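/- Proposition 3 (power of the $m$-carryover test). Fix integers $L,r\ge 1$, $0\le m<m_0\le rL$, and $q\in(0,1)$, $\mu\in\mathbb R$, $|\rho|<1$, $\alpha\in(0,1)$, and put $n=rL-m$. For each $J$ consider a switchback experiment with $T=rLJ$ periods: block $k=1,\dots,rJ$ is $\{(k-1)L+1,\dots,kL\}$, its label $W^{(k)}$ is Bernoulli$(q)$, the labels are independent, and $W_t=W^{(k)}$ for $t$ in block $k$. Pooled section $j=1,\dots,J$ is $[s_j,e_j]=\{(j-1)rL+1,\dots,jrL\}$. Outcomes are $Y_t=\mu+\sum_{\ell=0}^{m_0}\beta_\ell W_{t-\ell}+\varepsilon_t$, where $(\varepsilon_t)$ is independent of the labels and is a stationary AR(1) process $\varepsilon_t=\rho\varepsilon_{t-1}+u_t$ with $u_t$ i.i.d. of mean $0$ and finite variance $\sigma_u^2$. The coefficients $\beta=\beta^{(J)}$ may vary arbitrarily with $J$ (in particular they may be fixed, or local alternatives). Let $J_e=\lfloor J/2\rfloor$. For $j=1,\dots,J_e$ let $\bar Y_{2j}=\frac1n\sum_{t=s_{2j}+m}^{e_{2j}}Y_t$, let $Z_{2j-1}=W^{((2j-1)r)}$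 be the label of the last block of section $2j-1$, and let $$\hat\delta_m=\frac1{J_e}\sum_{j=1}^{J_e}\Big(\frac{Z_{2j-1}\bar Y_{2j}}{q}-\frac{(1-Z_{2j-1})\bar Y_{2j}}{1-q}\Big),\quad \widehat V=\frac1{J_e^2}\sum_{j=1}^{J_e}\bar Y_{2j}^2\Big(\frac{Z_{2j-1}}{q^2}+\frac{1-Z_{2j-1}}{(1-q)^2}\Big),\quad T_m=\frac{\hat\delta_m}{\sqrt{\widehat V}}.$$ The conditional randomization test (CRT) $\varphi_m$ compares $T_m$ with its randomization distribution, obtained by redrawing the labels of all blocks in odd sections from the design while holding the labels of the even sections and the outcomes in the even sections fixed. It rejects when the randomization $p$-value, i.e. the randomization probability of a value at least $T_m$, is at most $\alpha$, or alternatively when $T_m\ge c_{1-\alpha}$, the $(1-\alpha)$-quantile of the randomization distribution. Let $\bar Y(z)$, $z\in\{0,1\}$, be the focal mean of an even section when the label of the last block of the preceding odd section is set to $z$, all other labels and the errors following their original laws (the joint law does not depend on the section), and let $$\delta_m(n)=\frac1n\sum_{\ell=m+1}^{m_0}\min\{L,\ell-m\}\,\beta_\ell,\qquad v_{\mathrm{up}}=\frac{\mathbb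 E[\bar Y(1)^2]}{q}+\frac{\mathbb E[\bar Y(0)^2]}{1-q},$$ $$\sigma_\delta^2=\mathbb E\Big[\Big(\tfrac1q-1\Big)\bar Y(1)^2+\Big(\tfrac1{1-q}-1\Big)\bar Y(0)^2+2\bar Y(1)\bar Y(0)\Big],\qquad \mu_m(J)=\frac{\delta_m(n)\sqrt{J_e}}{\sqrt{v_{\mathrm{up}}}},\qquad \sigma_m^2=\frac{\sigma_\delta^2}{v_{\mathrm{up}}}.$$ Assume $\sigma_\delta^2>0$ for every $J$ (automatic if $\sigma_u^2>0$). Then, for either version of the test, as $J\to\infty$, $$\mathbb P(\varphi_m=1)-\Big\{1-\Phi\Big(\frac{z_{1-\alpha}-\mu_m(J)}{\sigma_m}\Big)\Big\}\longrightarrow 0,$$ where $\Phi$ is the standard normal distribution function and $z_{1-\alpha}$ its $(1-\alpha)$-quantile. -/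

import Mathlib

open MeasureTheory ProbabilityTheory Filter Topology

namespace Switchback

/-! ## Design

Times are `t = 1, 2, …`; design blocks are `k = 1, 2, …`, block `k` being `{(k-1)L+1, …, kL}`; pooled
sections are `j = 1, 2, …`, section `j` consisting of the blocks `(j-1)r+1, …, jr`, i.e. of the times
`(j-1)rL+1, …, jrL`.  A *label sequence* `w : ℕ → Bool` lists the treatments of the blocks
(`w 0` is never used).  An experiment with `J` pooled sections has `M = rJ` blocks and `T = rLJ`
periods, and only uses the labels `w 1, …, w (rJ)`. -/

/-- The law of the block labels: independent Bernoulli(`q`). -/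
noncomputable def design (q : unitInterval) : Measure (ℕ → Bool) :=
  Measure.infinitePi (fun _ : ℕ => bernoulliMeasure true false q)

/-- A treatment label as a real number in `{0, 1}`. -/
def label (b : Bool) : ℝ := if b then 1 else 0

/-- Treatment `w_t` in period `t`: the label of the block containing `t ≥ 1`.  Period `0` stands for
"before the experiment" and is untreated (with truncated subtraction, `t - ℓ = 0` when `ℓ ≥ t`; this
concerns only the first section, whose outcomes are never used). -/
def treatment (L : ℕ) (w : ℕ → Bool) (t : ℕ) : ℝ :=
  if t = 0 then 0 else label (w ((t - 1) / L + 1))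

/-- The block carrying the randomized label of pair `j`: the last block of section `2j - 1`. -/
def lastOddBlock (r j : ℕ) : ℕ := (2 * j - 1) * r

/-! ## Outcomes -/

/-- The distributed-lag outcome `Y_t(w) = μ + ∑_{ℓ=0}^{m₀} β_ℓ w_{t-ℓ} + ε_t`, where `e` is the
realized error path. -/
noncomputable def outcome (L m₀ : ℕ) (μ : ℝ) (β : ℕ → ℝ) (e : ℤ → ℝ) (w : ℕ → Bool) (t : ℕ) : ℝ :=
  μ + ∑ ℓ ∈ Finset.range (m₀ + 1), β ℓ * treatment L w (t - ℓ) + e (t : ℤ)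

/-- The focal mean of the series `y` in the even section `2j`: the average over the
`n = rL - m` periods `s_{2j} + m, …, e_{2j}`. -/
noncomputable def focalMean (L r m : ℕ) (y : ℕ → ℝ) (j : ℕ) : ℝ :=
  (∑ t ∈ Finset.Icc ((2 * j - 1) * (r * L) + 1 + m) (2 * j * (r * L)), y t) / ((r * L - m : ℕ) : ℝ)

/-- `Ȳ_{2j}(z)`: the focal mean of section `2j` when the last block of section `2j - 1` is set to `z`,
all other labels and the errors being left as they are. -/
noncomputable def potentialMean (L r m m₀ : ℕ) (μ : ℝ) (β : ℕ → ℝ) (j : ℕ) (z : Bool)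
    (e : ℤ → ℝ) (w : ℕ → Bool) : ℝ :=
  focalMean L r m (outcome L m₀ μ β e (Function.update w (lastOddBlock r j) z)) j

/-- `ε` is a stationary AR(1) process `ε_t = ρ ε_{t-1} + u_t` with i.i.d. innovations `u_t` of mean
zero and variance `σu²`.  (Mean zero and variance `σu²/(1-ρ²)` of `ε` follow when `|ρ| < 1`.) -/
structure IsStationaryAR1 {Ω : Type*} [MeasurableSpace Ω] (P : Measure Ω) (ρ σu : ℝ)
    (ε u : ℤ → Ω → ℝ) : Prop where
  measurable_error : ∀ t, Measurable (ε t)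
  measurable_innovation : ∀ t, Measurable (u t)
  indep : iIndepFun u P
  identDistrib : ∀ t, IdentDistrib (u t) (u 0) P P
  memLp : MemLp (u 0) 2 P
  mean_zero : ∫ ω, u 0 ω ∂P = 0
  variance_eq : ∫ ω, (u 0 ω) ^ 2 ∂P = σu ^ 2
  recursion : ∀ t, ∀ᵐ ω ∂P, ε t ω = ρ * ε (t - 1) ω + u t ω
  stationary : ∀ k : ℤ, IdentDistrib (fun ω t => ε (t + k) ω) (fun ω t => ε t ω) P P

/-! ## The test -/

/-- The Horvitz–Thompson contrast `δ̂_m` over the `⌊J/2⌋` pairs of sections, computed from the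
outcome series `y` (on the focal periods) and the block labels `w`. -/
noncomputable def deltaHat (L r m : ℕ) (q : ℝ) (J : ℕ) (y : ℕ → ℝ) (w : ℕ → Bool) : ℝ :=
  (∑ j ∈ Finset.Icc 1 (J / 2),
    (label (w (lastOddBlock r j)) * focalMean L r m y j / q
      - (1 - label (w (lastOddBlock r j))) * focalMean L r m y j / (1 - q))) / ((J / 2 : ℕ) : ℝ)

/-- The upper-bound variance estimator. -/
noncomputable def vUpHat (L r m : ℕ) (q : ℝ) (J : ℕ) (y : ℕ → ℝ) (w : ℕ → Bool) : ℝ :=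
  (∑ j ∈ Finset.Icc 1 (J / 2),
    focalMean L r m y j ^ 2
      * (label (w (lastOddBlock r j)) / q ^ 2
        + (1 - label (w (lastOddBlock r j))) / (1 - q) ^ 2)) / ((J / 2 : ℕ) : ℝ) ^ 2

/-- The studentized statistic `T_m`. -/
noncomputable def tStat (L r m : ℕ) (q : ℝ) (J : ℕ) (y : ℕ → ℝ) (w : ℕ → Bool) : ℝ :=
  deltaHat L r m q J y w / √(vUpHat L r m q J y w)

/-- Redrawing: keep the labels `w` on the blocks of even sections and take those of all other blocks
from `w'`.  (Block `k` lies in section `(k-1)/r + 1`.) -/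
def redraw (r : ℕ) (w w' : ℕ → Bool) (k : ℕ) : Bool :=
  if Even ((k - 1) / r + 1) then w k else w' k

/-- The randomization `p`-value: the probability, over labels redrawn from the design on the odd
sections with everything else (outcomes and even-section labels) held fixed, that the
statistic is at least as large as the observed one. -/
noncomputable def pValue (L r m : ℕ) (q : unitInterval) (J : ℕ) (y : ℕ → ℝ) (w : ℕ → Bool) : ℝ :=
  (design q).real {w' | tStat L r m q J y w ≤ tStat L r m q J y (redraw r w w')}

/-- The critical value of the test: the `(1 - α)`-quantile of the randomization distribution. -/
noncomputable def criticalValue (L r m : ℕ) (q : unitInterval) (α : ℝ) (J : ℕ) (y : ℕ → ℝ)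
    (w : ℕ → Bool) : ℝ :=
  sInf {x : ℝ | 1 - α ≤ (design q).real {w' | tStat L r m q J y (redraw r w w') ≤ x}}

/-! ## The quantities in the power approximation -/

/-- The standard normal distribution function `Φ`. -/
noncomputable def Phi (x : ℝ) : ℝ := cdf (gaussianReal 0 1) x

/-- The standard normal quantile `z_p`. -/
noncomputable def zQuantile (p : ℝ) : ℝ := sInf {x : ℝ | p ≤ Phi x}

/-- The tail signal `δ_m(n)`, `n = rL - m`. -/
noncomputable def tailSignal (L r m m₀ : ℕ) (β : ℕ → ℝ) : ℝ :=
  (∑ ℓ ∈ Finset.Icc (m + 1) m₀, ((min L (ℓ - m) : ℕ) : ℝ) * β ℓ) / ((r * L - m : ℕ) : ℝ)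

section Moments

variable {Ω : Type*} [MeasurableSpace Ω] (P : Measure Ω) (W : Ω → ℕ → Bool) (ε : ℤ → Ω → ℝ)
  (L r m m₀ : ℕ) (q μ : ℝ) (β : ℕ → ℝ)

/-- `Ȳ(z)` as a random variable, for the first pair of sections (its law is the same for all pairs). -/
noncomputable def YBar (z : Bool) (ω : Ω) : ℝ :=
  potentialMean L r m m₀ μ β 1 z (fun t => ε t ω) (W ω)

/-- `v_up = E[Ȳ(1)²]/q + E[Ȳ(0)²]/(1-q)`. -/
noncomputable def vUp : ℝ :=
  (∫ ω, YBar W ε L r m m₀ μ β true ω ^ 2 ∂P) / q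
    + (∫ ω, YBar W ε L r m m₀ μ β false ω ^ 2 ∂P) / (1 - q)

/-- `σ_δ² = E[(1/q - 1) Ȳ(1)² + (1/(1-q) - 1) Ȳ(0)² + 2 Ȳ(1) Ȳ(0)]`. -/
noncomputable def sigmaDeltaSq : ℝ :=
  ∫ ω, ((1 / q - 1) * YBar W ε L r m m₀ μ β true ω ^ 2
    + (1 / (1 - q) - 1) * YBar W ε L r m m₀ μ β false ω ^ 2
    + 2 * (YBar W ε L r m m₀ μ β true ω * YBar W ε L r m m₀ μ β false ω)) ∂P

/-- `μ_m(J) = δ_m(n) √J_e / √v_up` with `J_e = ⌊J/2⌋`. -/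
noncomputable def muM (J : ℕ) : ℝ :=
  tailSignal L r m m₀ β * √((J / 2 : ℕ) : ℝ) / √(vUp P W ε L r m m₀ q μ β)

/-- `σ_m = √(σ_δ² / v_up)`. -/
noncomputable def sigmaM : ℝ :=
  √(sigmaDeltaSq P W ε L r m m₀ q μ β / vUp P W ε L r m m₀ q μ β)

/-- The power approximation `1 - Φ((z_{1-α} - μ_m(J)) / σ_m)`. -/
noncomputable def powerApprox (α : ℝ) (J : ℕ) : ℝ :=
  1 - Phi ((zQuantile (1 - α) - muM P W ε L r m m₀ q μ β J) / sigmaM P W ε L r m m₀ q μ β)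

end Moments

end Switchback

open Switchback

set_option linter.unusedSectionVars false

namespace Switchback

/-! Because `m₀ ≤ r * L`, lags reach back at most one section, so the focal mean of an even section
depends only on the errors and on the labels of its own pair of sections, and it is affine in those
labels. Let `X_j` be the standardized label of the last block of the odd section of pair `j`. The
contrast of the pair is then exactly `δ + √(q(1-q)) C_j X_j`, where `δ` is the tail signal and `C_j
= Ȳ(1)/q + Ȳ(0)/(1-q)` involves none of the labels `X_1, X_2, …` (`pair_decomposition`,
`contrastCoeff_update`). Given the errors and all other labels, the noise is therefore a sum of
i.i.d. standardized variables with fixed weights. It is asymptotically normal as soon as no weight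
dominates (`exists_weight_bound_linear`), and integrating out the conditioning preserves this
(`abs_real_sub_le_of_resample`). The same central limit theorem, with the observed focal means as
weights, shows that the randomization distribution is asymptotically standard normal
(`exists_weight_bound_studentized`), so both versions of the test compare the statistic with a
threshold close to `z_{1-α}`.

The random normalizations are handled by a law of large numbers: the variance estimator divided by
`v_up / J_e` tends to 1, and `q(1-q) ∑ C_j² / (J_e v_up)` is asymptotically `σ_m²`. Since the
coefficients vary arbitrarily with `J`, these limits must be uniform in them. This rests on a bound
of all label parts by a multiple of `√v_up` (`exists_abs_labelMean_le`): a Bernoulli label with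
weight `a` contributes `q(1-q)a²` to a second moment. After division by `√v_up` the summands are
functions of the pair's labels and error mean with one common quadratic bound, and the law of large
numbers holds uniformly over such functions (`exists_forall_integral_abs_average_sub_le`). Its proof
truncates the errors, both in size and to finitely many innovations, which makes distant pairs
independent. Second moments suffice throughout, also for the absence of a dominating weight, since
`N P(E² > aN) → 0`.

The identity `v_up = σ_δ² + δ²` gives `σ_m² = 1 - μ_m(J)² / J_e`. It is enough to treat subsequences
along which `μ_m(J)` converges in `[-∞, ∞]`. For a finite limit `b`, `σ_m → 1` and both the power
and its approximation tend to `1 - Φ(z - b)`. For an infinite limit the noise stays tight, while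
`σ_m ≤ 1` in the approximation, and both tend to 1 or to 0. Small values of `σ_m` thus never need a
limit law of their own. -/

/-! ### The standard normal distribution function and its quantiles. -/

lemma continuous_Phi : Continuous Phi := by
  have h : Phi = fun x => (gaussianReal 0 1).real (Set.Iic x) := by
    ext x; exact cdf_eq_real _ x
  have hna : NullSingletonClass (gaussianReal 0 1) := nullSingletonClass_gaussianReal one_ne_zero
  rw [continuous_iff_continuousAt]
  intro x
  have hr : ContinuousWithinAt (cdf (gaussianReal 0 1)) (Set.Ici x) x := (cdf _).right_continuous x
  have hl : ContinuousWithinAt (cdf (gaussianReal 0 1)) (Set.Iic x) x := by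
    have h1 := (cdf (gaussianReal 0 1)).measure_singleton x
    rw [measure_cdf, measure_singleton] at h1
    have h2 := ENNReal.ofReal_eq_zero.1 h1.symm
    have h3 : Function.leftLim (cdf (gaussianReal 0 1)) x = cdf (gaussianReal 0 1) x :=
      le_antisymm ((monotone_cdf _).leftLim_le le_rfl) (by linarith)
    exact continuousWithinAt_Iio_iff_Iic.1
      ((monotone_cdf _).continuousWithinAt_Iio_iff_leftLim_eq.2 h3)
  exact continuousAt_iff_continuous_left_right.2 ⟨hl, hr⟩

/-- Lebesgue measure is absolutely continuous with respect to the Gaussian law, so nonempty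
intervals have positive Gaussian mass. -/
lemma strictMono_Phi : StrictMono Phi := by
  intro x y hxy
  have h : (0 : ENNReal) < gaussianReal 0 1 (Set.Ioc x y) := by
    rw [pos_iff_ne_zero]
    intro h0
    have := gaussianReal_absolutelyContinuous' 0 (one_ne_zero (α := NNReal)) h0
    simp at this
    linarith
  have h1 := (cdf (gaussianReal 0 1)).measure_Ioc x y
  rw [measure_cdf] at h1
  rw [h1, ENNReal.ofReal_pos] at h
  exact sub_pos.1 h

lemma tendsto_Phi_atTop : Tendsto Phi atTop (𝓝 1) := tendsto_cdf_atTop _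

lemma tendsto_Phi_atBot : Tendsto Phi atBot (𝓝 0) := tendsto_cdf_atBot _

lemma Phi_nonneg (x : ℝ) : 0 ≤ Phi x := cdf_nonneg _ x

lemma Phi_le_one (x : ℝ) : Phi x ≤ 1 := cdf_le_one _ x

lemma Phi_zQuantile {p : ℝ} (hp0 : 0 < p) (hp1 : p < 1) : Phi (zQuantile p) = p := by
  obtain ⟨a, ha⟩ := (tendsto_Phi_atBot.eventually (gt_mem_nhds hp0)).exists
  obtain ⟨b, hb⟩ := (tendsto_Phi_atTop.eventually (lt_mem_nhds hp1)).exists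
  obtain ⟨c, hc⟩ := mem_range_of_exists_le_of_exists_ge continuous_Phi ⟨a, ha.le⟩ ⟨b, hb.le⟩
  have : {x : ℝ | p ≤ Phi x} = Set.Ici c := by
    ext x
    simp [← hc, strictMono_Phi.le_iff_le]
  rw [zQuantile, this, csInf_Ici, hc]

/-! ### A central limit theorem for weighted sums. -/

section WeightedCLT

variable {Ω : Type*} [MeasurableSpace Ω] {P : Measure Ω} [IsProbabilityMeasure P]

/-- Two finite products of complex numbers of modulus at most one differ by at most the sum of the
differences of the factors. -/
lemma norm_prod_sub_prod_le {ι : Type*} (s : Finset ι) (f g : ι → ℂ)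
    (hf : ∀ i ∈ s, ‖f i‖ ≤ 1) (hg : ∀ i ∈ s, ‖g i‖ ≤ 1) :
    ‖∏ i ∈ s, f i - ∏ i ∈ s, g i‖ ≤ ∑ i ∈ s, ‖f i - g i‖ := by
  classical
  induction s using Finset.induction_on with
  | empty => simp
  | insert a s ha ih =>
    rw [Finset.prod_insert ha, Finset.prod_insert ha, Finset.sum_insert ha]
    have h1 : f a * ∏ i ∈ s, f i - g a * ∏ i ∈ s, g i
        = (f a - g a) * ∏ i ∈ s, f i + g a * (∏ i ∈ s, f i - ∏ i ∈ s, g i) := by ring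
    rw [h1]
    have h2 : ‖∏ i ∈ s, f i‖ ≤ 1 := by
      rw [norm_prod]
      exact Finset.prod_le_one (fun _ _ => norm_nonneg _)
        (fun i hi => hf i (Finset.mem_insert_of_mem hi))
    have h3 := ih (fun i hi => hf i (Finset.mem_insert_of_mem hi))
      (fun i hi => hg i (Finset.mem_insert_of_mem hi))
    have h4 := hg a (Finset.mem_insert_self _ _)
    calc _ ≤ ‖(f a - g a) * ∏ i ∈ s, f i‖ + ‖g a * (∏ i ∈ s, f i - ∏ i ∈ s, g i)‖ := norm_add_le _ _
      _ ≤ ‖f a - g a‖ * 1 + 1 * ∑ i ∈ s, ‖f i - g i‖ := by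
        rw [norm_mul, norm_mul]; gcongr
      _ = _ := by ring

/-- **Central limit theorem for weighted sums** of i.i.d. standardized variables, when the largest
weight tends to zero. -/
theorem tendsto_measureReal_weightedSum_le {X : ℕ → Ω → ℝ} (hindep : iIndepFun X P)
    (hident : ∀ i, IdentDistrib (X i) (X 0) P P) (h0 : P[X 0] = 0) (h1 : P[X 0 ^ 2] = 1)
    {s : ℕ → Finset ℕ} {a : ℕ → ℕ → ℝ} (hsum : ∀ k, ∑ j ∈ s k, a k j ^ 2 = 1) {δ : ℕ → ℝ}
    (hδ : Tendsto δ atTop (𝓝 0)) (hmax : ∀ k, ∀ j ∈ s k, |a k j| ≤ δ k) (t : ℝ) :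
    Tendsto (fun k => P.real {ω | ∑ j ∈ s k, a k j * X j ω ≤ t}) atTop (𝓝 (Phi t)) := by
  have mX i := (hident i).aemeasurable_fst
  have mS k : AEMeasurable (fun ω => ∑ j ∈ s k, a k j * X j ω) P :=
    Finset.aemeasurable_fun_sum _ fun j _ => (mX j).const_mul _
  let ν : ℕ → ProbabilityMeasure ℝ := fun k =>
    ⟨P.map (fun ω => ∑ j ∈ s k, a k j * X j ω), Measure.isProbabilityMeasure_map (mS k)⟩
  let γ : ProbabilityMeasure ℝ := ⟨gaussianReal 0 1, inferInstance⟩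
  set φ := charFun (P.map (X 0)) with hφ
  have hpX : IsProbabilityMeasure (P.map (X 0)) := Measure.isProbabilityMeasure_map (mX 0)
  have hcf k (t : ℝ) : charFun (ν k : Measure ℝ) t = ∏ j ∈ s k, φ (a k j * t) := by
    have hi : iIndepFun (fun j ω => a k j * X j ω) P :=
      hindep.comp (fun j x => a k j * x) (fun j => by fun_prop)
    change charFun (P.map (fun ω => ∑ j ∈ s k, a k j * X j ω)) t = _
    rw [(hi.restrict _).charFun_map_fun_finsetSum_eq_prod (fun j _ => (mX j).const_mul _)]
    simp only [Finset.prod_apply]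
    refine Finset.prod_congr rfl fun j _ => ?_
    rw [charFun_map_mul_comp (mX j), (hident j).map_eq]
  have hγ (t : ℝ) : charFun (gaussianReal 0 1) t = Complex.exp (-(t : ℂ) ^ 2 / 2) := by
    simp [charFun_gaussianReal, neg_div]
  -- The two laws share their first two moments, so their characteristic functions agree to second
  -- order at the origin.
  have hlittle : (fun t => φ t - charFun (gaussianReal 0 1) t) =o[𝓝 0] fun t : ℝ => t ^ 2 := by
    have e1 := taylor_charFun_two (mX 0) h0 h1
    have e2 := taylor_charFun_two (P := gaussianReal 0 1) (X := id) aemeasurable_id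
      (by simp) (by
        have := variance_fun_id_gaussianReal (μ := 0) (v := 1)
        rw [variance_eq_integral (by fun_prop)] at this
        simpa using this)
    rw [Measure.map_id] at e2
    refine (e1.sub e2).congr_left fun t => ?_
    ring
  have key : Tendsto ν atTop (𝓝 γ) := by
    refine ProbabilityMeasure.tendsto_iff_tendsto_charFun.2 fun t => ?_
    change Tendsto _ _ (𝓝 (charFun (gaussianReal 0 1) t))
    rw [Metric.tendsto_atTop]
    intro η hη
    -- With this constant the errors of the factors, each at most the constant times `a_j² t²`, add
    -- up to at most `η / 2`.
    have hc : 0 < η / (2 * (t ^ 2 + 1)) := by positivity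
    have e1 := hlittle.def hc
    rw [Metric.eventually_nhds_iff] at e1
    obtain ⟨d, hd, e1⟩ := e1
    have e2 : ∀ᶠ k in atTop, δ k * |t| < d := by
      have : Tendsto (fun k => δ k * |t|) atTop (𝓝 0) := by simpa using hδ.mul_const |t|
      exact this.eventually (gt_mem_nhds hd)
    obtain ⟨n, hn⟩ := eventually_atTop.1 e2
    refine ⟨n, fun k hk => ?_⟩
    -- As the squared weights sum to one, the Gaussian characteristic function factors along the
    -- same weights and can be compared factor by factor.
    have hprod : charFun (gaussianReal 0 1) t
        = ∏ j ∈ s k, charFun (gaussianReal 0 1) (a k j * t) := by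
      simp_rw [hγ]
      rw [← Complex.exp_sum]
      congr 1
      have : ∑ j ∈ s k, -((a k j * t : ℝ) : ℂ) ^ 2 / 2
          = ((∑ j ∈ s k, a k j ^ 2 : ℝ) : ℂ) * (-(t : ℂ) ^ 2 / 2) := by
        push_cast
        rw [Finset.sum_mul]
        exact Finset.sum_congr rfl fun j _ => by ring
      rw [this, hsum k]; simp
    rw [dist_eq_norm, hcf, hprod]
    calc _ ≤ ∑ j ∈ s k, ‖φ (a k j * t) - charFun (gaussianReal 0 1) (a k j * t)‖ :=
          norm_prod_sub_prod_le _ _ _ (fun _ _ => norm_charFun_le_one _)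
            (fun _ _ => norm_charFun_le_one _)
      _ ≤ ∑ j ∈ s k, η / (2 * (t ^ 2 + 1)) * (a k j ^ 2 * t ^ 2) := by
          refine Finset.sum_le_sum fun j hj => ?_
          have hdist : dist (a k j * t) 0 < d := by
            rw [dist_zero_right, Real.norm_eq_abs, abs_mul]
            exact (mul_le_mul_of_nonneg_right (hmax k j hj) (abs_nonneg t)).trans_lt (hn k hk)
          have := e1 hdist
          rw [Real.norm_eq_abs, abs_of_nonneg (sq_nonneg _), mul_pow] at this
          exact this
      _ = η / (2 * (t ^ 2 + 1)) * t ^ 2 := by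
          rw [← Finset.mul_sum, ← Finset.sum_mul, hsum k, one_mul]
      _ < η := by
          rw [div_mul_eq_mul_div, div_lt_iff₀ (by positivity)]
          nlinarith [sq_nonneg t]
  have hna : NullSingletonClass (gaussianReal 0 1) := nullSingletonClass_gaussianReal one_ne_zero
  have hlim := ProbabilityMeasure.tendsto_measure_of_null_frontier_of_tendsto' key
    (E := Set.Iic t) (by
      change gaussianReal 0 1 _ = 0
      rw [frontier_Iic]; exact measure_singleton _)
  have hlim' := (ENNReal.tendsto_toReal (measure_ne_top _ _)).comp hlim
  have hPhi : Phi t = ((γ : Measure ℝ) (Set.Iic t)).toReal := cdf_eq_real _ t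
  rw [hPhi]
  refine hlim'.congr fun k => ?_
  change ((P.map (fun ω => ∑ j ∈ s k, a k j * X j ω)) (Set.Iic t)).toReal = _
  rw [Measure.map_apply_of_aemeasurable (mS k) measurableSet_Iic]
  rfl

end WeightedCLT


/-! ## Convergence in probability -/

/-- Convergence in probability to a constant. -/
def TendstoProb {Ω ι : Type*} [MeasurableSpace Ω] (P : Measure Ω) (l : Filter ι) (B : ι → Ω → ℝ)
    (b : ℝ) : Prop :=
  ∀ η > 0, Tendsto (fun k => P.real {ω | η ≤ |B k ω - b|}) l (𝓝 0)

section Prob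

variable {Ω ι : Type*} [MeasurableSpace Ω] {P : Measure Ω} [IsProbabilityMeasure P]
  {l : Filter ι}

lemma tendsto_zero_of_le_real {f g : ι → ℝ} (hf : ∀ k, 0 ≤ f k) (hfg : ∀ᶠ k in l, f k ≤ g k)
    (hg : Tendsto g l (𝓝 0)) : Tendsto f l (𝓝 0) :=
  tendsto_of_tendsto_of_tendsto_of_le_of_le' tendsto_const_nhds hg (Eventually.of_forall hf) hfg

lemma real_le_add {s t u : Set Ω} (h : s ⊆ t ∪ u) : P.real s ≤ P.real t + P.real u :=
  (measureReal_mono h).trans (measureReal_union_le _ _)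

lemma real_union_tendsto_zero {s t : ι → Set Ω} (hs : Tendsto (fun k => P.real (s k)) l (𝓝 0))
    (ht : Tendsto (fun k => P.real (t k)) l (𝓝 0)) :
    Tendsto (fun k => P.real (s k ∪ t k)) l (𝓝 0) := by
  refine tendsto_zero_of_le_real (fun _ => measureReal_nonneg)
    (Eventually.of_forall fun k => measureReal_union_le _ _) ?_
  simpa using hs.add ht

lemma real_subset_tendsto_zero {s t : ι → Set Ω} (hst : ∀ᶠ k in l, s k ⊆ t k)
    (ht : Tendsto (fun k => P.real (t k)) l (𝓝 0)) :
    Tendsto (fun k => P.real (s k)) l (𝓝 0) :=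
  tendsto_zero_of_le_real (fun _ => measureReal_nonneg)
    (hst.mono fun k hk => measureReal_mono hk) ht

/-- If `A k` converges in law with continuous limit distribution function `F`, if `B k → b` in
probability, and if `E k` agrees with `A k ≤ B k` up to equality and up to negligible events, then
`P (E k) → F b`. -/
lemma tendsto_real_of_le_of_tendstoProb {A B : ι → Ω → ℝ} {F : ℝ → ℝ} {b : ℝ}
    (hA : ∀ t, Tendsto (fun k => P.real {ω | A k ω ≤ t}) l (𝓝 (F t))) (hF : Continuous F)
    (hB : TendstoProb P l B b) {E N : ι → Set Ω}
    (hN : Tendsto (fun k => P.real (N k)) l (𝓝 0))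
    (h1 : ∀ k, ∀ ω ∉ N k, ω ∈ E k → A k ω ≤ B k ω)
    (h2 : ∀ k, ∀ ω ∉ N k, A k ω < B k ω → ω ∈ E k) :
    Tendsto (fun k => P.real (E k)) l (𝓝 (F b)) := by
  rw [Metric.tendsto_nhds]
  intro e he
  obtain ⟨d, hd, hFd⟩ := Metric.continuousAt_iff.1 hF.continuousAt (e / 3) (by positivity)
  have hbd : Tendsto (fun k => P.real ({ω | d / 2 ≤ |B k ω - b|} ∪ N k)) l (𝓝 0) :=
    real_union_tendsto_zero (hB (d / 2) (by positivity)) hN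
  have e1 := Metric.tendsto_nhds.1 (hA (b + d / 2)) (e / 3) (by positivity)
  have e2 := Metric.tendsto_nhds.1 (hA (b - d / 2)) (e / 3) (by positivity)
  have e3 := Metric.tendsto_nhds.1 hbd (e / 3) (by positivity)
  have f1 : |F (b + d / 2) - F b| < e / 3 := hFd (by simp [abs_of_pos hd]; linarith)
  have f2 : |F (b - d / 2) - F b| < e / 3 := hFd (by simp [abs_of_pos hd]; linarith)
  filter_upwards [e1, e2, e3] with k g1 g2 g3
  have i1 : P.real (E k) ≤ P.real {ω | A k ω ≤ b + d / 2}
      + P.real ({ω | d / 2 ≤ |B k ω - b|} ∪ N k) := by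
    refine real_le_add fun ω hω => ?_
    by_cases hb : ω ∈ {ω | d / 2 ≤ |B k ω - b|} ∪ N k
    · exact Or.inr hb
    · left
      simp only [Set.mem_union, not_or, Set.mem_ofPred_eq, not_le] at hb
      have := h1 k ω hb.2 hω
      have := (abs_lt.1 hb.1).2
      simp only [Set.mem_ofPred_eq]; linarith
  have i2 : P.real {ω | A k ω ≤ b - d / 2} ≤ P.real (E k)
      + P.real ({ω | d / 2 ≤ |B k ω - b|} ∪ N k) := by
    refine real_le_add fun ω hω => ?_
    by_cases hb : ω ∈ {ω | d / 2 ≤ |B k ω - b|} ∪ N k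
    · exact Or.inr hb
    · left
      simp only [Set.mem_union, not_or, Set.mem_ofPred_eq, not_le] at hb hω
      have := (abs_lt.1 hb.1).1
      exact h2 k ω hb.2 (by linarith)
  rw [Real.dist_eq] at *
  rw [abs_lt] at *
  constructor <;> linarith [g1.1, g1.2, g2.1, g2.2, g3.1, g3.2, f1.1, f1.2, f2.1, f2.2]

/-- Convergence in probability from convergence of the first absolute moments. -/
lemma TendstoProb.of_integral {B : ι → Ω → ℝ} {b : ℝ}
    (hint : ∀ᶠ k in l, Integrable (B k) P)
    (h : Tendsto (fun k => ∫ ω, |B k ω - b| ∂P) l (𝓝 0)) : TendstoProb P l B b := by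
  intro η hη
  refine tendsto_zero_of_le_real (g := fun k => η⁻¹ * ∫ ω, |B k ω - b| ∂P)
    (fun _ => measureReal_nonneg) ?_ (by simpa using h.const_mul η⁻¹)
  filter_upwards [hint] with k hk
  have := mul_meas_ge_le_integral_of_nonneg (μ := P) (f := fun ω => |B k ω - b|)
    (Eventually.of_forall fun _ => abs_nonneg _) (hk.sub (integrable_const b)).abs η
  rw [inv_mul_eq_div, le_div_iff₀ hη, mul_comm]
  exact this

lemma TendstoProb.congr_limit {B : ι → Ω → ℝ} {c : ι → ℝ} {b : ℝ}
    (hc : Tendsto c l (𝓝 b)) (h : TendstoProb P l (fun k ω => B k ω - c k) 0) :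
    TendstoProb P l B b := by
  intro η hη
  refine real_subset_tendsto_zero ?_ (h (η / 2) (by positivity))
  filter_upwards [Metric.tendsto_nhds.1 hc (η / 2) (by positivity)] with k hk ω hω
  simp only [Set.mem_ofPred_eq, sub_zero] at *
  rw [Real.dist_eq] at hk
  have := abs_sub_le (B k ω) (c k) b
  linarith

/-- Continuous mapping, for convergence in probability to constants. -/
lemma TendstoProb.map₂ {B C : ι → Ω → ℝ} {b c : ℝ} (hB : TendstoProb P l B b)
    (hC : TendstoProb P l C c) {f : ℝ → ℝ → ℝ}
    (hf : ContinuousAt (Function.uncurry f) (b, c)) :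
    TendstoProb P l (fun k ω => f (B k ω) (C k ω)) (f b c) := by
  intro η hη
  obtain ⟨d, hd, h⟩ := Metric.continuousAt_iff.1 hf η hη
  refine real_subset_tendsto_zero (Eventually.of_forall fun k => ?_)
    (real_union_tendsto_zero (hB d hd) (hC d hd))
  intro ω hω
  by_contra hn
  simp only [Set.mem_union, not_or, Set.mem_ofPred_eq, not_le] at hn hω
  have h3 := h (x := (B k ω, C k ω)) (by
    rw [Prod.dist_eq]
    exact max_lt hn.1 hn.2)
  rw [Real.dist_eq] at h3
  simp only [Function.uncurry] at h3
  linarith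

lemma TendstoProb.map {B : ι → Ω → ℝ} {b : ℝ} (hB : TendstoProb P l B b) {f : ℝ → ℝ}
    (hf : ContinuousAt f b) : TendstoProb P l (fun k ω => f (B k ω)) (f b) :=
  TendstoProb.map₂ hB hB (f := fun x _ => f x)
    (ContinuousAt.comp (f := Prod.fst) (x := (b, b)) hf continuousAt_fst)

lemma tendstoProb_const {c : ι → ℝ} {b : ℝ} (hc : Tendsto c l (𝓝 b)) :
    TendstoProb P l (fun k _ => c k) b := by
  refine TendstoProb.congr_limit hc fun η hη => ?_
  refine real_subset_tendsto_zero (t := fun _ => ∅) (Eventually.of_forall fun k ω hω => ?_)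
    (by simpa using tendsto_const_nhds)
  simp only [Set.mem_ofPred_eq, sub_self, abs_zero] at hω
  linarith

lemma TendstoProb.comp {ι' : Type*} {l' : Filter ι'} {B : ι → Ω → ℝ} {b : ℝ}
    (hB : TendstoProb P l B b) {g : ι' → ι} (hg : Tendsto g l' l) :
    TendstoProb P l' (fun k => B (g k)) b :=
  fun η hη => (hB η hη).comp hg

end Prob

/-! ## The design -/

instance (q : unitInterval) : IsProbabilityMeasure (design q) := by
  unfold design; infer_instance

lemma measurable_label : Measurable label := measurable_from_top

/-- A standardized label. -/
noncomputable def stdLabel (q : ℝ) (b : Bool) : ℝ := (label b - q) / √(q * (1 - q))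

lemma measurable_stdLabel (q : ℝ) : Measurable (stdLabel q) := measurable_from_top

section Design

variable {q : unitInterval}

lemma integral_design_eval (f : Bool → ℝ) (k : ℕ) :
    ∫ w, f (w k) ∂(design q) = q * f true + (1 - q) * f false := by
  have h1 := Measure.infinitePi_map_eval (fun _ : ℕ => bernoulliMeasure true false q) k
  have h2 : ∫ w, f (w k) ∂(design q) = ∫ b, f b ∂((design q).map (fun w => w k)) :=
    (integral_map (measurable_pi_apply k).aemeasurable measurable_from_top.aestronglyMeasurable).symm
  rw [h2, design]
  erw [h1]
  rw [integral_bernoulliMeasure]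
  simp

lemma iIndepFun_design_eval : iIndepFun (fun (k : ℕ) (w : ℕ → Bool) => w k) (design q) :=
  iIndepFun_infinitePi (P := fun _ : ℕ => bernoulliMeasure true false q)
    (X := fun _ b => b) (fun _ => measurable_id)

lemma iIndepFun_stdLabel {c : ℕ → ℕ} (hc : c.Injective) :
    iIndepFun (fun j (w : ℕ → Bool) => stdLabel q (w (c j))) (design q) :=
  (iIndepFun_design_eval.precomp hc).comp (fun _ => stdLabel q) (fun _ => measurable_stdLabel _)

lemma identDistrib_stdLabel (i j : ℕ) :
    IdentDistrib (fun (w : ℕ → Bool) => stdLabel q (w i)) (fun w => stdLabel q (w j))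
      (design q) (design q) := by
  have h : IdentDistrib (fun (w : ℕ → Bool) => w i) (fun w => w j) (design q) (design q) := by
    refine ⟨(measurable_pi_apply i).aemeasurable, (measurable_pi_apply j).aemeasurable, ?_⟩
    have h1 := Measure.infinitePi_map_eval (fun _ : ℕ => bernoulliMeasure true false q) i
    have h2 := Measure.infinitePi_map_eval (fun _ : ℕ => bernoulliMeasure true false q) j
    exact h1.trans h2.symm
  exact h.comp (measurable_stdLabel q)

lemma integral_stdLabel (k : ℕ) : ∫ w, stdLabel q (w k) ∂(design q) = 0 := by
  rw [integral_design_eval (stdLabel q)]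
  simp only [stdLabel, label]
  simp
  ring

lemma stdLabel_sq_mean (hq0 : 0 < (q : ℝ)) (hq1 : (q : ℝ) < 1) (k : ℕ) :
    ∫ w, stdLabel q (w k) ^ 2 ∂(design q) = 1 := by
  rw [integral_design_eval (fun b => stdLabel q b ^ 2)]
  have hpos : 0 < (q : ℝ) * (1 - q) := mul_pos hq0 (by linarith)
  simp only [stdLabel, label, div_pow, Real.sq_sqrt hpos.le]
  simp
  have : (1 - (q : ℝ)) ≠ 0 := by linarith
  field_simp
  ring

lemma integrable_of_bdd {Ω : Type*} [MeasurableSpace Ω] {P : Measure Ω} [IsFiniteMeasure P]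
    {f : Ω → ℝ} (hf : Measurable f) (C : ℝ) (h : ∀ ω, |f ω| ≤ C) : Integrable f P :=
  Integrable.of_bound hf.aestronglyMeasurable C (Eventually.of_forall h)

lemma exists_bound_bool (f : Bool → ℝ) : ∃ C, ∀ b, |f b| ≤ C :=
  ⟨|f true| + |f false|, fun b => by cases b <;> simp⟩

/-- Second moment of a weighted sum of standardized labels. -/
lemma integral_sq_weightedSum (hq0 : 0 < (q : ℝ)) (hq1 : (q : ℝ) < 1) {c : ℕ → ℕ}
    (hc : c.Injective) (s : Finset ℕ) (b : ℕ → ℝ) :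
    ∫ w, (∑ j ∈ s, b j * stdLabel q (w (c j))) ^ 2 ∂(design q) = ∑ j ∈ s, b j ^ 2 := by
  obtain ⟨C, hC⟩ := exists_bound_bool (stdLabel q)
  have hC0 : 0 ≤ C := (abs_nonneg _).trans (hC true)
  have hm (j : ℕ) : Measurable (fun w : ℕ → Bool => stdLabel q (w (c j))) :=
    (measurable_stdLabel q).comp (measurable_pi_apply _)
  have hi (i j : ℕ) : Integrable (fun w : ℕ → Bool => stdLabel q (w (c i)) * stdLabel q (w (c j)))
      (design q) := by
    refine integrable_of_bdd ((hm i).mul (hm j)) (C * C) fun w => ?_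
    rw [abs_mul]
    exact mul_le_mul (hC _) (hC _) (abs_nonneg _) hC0
  have hval (i j : ℕ) : ∫ w, stdLabel q (w (c i)) * stdLabel q (w (c j)) ∂(design q)
      = if i = j then 1 else 0 := by
    split_ifs with h
    · subst h
      simp_rw [← pow_two]
      exact stdLabel_sq_mean hq0 hq1 _
    · rw [((iIndepFun_stdLabel (q := q) hc).indepFun h).integral_fun_mul_eq_mul_integral
        (hm i).aestronglyMeasurable (hm j).aestronglyMeasurable, integral_stdLabel, zero_mul]
  have hexp (w : ℕ → Bool) : (∑ j ∈ s, b j * stdLabel q (w (c j))) ^ 2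
      = ∑ i ∈ s, ∑ j ∈ s, b i * b j * (stdLabel q (w (c i)) * stdLabel q (w (c j))) := by
    rw [pow_two, Finset.sum_mul_sum]
    exact Finset.sum_congr rfl fun i _ => Finset.sum_congr rfl fun j _ => by ring
  simp_rw [hexp]
  rw [integral_finsetSum _ fun i _ => integrable_finsetSum _ fun j _ => (hi i j).const_mul _]
  refine Finset.sum_congr rfl fun i his => ?_
  rw [integral_finsetSum _ fun j _ => (hi i j).const_mul _]
  simp_rw [integral_const_mul, hval]
  simp [his, pow_two]

/-- Chebyshev's inequality for weighted sums of standardized labels. -/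
lemma design_abs_weightedSum_ge (hq0 : 0 < (q : ℝ)) (hq1 : (q : ℝ) < 1) {c : ℕ → ℕ}
    (hc : c.Injective) (s : Finset ℕ) (b : ℕ → ℝ) {a : ℝ} (ha : 0 < a) :
    (design q).real {w | a ≤ |∑ j ∈ s, b j * stdLabel q (w (c j))|} ≤ (∑ j ∈ s, b j ^ 2) / a ^ 2 := by
  obtain ⟨C, hC⟩ := exists_bound_bool (stdLabel q)
  have hm : Measurable (fun w : ℕ → Bool => ∑ j ∈ s, b j * stdLabel q (w (c j))) :=
    Finset.measurable_fun_sum _ fun j _ =>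
      ((measurable_stdLabel q).comp (measurable_pi_apply _)).const_mul _
  have hbd : ∀ w : ℕ → Bool, |∑ j ∈ s, b j * stdLabel q (w (c j))| ≤ ∑ j ∈ s, |b j| * C := by
    intro w
    refine (Finset.abs_sum_le_sum_abs _ _).trans (Finset.sum_le_sum fun j _ => ?_)
    rw [abs_mul]
    exact mul_le_mul_of_nonneg_left (hC _) (abs_nonneg _)
  have hint : Integrable (fun w : ℕ → Bool => (∑ j ∈ s, b j * stdLabel q (w (c j))) ^ 2)
      (design q) := by
    refine integrable_of_bdd (hm.pow_const 2) ((∑ j ∈ s, |b j| * C) ^ 2) fun w => ?_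
    rw [abs_pow]
    exact pow_le_pow_left₀ (abs_nonneg _) (hbd w) 2
  have := mul_meas_ge_le_integral_of_nonneg (μ := design q)
    (f := fun w => (∑ j ∈ s, b j * stdLabel q (w (c j))) ^ 2)
    (Eventually.of_forall fun _ => sq_nonneg _) hint (a ^ 2)
  rw [integral_sq_weightedSum hq0 hq1 hc] at this
  rw [le_div_iff₀ (by positivity), mul_comm]
  refine le_trans (mul_le_mul_of_nonneg_left (measureReal_mono fun w hw => ?_) (by positivity)) this
  simp only [Set.mem_ofPred_eq] at *
  rw [← sq_abs (∑ j ∈ s, _)]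
  exact pow_le_pow_left₀ ha.le hw 2

/-- The linear statistic is asymptotically standard normal, uniformly over weights none of which
dominates. -/
lemma exists_weight_bound_linear (hq0 : 0 < (q : ℝ)) (hq1 : (q : ℝ) < 1) {c : ℕ → ℕ}
    (hc : c.Injective) (t : ℝ) {η : ℝ} (hη : 0 < η) :
    ∃ κ > 0, ∀ (s : Finset ℕ) (x : ℕ → ℝ), (∀ j ∈ s, x j ^ 2 ≤ κ * ∑ i ∈ s, x i ^ 2) →
      0 < ∑ i ∈ s, x i ^ 2 →
      |(design q).real {w | (∑ j ∈ s, x j * stdLabel q (w (c j))) / √(∑ i ∈ s, x i ^ 2) ≤ t}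
        - Phi t| ≤ η := by
  -- If no `κ` worked, the failures for `κ = 1/(n+1)` would form a sequence of weights to which the
  -- central limit theorem applies, a contradiction.
  by_contra! hcon
  choose s x hx hpos hbad using fun n : ℕ => hcon (1 / ((n : ℝ) + 1)) (by positivity)
  have hlim := tendsto_measureReal_weightedSum_le (P := design q)
    (X := fun j w => stdLabel q (w (c j))) (iIndepFun_stdLabel hc)
    (fun i => identDistrib_stdLabel _ _) (integral_stdLabel _) (stdLabel_sq_mean hq0 hq1 _)
    (s := s) (a := fun n j => x n j / √(∑ i ∈ s n, x n i ^ 2))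
    (fun n => by
      simp_rw [div_pow, Real.sq_sqrt (hpos n).le]
      rw [← Finset.sum_div, div_self (hpos n).ne'])
    (δ := fun n : ℕ => √(1 / ((n : ℝ) + 1)))
    (by
      have := tendsto_one_div_add_atTop_nhds_zero_nat (𝕜 := ℝ)
      exact (Real.sqrt_zero ▸ Real.continuous_sqrt.tendsto 0).comp this)
    (fun n j hj => by
      rw [abs_div, abs_of_nonneg (Real.sqrt_nonneg _), div_le_iff₀ (Real.sqrt_pos.2 (hpos n)),
        ← Real.sqrt_mul (by positivity)]
      exact Real.abs_le_sqrt (hx n j hj)) t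
  obtain ⟨n, hn⟩ := (Metric.tendsto_atTop.1 hlim η hη)
  have h1 := hn n le_rfl
  have h2 := hbad n
  rw [Real.dist_eq] at h1
  simp_rw [Finset.sum_div] at h2
  simp_rw [div_mul_eq_mul_div] at h1
  linarith

end Design


/-! ## The randomization distribution -/

/-- The studentized Horvitz–Thompson contrast of the means `x` with the labels `z`. -/
noncomputable def studentized (q : ℝ) (s : Finset ℕ) (x z : ℕ → ℝ) : ℝ :=
  (∑ j ∈ s, (z j * x j / q - (1 - z j) * x j / (1 - q)))
    / √(∑ j ∈ s, x j ^ 2 * (z j / q ^ 2 + (1 - z j) / (1 - q) ^ 2))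

/-- The factors `1/J_e` of numerator and denominator cancel; for `J_e = 0` both sides are 0. -/
lemma tStat_eq_studentized (L r m : ℕ) (q : ℝ) (J : ℕ) (y : ℕ → ℝ) (w : ℕ → Bool) :
    tStat L r m q J y w = studentized q (Finset.Icc 1 (J / 2)) (focalMean L r m y)
      (fun j => label (w (lastOddBlock r j))) := by
  rw [tStat, deltaHat, vUpHat, studentized]
  rcases Nat.eq_zero_or_pos (J / 2) with h | h
  · simp [h]
  · have hN : (0 : ℝ) < ((J / 2 : ℕ) : ℝ) := by exact_mod_cast h
    rw [Real.sqrt_div' _ (sq_nonneg _), Real.sqrt_sq hN.le, div_div_div_cancel_right₀ hN.ne']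

lemma lastOddBlock_injective {r : ℕ} (hr : 0 < r) : (lastOddBlock r).Injective := by
  intro i j h
  have := Nat.eq_of_mul_eq_mul_right hr h
  omega

lemma redraw_lastOddBlock {r j : ℕ} (hr : 0 < r) (hj : 1 ≤ j) (w w' : ℕ → Bool) :
    redraw r w w' (lastOddBlock r j) = w' (lastOddBlock r j) := by
  obtain ⟨i, rfl⟩ : ∃ i, j = i + 1 := ⟨j - 1, by omega⟩
  have h1 : (lastOddBlock r (i + 1) - 1) / r = 2 * i := by
    have : lastOddBlock r (i + 1) - 1 = (r - 1) + r * (2 * i) := by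
      rw [lastOddBlock, show 2 * (i + 1) - 1 = 2 * i + 1 by omega, add_mul, one_mul, mul_comm]
      omega
    rw [this, Nat.add_mul_div_left _ _ hr, Nat.div_eq_of_lt (by omega), zero_add]
  rw [redraw, h1, if_neg (by simp)]

section Design

variable {q : unitInterval}

lemma measurable_label_eval (k : ℕ) : Measurable (fun w : ℕ → Bool => label (w k)) :=
  measurable_label.comp (measurable_pi_apply k)

lemma measurable_studentized_label (s : Finset ℕ) (x : ℕ → ℝ) (c : ℕ → ℕ) :
    Measurable (fun w : ℕ → Bool => studentized q s x (fun j => label (w (c j)))) := by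
  unfold studentized
  refine Measurable.div (Finset.measurable_fun_sum _ fun j _ => ?_)
    (Real.continuous_sqrt.measurable.comp (Finset.measurable_fun_sum _ fun j _ => ?_))
  · have := measurable_label_eval (c j)
    fun_prop
  · have := measurable_label_eval (c j)
    fun_prop

lemma label_sub_eq (hq0 : 0 < (q : ℝ)) (hq1 : (q : ℝ) < 1) (b : Bool) :
    label b - q = √(q * (1 - q)) * stdLabel q b := by
  have : 0 < √((q : ℝ) * (1 - q)) := Real.sqrt_pos.2 (mul_pos hq0 (by linarith))
  rw [stdLabel, mul_div_cancel₀ _ this.ne']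

/-- The studentized statistic as the ratio of a standardized linear statistic and a factor close
to one. -/
lemma studentized_label_eq (hq0 : 0 < (q : ℝ)) (hq1 : (q : ℝ) < 1) (s : Finset ℕ) (x : ℕ → ℝ)
    (b : ℕ → Bool) (hx : 0 < ∑ i ∈ s, x i ^ 2) :
    studentized q s x (fun j => label (b j))
      = ((∑ j ∈ s, x j * stdLabel q (b j)) / √(∑ i ∈ s, x i ^ 2))
        / √(1 + ((1 / (q : ℝ) ^ 2 - 1 / (1 - q) ^ 2) * (q * (1 - q)) * √(q * (1 - q)))
          * ∑ j ∈ s, x j ^ 2 / (∑ i ∈ s, x i ^ 2) * stdLabel q (b j)) := by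
  set S := ∑ i ∈ s, x i ^ 2 with hS
  have hq1' : 0 < 1 - (q : ℝ) := by linarith
  have hpq : 0 < (q : ℝ) * (1 - q) := mul_pos hq0 hq1'
  set σ := √((q : ℝ) * (1 - q)) with hσ
  have hσ0 : 0 < σ := Real.sqrt_pos.2 hpq
  have hσ2 : σ ^ 2 = q * (1 - q) := Real.sq_sqrt hpq.le
  have hlab (j : ℕ) : label (b j) = q + σ * stdLabel q (b j) := by
    have := label_sub_eq hq0 hq1 (b j)
    linarith
  have hnum : ∑ j ∈ s, (label (b j) * x j / q - (1 - label (b j)) * x j / (1 - q))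
      = (∑ j ∈ s, x j * stdLabel q (b j)) / σ := by
    rw [Finset.sum_div]
    refine Finset.sum_congr rfl fun j _ => ?_
    rw [hlab]
    have h3 : x j * stdLabel q (b j) / σ = σ * (x j * stdLabel q (b j)) / (q * (1 - q)) := by
      rw [← hσ2]; field_simp
    rw [h3]
    field_simp
    ring
  -- Substituting `z = q + σ x` in `z/q² + (1-z)/(1-q)²` gives the constant `1/q + 1/(1-q) =
  -- 1/(q(1-q))` plus a multiple of the standardized label.
  have hden : ∑ j ∈ s, x j ^ 2 * (label (b j) / (q : ℝ) ^ 2 + (1 - label (b j)) / (1 - q) ^ 2)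
      = (S / (q * (1 - q))) * (1 + ((1 / (q : ℝ) ^ 2 - 1 / (1 - q) ^ 2) * (q * (1 - q)) * σ)
          * ∑ j ∈ s, x j ^ 2 / S * stdLabel q (b j)) := by
    have h4 : ∑ j ∈ s, x j ^ 2 / S * stdLabel q (b j)
        = (∑ j ∈ s, x j ^ 2 * stdLabel q (b j)) / S := by
      rw [Finset.sum_div]; exact Finset.sum_congr rfl fun j _ => by ring
    rw [h4]
    have h5 : (S / (q * (1 - q))) * (1 + ((1 / (q : ℝ) ^ 2 - 1 / (1 - q) ^ 2) * (q * (1 - q)) * σ)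
          * ((∑ j ∈ s, x j ^ 2 * stdLabel q (b j)) / S))
        = S / (q * (1 - q)) + (1 / (q : ℝ) ^ 2 - 1 / (1 - q) ^ 2) * σ
          * (∑ j ∈ s, x j ^ 2 * stdLabel q (b j)) := by
      field_simp
    rw [h5, hS, Finset.sum_div, Finset.mul_sum, ← Finset.sum_add_distrib]
    refine Finset.sum_congr rfl fun j _ => ?_
    rw [hlab]
    field_simp
    ring
  rw [studentized, hnum, hden, Real.sqrt_mul (by positivity), Real.sqrt_div hx.le, ← hσ]
  have hS0 : 0 < √S := Real.sqrt_pos.2 hx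
  field_simp

/-- The randomization distribution of the studentized statistic is asymptotically standard normal,
uniformly over weights none of which dominates. -/
lemma exists_weight_bound_studentized (hq0 : 0 < (q : ℝ)) (hq1 : (q : ℝ) < 1) {c : ℕ → ℕ}
    (hc : c.Injective) (t : ℝ) {η : ℝ} (hη : 0 < η) :
    ∃ κ > 0, ∀ (s : Finset ℕ) (x : ℕ → ℝ), (∀ j ∈ s, x j ^ 2 ≤ κ * ∑ i ∈ s, x i ^ 2) →
      0 < ∑ i ∈ s, x i ^ 2 →
      |(design q).real {w | studentized q s x (fun j => label (w (c j))) ≤ t} - Phi t| ≤ η := by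
  by_contra! hcon
  choose s x hx hpos hbad using fun n : ℕ => hcon (1 / ((n : ℝ) + 1)) (by positivity)
  set S : ℕ → ℝ := fun n => ∑ i ∈ s n, x n i ^ 2 with hS
  set D : ℝ := (1 / (q : ℝ) ^ 2 - 1 / (1 - q) ^ 2) * (q * (1 - q)) * √(q * (1 - q))
  set A : ℕ → (ℕ → Bool) → ℝ := fun n w => (∑ j ∈ s n, x n j * stdLabel q (w (c j))) / √(S n)
  set V : ℕ → (ℕ → Bool) → ℝ := fun n w => ∑ j ∈ s n, x n j ^ 2 / S n * stdLabel q (w (c j))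
  have hκ : Tendsto (fun n : ℕ => 1 / ((n : ℝ) + 1)) atTop (𝓝 0) :=
    tendsto_one_div_add_atTop_nhds_zero_nat
  have hA (t : ℝ) : Tendsto (fun n => (design q).real {w | A n w ≤ t}) atTop (𝓝 (Phi t)) := by
    rw [Metric.tendsto_nhds]
    intro e he
    obtain ⟨κ, hκ0, h⟩ := exists_weight_bound_linear hq0 hq1 hc t (half_pos he)
    filter_upwards [hκ.eventually (gt_mem_nhds hκ0)] with n hn
    rw [Real.dist_eq]
    refine (h (s n) (x n) (fun j hj => (hx n j hj).trans ?_) (hpos n)).trans_lt (half_lt_self he)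
    exact mul_le_mul_of_nonneg_right hn.le (hpos n).le
  -- Chebyshev: the variance is `∑ (x_j²/S)²`, at most the largest share `x_j²/S`, because the
  -- shares sum to one.
  have hV : TendstoProb (design q) atTop V 0 := by
    intro e he
    refine tendsto_zero_of_le_real (fun _ => measureReal_nonneg) (Eventually.of_forall fun n => ?_)
      (g := fun n : ℕ => 1 / ((n : ℝ) + 1) / e ^ 2) (by simpa using hκ.div_const (e ^ 2))
    simp only [sub_zero]
    refine (design_abs_weightedSum_ge hq0 hq1 hc (s n) (fun j => x n j ^ 2 / S n) he).trans ?_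
    gcongr
    have hSn : 0 < S n := hpos n
    calc ∑ j ∈ s n, (x n j ^ 2 / S n) ^ 2
        ≤ ∑ j ∈ s n, 1 / ((n : ℝ) + 1) * (x n j ^ 2 / S n) := by
          refine Finset.sum_le_sum fun j hj => ?_
          rw [pow_two (x n j ^ 2 / S n)]
          refine mul_le_mul_of_nonneg_right ?_ (by positivity)
          rw [div_le_iff₀ hSn]; exact hx n j hj
      _ = 1 / ((n : ℝ) + 1) := by
          rw [← Finset.mul_sum, ← Finset.sum_div, div_self hSn.ne', mul_one]
  have hB : TendstoProb (design q) atTop (fun n w => t * √(1 + D * V n w)) t := by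
    have := hV.map (f := fun v => t * √(1 + D * v)) (by fun_prop)
    simpa using this
  have hR : TendstoProb (design q) atTop (fun n w => 1 + D * V n w) 1 := by
    have := hV.map (f := fun v => 1 + D * v) (by fun_prop)
    simpa using this
  -- Where the factor under the root is positive, the statistic is at most `t` exactly when its
  -- linear part is at most `t` times that root. The exceptional event is that the factor is off by
  -- `1/2` or more.
  have hlim := tendsto_real_of_le_of_tendstoProb hA continuous_Phi hB
    (E := fun n => {w | studentized q (s n) (x n) (fun j => label (w (c j))) ≤ t})
    (hR (1 / 2) (by norm_num)) (fun n w hw hE => ?_) (fun n w hw hlt => ?_)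
  · obtain ⟨n, hn⟩ := Metric.tendsto_atTop.1 hlim η hη
    have h1 := hn n le_rfl
    rw [Real.dist_eq] at h1
    linarith [hbad n]
  all_goals
    simp only [Set.mem_ofPred_eq, not_le] at hw
    have hR0 : 0 < √(1 + D * V n w) := Real.sqrt_pos.2 (by linarith [(abs_lt.1 hw).1])
  · simp only [Set.mem_ofPred_eq] at hE
    rw [studentized_label_eq hq0 hq1 _ _ (fun j => w (c j)) (hpos n)] at hE
    exact (div_le_iff₀ hR0).1 hE
  · simp only [Set.mem_ofPred_eq]
    rw [studentized_label_eq hq0 hq1 _ _ (fun j => w (c j)) (hpos n)]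
    exact (div_le_iff₀ hR0).2 hlt.le

/-! ## Resampling labels -/

open Classical in
/-- Replace the labels of the blocks in `S`. -/
noncomputable def mix (S : Set ℕ) (w w' : ℕ → Bool) (k : ℕ) : Bool := if k ∈ S then w' k else w k

lemma measurable_mix (S : Set ℕ) :
    Measurable (fun p : (ℕ → Bool) × (ℕ → Bool) => mix S p.1 p.2) := by
  refine measurable_pi_iff.2 fun k => ?_
  unfold mix
  split_ifs <;> fun_prop

lemma mix_of_mem {S : Set ℕ} {k : ℕ} (hk : k ∈ S) (w w' : ℕ → Bool) : mix S w w' k = w' k :=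
  if_pos hk

lemma mix_of_notMem {S : Set ℕ} {k : ℕ} (hk : k ∉ S) (w w' : ℕ → Bool) : mix S w w' k = w k :=
  if_neg hk

lemma mix_singleton (k : ℕ) (w w' : ℕ → Bool) :
    mix {k} w w' = Function.update w k (w' k) := by
  ext i
  by_cases h : i = k
  · subst h; simp [mix]
  · simp [mix, h]

/-- On a finite cylinder the event splits into conditions on the kept and on the replaced
coordinates, and the product formula recombines them. -/
lemma measurePreserving_mix (S : Set ℕ) :
    MeasurePreserving (fun p : (ℕ → Bool) × (ℕ → Bool) => mix S p.1 p.2)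
      ((design q).prod (design q)) (design q) := by
  classical
  refine ⟨measurable_mix S, ?_⟩
  refine Measure.eq_infinitePi (μ := fun _ : ℕ => bernoulliMeasure true false q) fun s t ht => ?_
  have hpre : (fun p : (ℕ → Bool) × (ℕ → Bool) => mix S p.1 p.2) ⁻¹' (Set.pi s t)
      = (Set.pi (s.filter (· ∉ S)) t) ×ˢ (Set.pi (s.filter (· ∈ S)) t) := by
    ext p
    simp only [Set.mem_preimage, Set.mem_pi, Set.mem_prod, Finset.coe_filter, Set.mem_ofPred_eq,
      Finset.mem_coe]
    constructor
    · intro h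
      exact ⟨fun i hi => mix_of_notMem hi.2 p.1 p.2 ▸ h i hi.1,
        fun i hi => mix_of_mem hi.2 p.1 p.2 ▸ h i hi.1⟩
    · rintro ⟨h1, h2⟩ i hi
      by_cases hS : i ∈ S
      · rw [mix_of_mem hS]; exact h2 i ⟨hi, hS⟩
      · rw [mix_of_notMem hS]; exact h1 i ⟨hi, hS⟩
  rw [Measure.map_apply (measurable_mix S)
    (MeasurableSet.pi (Finset.countable_toSet s) fun i _ => ht i), hpre, Measure.prod_prod,
    design, Measure.infinitePi_pi _ (fun i _ => ht i), Measure.infinitePi_pi _ (fun i _ => ht i),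
    mul_comm]
  exact Finset.prod_filter_mul_prod_filter_not s (· ∈ S) _

variable {𝓔 : Type*} [MeasurableSpace 𝓔]

lemma measurePreserving_mix_prod (S : Set ℕ) (ν : Measure 𝓔) [IsProbabilityMeasure ν] :
    MeasurePreserving
      (fun p : ((ℕ → Bool) × 𝓔) × (ℕ → Bool) => ((mix S p.1.1 p.2, p.1.2) : (ℕ → Bool) × 𝓔))
      (((design q).prod ν).prod (design q)) ((design q).prod ν) := by
  have h1 := measurePreserving_prodAssoc (design q) ν (design q)
  have h2 : MeasurePreserving (Prod.map id Prod.swap)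
      ((design q).prod (ν.prod (design q))) ((design q).prod ((design q).prod ν)) :=
    (MeasurePreserving.id (design q)).prod (Measure.measurePreserving_swap)
  have h3 := (measurePreserving_prodAssoc (design q) (design q) ν).symm
  have h4 : MeasurePreserving (Prod.map (fun p : (ℕ → Bool) × (ℕ → Bool) => mix S p.1 p.2) id)
      (((design q).prod (design q)).prod ν) ((design q).prod ν) :=
    (measurePreserving_mix S).prod (MeasurePreserving.id ν)
  exact h4.comp (h3.comp (h2.comp h1))

variable {Ω : Type*} [MeasurableSpace Ω] {P : Measure Ω} [IsProbabilityMeasure P]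
  {W : Ω → ℕ → Bool} {ξ : Ω → 𝓔}

lemma measurePreserving_label_error (hW : Measurable W) (hWlaw : P.map W = design q)
    (hξ : Measurable ξ) (hind : IndepFun W ξ P) :
    MeasurePreserving (fun ω => (W ω, ξ ω)) P ((design q).prod (P.map ξ)) := by
  refine ⟨hW.prodMk hξ, ?_⟩
  rw [(indepFun_iff_map_prod_eq_prod_map_map hW.aemeasurable hξ.aemeasurable).1 hind, hWlaw]

/-- Resampling the labels of the blocks in `S`: if the conditional probability of an event is close
to `c` off a bad event, its probability is close to `c`. -/
lemma abs_real_sub_le_of_resample (hW : Measurable W) (hWlaw : P.map W = design q)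
    (hξ : Measurable ξ) (hind : IndepFun W ξ P) (S : Set ℕ) {A B : Set ((ℕ → Bool) × 𝓔)}
    (hA : MeasurableSet A) (hB : MeasurableSet B) {c η : ℝ} (hc0 : 0 ≤ c) (hc1 : c ≤ 1)
    (hη : 0 ≤ η)
    (h : ∀ p ∉ B, |(design q).real {w' | (mix S p.1 w', p.2) ∈ A} - c| ≤ η) :
    |P.real {ω | (W ω, ξ ω) ∈ A} - c| ≤ η + P.real {ω | (W ω, ξ ω) ∈ B} := by
  have hpξ : IsProbabilityMeasure (P.map ξ) := Measure.isProbabilityMeasure_map hξ.aemeasurable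
  have hmp := measurePreserving_label_error hW hWlaw hξ hind
  set M := (design q).prod (P.map ξ) with hM
  have e1 : P.real {ω | (W ω, ξ ω) ∈ A} = M.real A := hmp.measureReal_preimage hA.nullMeasurableSet
  have e2 : P.real {ω | (W ω, ξ ω) ∈ B} = M.real B := hmp.measureReal_preimage hB.nullMeasurableSet
  have hmix := measurePreserving_mix_prod (q := q) S (P.map ξ)
  -- Resampling preserves the joint law, so Fubini writes the probability as the mean of the
  -- conditional probabilities.
  have e3 : M.real A = ∫ p, (design q).real {w' | (mix S p.1 w', p.2) ∈ A} ∂M := by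
    rw [← hmix.measureReal_preimage hA.nullMeasurableSet]
    rw [measureReal_def, Measure.prod_apply (hmix.measurable hA),
      ← integral_toReal (measurable_measure_prodMk_left (hmix.measurable hA)).aemeasurable
        (Eventually.of_forall fun _ => measure_lt_top _ _)]
    rfl
  have hmeas : Measurable (fun p : (ℕ → Bool) × 𝓔 =>
      (design q).real {w' | (mix S p.1 w', p.2) ∈ A}) :=
    (measurable_measure_prodMk_left (hmix.measurable hA)).ennreal_toReal
  have hbd (p : (ℕ → Bool) × 𝓔) :
      |(design q).real {w' | (mix S p.1 w', p.2) ∈ A}| ≤ 1 := by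
    rw [abs_of_nonneg measureReal_nonneg]; exact measureReal_le_one
  have hint : Integrable (fun p : (ℕ → Bool) × 𝓔 =>
      (design q).real {w' | (mix S p.1 w', p.2) ∈ A}) M := integrable_of_bdd hmeas 1 hbd
  rw [e1, e2, e3]
  have e4 : ∫ p, (design q).real {w' | (mix S p.1 w', p.2) ∈ A} ∂M - c
      = ∫ p, ((design q).real {w' | (mix S p.1 w', p.2) ∈ A} - c) ∂M := by
    rw [integral_sub hint (integrable_const c)]; simp
  rw [e4]
  have e5 : η + M.real B = ∫ p, (η + B.indicator 1 p) ∂M := by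
    have h1 : Integrable (B.indicator (1 : (ℕ → Bool) × 𝓔 → ℝ)) M :=
      (integrable_const (1 : ℝ)).indicator hB
    rw [integral_add (integrable_const _) h1, integral_indicator_one hB]
    simp
  rw [e5]
  refine (abs_integral_le_integral_abs).trans (integral_mono (hint.sub (integrable_const c)).abs
    ((integrable_const _).add ((integrable_const (1 : ℝ)).indicator hB)) fun p => ?_)
  by_cases hp : p ∈ B
  · have h0 : (0 : ℝ) ≤ (design q).real {w' | (mix S p.1 w', p.2) ∈ A} := measureReal_nonneg
    have h1 : (design q).real {w' | (mix S p.1 w', p.2) ∈ A} ≤ 1 := measureReal_le_one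
    have : |(design q).real {w' | (mix S p.1 w', p.2) ∈ A} - c| ≤ 1 :=
      abs_le.2 ⟨by linarith, by linarith⟩
    simp only [Set.indicator_of_mem hp, Pi.one_apply]
    linarith
  · simp only [Set.indicator_of_notMem hp, add_zero]
    exact h p hp

/-- Averaging over the label of one block. -/
lemma integral_eq_integral_update (hW : Measurable W) (hWlaw : P.map W = design q)
    (hξ : Measurable ξ) (hind : IndepFun W ξ P) (k : ℕ) {F : (ℕ → Bool) → 𝓔 → ℝ}
    (hF : Measurable (Function.uncurry F)) (hint : Integrable (fun ω => F (W ω) (ξ ω)) P) :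
    ∫ ω, F (W ω) (ξ ω) ∂P
      = ∫ ω, (q * F (Function.update (W ω) k true) (ξ ω)
          + (1 - q) * F (Function.update (W ω) k false) (ξ ω)) ∂P := by
  have hpξ : IsProbabilityMeasure (P.map ξ) := Measure.isProbabilityMeasure_map hξ.aemeasurable
  have hmp := measurePreserving_label_error hW hWlaw hξ hind
  set M := (design q).prod (P.map ξ) with hM
  have hmix := measurePreserving_mix_prod (q := q) {k} (P.map ξ)
  have hintM : Integrable (Function.uncurry F) M :=
    (hmp.integrable_comp hF.aestronglyMeasurable).1 hint
  have e1 : ∫ ω, F (W ω) (ξ ω) ∂P = ∫ p, Function.uncurry F p ∂M := by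
    rw [← hmp.map_eq, integral_map hmp.aemeasurable hF.aestronglyMeasurable]
    rfl
  have hint3 := (hmix.integrable_comp hF.aestronglyMeasurable).2 hintM
  have e2 : ∫ p, Function.uncurry F p ∂M
      = ∫ p, (q * F (Function.update p.1 k true) p.2
          + (1 - q) * F (Function.update p.1 k false) p.2) ∂M := by
    have e3 : ∫ p, Function.uncurry F p ∂M
        = ∫ p, (Function.uncurry F ∘ fun p : ((ℕ → Bool) × 𝓔) × (ℕ → Bool) =>
          ((mix {k} p.1.1 p.2, p.1.2) : (ℕ → Bool) × 𝓔)) p ∂(M.prod (design q)) := by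
      have h := integral_map hmix.aemeasurable (f := Function.uncurry F)
        (hmix.map_eq.symm ▸ hF.aestronglyMeasurable)
      rw [hmix.map_eq] at h
      exact h
    rw [e3, integral_prod _ hint3]
    refine integral_congr_ae (Eventually.of_forall fun p => ?_)
    simp only [Function.comp_apply, mix_singleton, Function.uncurry_apply_pair]
    exact integral_design_eval (fun b => F (Function.update p.1 k b) p.2) k
  have hupd (b : Bool) : Measurable (fun p : (ℕ → Bool) × 𝓔 => F (Function.update p.1 k b) p.2) := by
    have : Measurable (fun w : ℕ → Bool => Function.update w k b) :=
      measurable_update'.comp (measurable_id.prodMk measurable_const)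
    exact hF.comp ((this.comp measurable_fst).prodMk measurable_snd)
  rw [e1, e2, ← hmp.map_eq, integral_map hmp.aemeasurable]
  exact (((hupd true).const_mul _).add ((hupd false).const_mul _)).aestronglyMeasurable

end Design


/-! ## A law of large numbers -/

section LLN

variable {Ω : Type*} [MeasurableSpace Ω] {P : Measure Ω} [IsProbabilityMeasure P]

/-- Reduces independence of pairs to a check on rectangles, which form a π-system. -/
lemma comap_prodMk_eq_generateFrom {α β : Type*} [MeasurableSpace α] [MeasurableSpace β]
    (X : Ω → α) (Y : Ω → β) :
    MeasurableSpace.comap (fun ω => (X ω, Y ω)) inferInstance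
      = MeasurableSpace.generateFrom (Set.preimage (fun ω => (X ω, Y ω)) ''
        (Set.image2 (· ×ˢ ·) {s : Set α | MeasurableSet s} {t : Set β | MeasurableSet t})) := by
  rw [← generateFrom_prod, MeasurableSpace.comap_generateFrom]

lemma measurableSet_of_mem_preimage_rectangles {α β : Type*} [MeasurableSpace α]
    [MeasurableSpace β] {X : Ω → α} {Y : Ω → β} (hX : Measurable X) (hY : Measurable Y) :
    ∀ s ∈ (Set.preimage (fun ω => (X ω, Y ω)) ''
      (Set.image2 (· ×ˢ ·) {s : Set α | MeasurableSet s} {t : Set β | MeasurableSet t})),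
      MeasurableSet s := by
  rintro _ ⟨_, ⟨s, hs, t, ht, rfl⟩, rfl⟩
  exact (hX.prodMk hY) (hs.prod ht)

/-- If two pairs are independent of each other and each has independent components, then regrouping
the components gives independent pairs. -/
lemma indepFun_prodMk_prodMk {α₁ α₂ β₁ β₂ : Type*} [MeasurableSpace α₁] [MeasurableSpace α₂]
    [MeasurableSpace β₁] [MeasurableSpace β₂] {X₁ : Ω → α₁} {X₂ : Ω → α₂} {Y₁ : Ω → β₁}
    {Y₂ : Ω → β₂} (hX₁ : Measurable X₁) (hX₂ : Measurable X₂) (hY₁ : Measurable Y₁)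
    (hY₂ : Measurable Y₂) (hXY : IndepFun (fun ω => (X₁ ω, X₂ ω)) (fun ω => (Y₁ ω, Y₂ ω)) P)
    (hX : IndepFun X₁ X₂ P) (hY : IndepFun Y₁ Y₂ P) :
    IndepFun (fun ω => (X₁ ω, Y₁ ω)) (fun ω => (X₂ ω, Y₂ ω)) P := by
  rw [IndepFun_iff_Indep]
  rw [comap_prodMk_eq_generateFrom, comap_prodMk_eq_generateFrom]
  refine IndepSets.indep' (measurableSet_of_mem_preimage_rectangles hX₁ hY₁) (measurableSet_of_mem_preimage_rectangles hX₂ hY₂)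
    (isPiSystem_prod.comap _) (isPiSystem_prod.comap _) ?_
  rw [IndepSets_iff]
  rintro _ _ ⟨_, ⟨s₁, hs₁, t₁, ht₁, rfl⟩, rfl⟩ ⟨_, ⟨s₂, hs₂, t₂, ht₂, rfl⟩, rfl⟩
  have hXY₁ : IndepFun X₁ Y₁ P := hXY.comp measurable_fst measurable_fst
  have hXY₂ : IndepFun X₂ Y₂ P := hXY.comp measurable_snd measurable_snd
  have e0 := hXY.measure_inter_preimage_eq_mul (s₁ ×ˢ s₂) (t₁ ×ˢ t₂) (hs₁.prod hs₂) (ht₁.prod ht₂)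
  have e1 := hX.measure_inter_preimage_eq_mul s₁ s₂ hs₁ hs₂
  have e2 := hY.measure_inter_preimage_eq_mul t₁ t₂ ht₁ ht₂
  have e3 := hXY₁.measure_inter_preimage_eq_mul s₁ t₁ hs₁ ht₁
  have e4 := hXY₂.measure_inter_preimage_eq_mul s₂ t₂ hs₂ ht₂
  simp only [Set.mk_preimage_prod] at e0 ⊢
  rw [e1, e2] at e0
  rw [e3, e4, Set.inter_inter_inter_comm, e0]
  ring

/-- Second moment of a sum of bounded variables which are uncorrelated at distance at least `g`. -/
lemma integral_sq_sum_le_of_uncorrelated {η : ℕ → Ω → ℝ} (hm : ∀ j, Measurable (η j)) {B : ℝ}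
    (hB : ∀ j ω, |η j ω| ≤ B) {g : ℕ} (hg : ∀ i j, i + g ≤ j → ∫ ω, η i ω * η j ω ∂P = 0) (N : ℕ) :
    ∫ ω, (∑ j ∈ Finset.range N, η j ω) ^ 2 ∂P ≤ N * (2 * g) * B ^ 2 := by
  have hB2 (i j : ℕ) (ω : Ω) : |η i ω * η j ω| ≤ B ^ 2 := by
    rw [abs_mul, pow_two]
    exact mul_le_mul (hB i ω) (hB j ω) (abs_nonneg _) ((abs_nonneg _).trans (hB i ω))
  have hi (i j : ℕ) : Integrable (fun ω => η i ω * η j ω) P :=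
    integrable_of_bdd ((hm i).mul (hm j)) (B ^ 2) (hB2 i j)
  -- For fixed `i` only the at most `2g` indices `j` with `|i - j| < g` can contribute; `i + 1 - g`
  -- is truncated at 0.
  have hle (i j : ℕ) : ∫ ω, η i ω * η j ω ∂P
      ≤ if j ∈ Finset.Ico (i + 1 - g) (i + g) then B ^ 2 else 0 := by
    split_ifs with h
    · calc ∫ ω, η i ω * η j ω ∂P ≤ ∫ _, B ^ 2 ∂P :=
            integral_mono (hi i j) (integrable_const _) fun ω => (le_abs_self _).trans (hB2 i j ω)
        _ = B ^ 2 := by simp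
    · rw [Finset.mem_Ico, not_and_or, not_le, not_lt] at h
      rcases h with h | h
      · simp_rw [mul_comm (η i _)]
        exact (hg j i (by omega)).le
      · exact (hg i j h).le
  simp_rw [pow_two (∑ j ∈ Finset.range N, _), Finset.sum_mul_sum]
  rw [integral_finsetSum _ fun i _ => integrable_finsetSum _ fun j _ => hi i j]
  calc ∑ i ∈ Finset.range N, ∫ ω, ∑ j ∈ Finset.range N, η i ω * η j ω ∂P
      ≤ ∑ i ∈ Finset.range N, (2 * g) * B ^ 2 := by
        refine Finset.sum_le_sum fun i _ => ?_
        rw [integral_finsetSum _ fun j _ => hi i j]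
        refine (Finset.sum_le_sum fun j _ => hle i j).trans ?_
        rw [← Finset.sum_filter, Finset.sum_const, nsmul_eq_mul]
        refine mul_le_mul_of_nonneg_right ?_ (sq_nonneg B)
        have : ((Finset.range N).filter (· ∈ Finset.Ico (i + 1 - g) (i + g))).card ≤ 2 * g := by
          refine (Finset.card_le_card (t := Finset.Ico (i + 1 - g) (i + g)) fun j hj =>
            (Finset.mem_filter.1 hj).2).trans ?_
          rw [Nat.card_Ico]; omega
        exact_mod_cast this
    _ = N * (2 * g) * B ^ 2 := by simp [mul_assoc]

/-- Truncation at level `M`. -/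
def clip (M x : ℝ) : ℝ := max (-M) (min x M)

lemma measurable_clip (M : ℝ) : Measurable (clip M) := by unfold clip; fun_prop

lemma abs_clip_le {M : ℝ} (hM : 0 ≤ M) (x : ℝ) : |clip M x| ≤ M := by
  unfold clip
  exact abs_le.2 ⟨le_max_left _ _, max_le (by linarith) (min_le_right _ _)⟩

lemma abs_clip_le_abs {M : ℝ} (hM : 0 ≤ M) (x : ℝ) : |clip M x| ≤ |x| := by
  unfold clip
  refine abs_le.2 ⟨?_, ?_⟩
  · rcases le_total x M with h | h
    · rw [min_eq_left h]; exact (neg_abs_le x).trans (le_max_right _ _)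
    · rw [min_eq_right h, max_eq_right (by linarith)]; linarith [abs_nonneg x]
  · exact max_le (by linarith [abs_nonneg x]) ((min_le_left _ _).trans (le_abs_self x))

lemma abs_clip_sub_clip_le (M x y : ℝ) : |clip M x - clip M y| ≤ |x - y| := by
  unfold clip
  have h1 := abs_max_sub_max_le_abs (min x M) (min y M) (-M)
  have h2 := abs_min_sub_min_le_max x M y M
  rw [sub_self, abs_zero, max_eq_left (abs_nonneg _)] at h2
  rw [max_comm (-M), max_comm (-M)]
  exact h1.trans h2

lemma clip_of_abs_le {M x : ℝ} (h : |x| ≤ M) : clip M x = x := by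
  unfold clip
  rw [min_eq_left (abs_le.1 h).2, max_eq_right (abs_le.1 h).1]

/-- Dominated convergence: the truncation is eventually exact at each point, and the squared error
is at most `4X²`. -/
lemma exists_clip_sq_le {X : Ω → ℝ} (hX : Measurable X) (hX2 : MemLp X 2 P) {e : ℝ} (he : 0 < e) :
    ∃ M, 0 ≤ M ∧ ∫ ω, (X ω - clip M (X ω)) ^ 2 ∂P ≤ e := by
  have hlim : Tendsto (fun n : ℕ => ∫ ω, (X ω - clip n (X ω)) ^ 2 ∂P) atTop (𝓝 (∫ _, 0 ∂P)) := by
    refine tendsto_integral_of_dominated_convergence (fun ω => 4 * X ω ^ 2)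
      (fun n => ((hX.sub ((measurable_clip n).comp hX)).pow_const 2).aestronglyMeasurable)
      (hX2.integrable_sq.const_mul 4) (fun n => Eventually.of_forall fun ω => ?_)
      (Eventually.of_forall fun ω => ?_)
    · rw [Real.norm_eq_abs, abs_pow]
      have h1 := abs_clip_le_abs (Nat.cast_nonneg n) (X ω)
      have h2 : |X ω - clip n (X ω)| ≤ 2 * |X ω| := (abs_sub _ _).trans (by linarith)
      calc |X ω - clip n (X ω)| ^ 2 ≤ (2 * |X ω|) ^ 2 := pow_le_pow_left₀ (abs_nonneg _) h2 2
        _ = 4 * X ω ^ 2 := by rw [mul_pow, sq_abs]; norm_num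
    · refine tendsto_const_nhds.congr' ?_
      obtain ⟨n₀, hn₀⟩ := exists_nat_ge |X ω|
      filter_upwards [eventually_ge_atTop n₀] with n hn
      rw [clip_of_abs_le (hn₀.trans (by exact_mod_cast hn))]
      simp
  rw [integral_zero] at hlim
  obtain ⟨n, hn⟩ := (hlim.eventually (gt_mem_nhds he)).exists
  exact ⟨n, Nat.cast_nonneg n, hn.le⟩

/-- Functions of a label pattern and a real number which grow at most quadratically, with an explicit
constant. -/
structure QuadBound {Λ : Type*} [MeasurableSpace Λ] (R : ℝ) (Ψ : Λ → ℝ → ℝ) : Prop where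
  measurable : Measurable (Function.uncurry Ψ)
  zero_le : ∀ l, |Ψ l 0| ≤ R
  lipschitz : ∀ l x y, |Ψ l x - Ψ l y| ≤ R * (1 + |x| + |y|) * |x - y|

section QuadBound

variable {Λ : Type*} [MeasurableSpace Λ] {R : ℝ} {Ψ : Λ → ℝ → ℝ}

lemma QuadBound.abs_le (h : QuadBound R Ψ) (l : Λ) (x : ℝ) :
    |Ψ l x| ≤ R * (2 + 2 * x ^ 2) := by
  have hR : 0 ≤ R := (abs_nonneg _).trans (h.zero_le l)
  have h1 := h.lipschitz l x 0
  have h2 := h.zero_le l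
  rw [abs_zero, sub_zero, add_zero] at h1
  have h3 : |Ψ l x| ≤ |Ψ l x - Ψ l 0| + |Ψ l 0| := by
    have := abs_add_le (Ψ l x - Ψ l 0) (Ψ l 0)
    simpa using this
  have h4 : R * (1 + |x|) * |x| ≤ R * (1 + 2 * x ^ 2) := by
    rw [mul_assoc]
    refine mul_le_mul_of_nonneg_left ?_ hR
    nlinarith [sq_abs x, sq_nonneg (|x| - 1)]
  linarith

lemma QuadBound.integrable (h : QuadBound R Ψ) {lam : Ω → Λ} {X : Ω → ℝ} (hlam : Measurable lam)
    (hX : Measurable X) (hX2 : MemLp X 2 P) : Integrable (fun ω => Ψ (lam ω) (X ω)) P := by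
  refine Integrable.mono' (((integrable_const 2).add (hX2.integrable_sq.const_mul 2)).const_mul R)
    (h.measurable.comp (hlam.prodMk hX)).aestronglyMeasurable
    (Eventually.of_forall fun ω => h.abs_le _ _)

end QuadBound

/-- Weighted arithmetic-geometric mean inequality; it turns a small second moment into a small first
absolute moment. -/
lemma abs_le_of_sq (x : ℝ) {η : ℝ} (hη : 0 < η) : |x| ≤ η / 4 + x ^ 2 / η := by
  have h : 0 ≤ (η / 2 - |x|) ^ 2 / η := by positivity
  have h2 : (η / 2 - |x|) ^ 2 / η = η / 4 + x ^ 2 / η - |x| := by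
    rw [sub_sq, sq_abs]; field_simp; ring
  linarith

/-- Replacing the real argument by a truncated approximation changes the mean little. -/
lemma QuadBound.integral_abs_sub_clip_le {Λ : Type*} [MeasurableSpace Λ] {R : ℝ} {Ψ : Λ → ℝ → ℝ}
    (h : QuadBound R Ψ) (hR : 0 ≤ R) {lam : Ω → Λ} (hlam : Measurable lam) {E V : Ω → ℝ}
    (hE : Measurable E) (hV : Measurable V) (hE2 : MemLp E 2 P) (hV2 : MemLp V 2 P) {M : ℝ}
    (hM : 0 ≤ M) {θ e τ s2 : ℝ} (hθ : 0 < θ) (he1 : e ≤ 1)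
    (hs : ∫ ω, E ω ^ 2 ∂P ≤ s2) (he : ∫ ω, (E ω - V ω) ^ 2 ∂P ≤ e)
    (hτ : ∫ ω, (E ω - clip M (E ω)) ^ 2 ∂P ≤ τ) :
    ∫ ω, |Ψ (lam ω) (E ω) - Ψ (lam ω) (clip M (V ω))| ∂P
      ≤ R * (3 * θ * (2 + 4 * s2) + (2 * τ + 2 * e) / (4 * θ)) := by
  have hcE : MemLp (fun ω => clip M (E ω)) 2 P :=
    MemLp.of_bound ((measurable_clip M).comp hE).aestronglyMeasurable M
      (Eventually.of_forall fun ω => abs_clip_le hM _)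
  have hcV : MemLp (fun ω => clip M (V ω)) 2 P :=
    MemLp.of_bound ((measurable_clip M).comp hV).aestronglyMeasurable M
      (Eventually.of_forall fun ω => abs_clip_le hM _)
  have i1 : Integrable (fun ω => E ω ^ 2) P := hE2.integrable_sq
  have i2 : Integrable (fun ω => (E ω - V ω) ^ 2) P := (hE2.sub hV2).integrable_sq
  have i3 : Integrable (fun ω => (E ω - clip M (E ω)) ^ 2) P := (hE2.sub hcE).integrable_sq
  have hpt (ω : Ω) : |Ψ (lam ω) (E ω) - Ψ (lam ω) (clip M (V ω))|
      ≤ R * (3 * θ * (1 + 4 * E ω ^ 2 + (E ω - V ω) ^ 2)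
        + (2 * (E ω - clip M (E ω)) ^ 2 + 2 * (E ω - V ω) ^ 2) / (4 * θ)) := by
    refine (h.lipschitz _ _ _).trans ?_
    rw [mul_assoc]
    refine mul_le_mul_of_nonneg_left ?_ hR
    have a1 := abs_clip_sub_clip_le M (E ω) (V ω)
    have a2 := abs_clip_le_abs hM (E ω)
    have a3 : |clip M (V ω)| ≤ |E ω| + |E ω - V ω| := by
      have := abs_sub_abs_le_abs_sub (clip M (V ω)) (clip M (E ω))
      rw [abs_sub_comm] at this
      linarith
    have a4 : |E ω - clip M (V ω)| ≤ |E ω - clip M (E ω)| + |E ω - V ω| :=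
      (abs_sub_le _ (clip M (E ω)) _).trans (by linarith)
    set x := |E ω| with hx
    set d := |E ω - V ω| with hd
    set c := |E ω - clip M (E ω)| with hc
    have b1 : E ω ^ 2 = x ^ 2 := (sq_abs _).symm
    have b2 : (E ω - V ω) ^ 2 = d ^ 2 := (sq_abs _).symm
    have b3 : (E ω - clip M (E ω)) ^ 2 = c ^ 2 := (sq_abs _).symm
    rw [b1, b2, b3]
    have x0 : 0 ≤ x := abs_nonneg _
    have d0 : 0 ≤ d := abs_nonneg _
    have c0 : 0 ≤ c := abs_nonneg _
    calc (1 + x + |clip M (V ω)|) * |E ω - clip M (V ω)| ≤ (1 + 2 * x + d) * (c + d) := by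
          refine mul_le_mul (by linarith) a4 (abs_nonneg _) (by positivity)
      -- `ab ≤ θa² + b²/(4θ)`: the growth factor is only bounded in mean square, so it receives the
      -- small weight `θ`, and the approximation error is made small afterwards.
      _ ≤ θ * (1 + 2 * x + d) ^ 2 + (c + d) ^ 2 / (4 * θ) := by
          have : 0 ≤ (2 * θ * (1 + 2 * x + d) - (c + d)) ^ 2 / (4 * θ) := by positivity
          have e : (2 * θ * (1 + 2 * x + d) - (c + d)) ^ 2 / (4 * θ)
            = θ * (1 + 2 * x + d) ^ 2 + (c + d) ^ 2 / (4 * θ) - (1 + 2 * x + d) * (c + d) := by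
            field_simp; ring
          linarith
      _ ≤ 3 * θ * (1 + 4 * x ^ 2 + d ^ 2) + (2 * c ^ 2 + 2 * d ^ 2) / (4 * θ) := by
          have e1 : (1 + 2 * x + d) ^ 2 ≤ 3 * (1 + 4 * x ^ 2 + d ^ 2) := by
            nlinarith [sq_nonneg (1 - 2 * x), sq_nonneg (1 - d), sq_nonneg (2 * x - d)]
          have e2 : (c + d) ^ 2 ≤ 2 * c ^ 2 + 2 * d ^ 2 := by nlinarith [sq_nonneg (c - d)]
          have e3 : θ * (1 + 2 * x + d) ^ 2 ≤ 3 * θ * (1 + 4 * x ^ 2 + d ^ 2) := by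
            calc _ ≤ θ * (3 * (1 + 4 * x ^ 2 + d ^ 2)) := mul_le_mul_of_nonneg_left e1 hθ.le
              _ = _ := by ring
          gcongr
  have j1 : Integrable (fun ω => 3 * θ * (1 + 4 * E ω ^ 2 + (E ω - V ω) ^ 2)) P :=
    (((integrable_const 1).add (i1.const_mul 4)).add i2).const_mul _
  have j2 : Integrable (fun ω => (2 * (E ω - clip M (E ω)) ^ 2 + 2 * (E ω - V ω) ^ 2) / (4 * θ)) P :=
    ((i3.const_mul 2).add (i2.const_mul 2)).div_const _
  have hL : Integrable (fun ω => |Ψ (lam ω) (E ω) - Ψ (lam ω) (clip M (V ω))|) P :=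
    ((h.integrable hlam hE hE2).sub
      (h.integrable hlam ((measurable_clip M).comp hV) hcV)).abs
  refine (integral_mono hL ((j1.add j2).const_mul R) hpt).trans ?_
  rw [integral_const_mul]
  refine mul_le_mul_of_nonneg_left ?_ hR
  have k1 : ∫ ω, (3 * θ * (1 + 4 * E ω ^ 2 + (E ω - V ω) ^ 2)
        + (2 * (E ω - clip M (E ω)) ^ 2 + 2 * (E ω - V ω) ^ 2) / (4 * θ)) ∂P
      = 3 * θ * (1 + 4 * ∫ ω, E ω ^ 2 ∂P + ∫ ω, (E ω - V ω) ^ 2 ∂P)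
        + (2 * ∫ ω, (E ω - clip M (E ω)) ^ 2 ∂P + 2 * ∫ ω, (E ω - V ω) ^ 2 ∂P) / (4 * θ) := by
    have i4 : Integrable (fun ω => 1 + 4 * E ω ^ 2) P :=
      (integrable_const 1).add (i1.const_mul 4)
    rw [integral_add j1 j2, integral_const_mul, integral_div, integral_add i4 i2,
      integral_add (integrable_const _) (i1.const_mul 4),
      integral_add (i3.const_mul 2) (i2.const_mul 2)]
    simp only [integral_const_mul]
    simp
  change ∫ ω, (3 * θ * (1 + 4 * E ω ^ 2 + (E ω - V ω) ^ 2)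
        + (2 * (E ω - clip M (E ω)) ^ 2 + 2 * (E ω - V ω) ^ 2) / (4 * θ)) ∂P ≤ _
  rw [k1]
  refine add_le_add (mul_le_mul_of_nonneg_left (by linarith) (by positivity)) ?_
  gcongr

/-- **Law of large numbers in mean** for functions of growing complexity: uniformly over all `Ψ`
obeying the same quadratic bound. -/
theorem exists_forall_integral_abs_average_sub_le {Λ : Type*} [MeasurableSpace Λ]
    {lam : ℕ → Ω → Λ} {E : ℕ → Ω → ℝ} (hlam : ∀ j, Measurable (lam j))
    (hE : ∀ j, Measurable (E j)) (hident : ∀ j, IdentDistrib (E j) (E 0) P P)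
    (hE2 : MemLp (E 0) 2 P)
    (happrox : ∀ e > 0, ∃ (g : ℕ) (V : ℕ → Ω → ℝ), (∀ j, Measurable (V j)) ∧
      (∀ j, MemLp (V j) 2 P) ∧ (∀ j, ∫ ω, (E j ω - V j ω) ^ 2 ∂P ≤ e) ∧
      ∀ i j, i + g ≤ j → IndepFun (fun ω => (lam i ω, V i ω)) (fun ω => (lam j ω, V j ω)) P)
    {R η : ℝ} (hR : 0 ≤ R) (hη : 0 < η) :
    ∃ N₀ : ℕ, ∀ N ≥ N₀, ∀ Ψ : Λ → ℝ → ℝ, QuadBound R Ψ →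
      ∫ ω, |(∑ j ∈ Finset.range N, (Ψ (lam j ω) (E j ω) - ∫ ω', Ψ (lam j ω') (E j ω') ∂P)) / N| ∂P
        ≤ η := by
  set s2 := ∫ ω, E 0 ω ^ 2 ∂P with hs2
  have hs0 : 0 ≤ s2 := integral_nonneg fun _ => sq_nonneg _
  -- The error budget is fixed here: `θ` and then `e` each cost `η/16`, so replacing one summand by
  -- its truncation costs `η/8`. This is paid for the summand and again for its mean.
  obtain ⟨θ, hθ, hθ'⟩ : ∃ θ > 0, R * (3 * θ * (2 + 4 * s2)) ≤ η / 16 := by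
    refine ⟨η / (16 * ((R + 1) * (3 * (2 + 4 * s2)))), by positivity, ?_⟩
    have : R * (3 * (η / (16 * ((R + 1) * (3 * (2 + 4 * s2))))) * (2 + 4 * s2))
        = η / 16 * (R / (R + 1)) := by field_simp
    rw [this]
    exact mul_le_of_le_one_right (by positivity) ((div_le_one (by positivity)).2 (by linarith))
  obtain ⟨e, he, he1, he'⟩ : ∃ e > 0, e ≤ 1 ∧ R * ((2 * e + 2 * e) / (4 * θ)) ≤ η / 16 := by
    refine ⟨min 1 (η * θ / (16 * (R + 1))), by positivity, min_le_left _ _, ?_⟩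
    set e := min 1 (η * θ / (16 * (R + 1)))
    have h1 : e ≤ η * θ / (16 * (R + 1)) := min_le_right _ _
    have h2 : R * ((2 * e + 2 * e) / (4 * θ)) = R / θ * e := by field_simp; ring
    rw [h2]
    calc R / θ * e ≤ R / θ * (η * θ / (16 * (R + 1))) := by gcongr
      _ = η / 16 * (R / (R + 1)) := by field_simp
      _ ≤ η / 16 := mul_le_of_le_one_right (by positivity)
          ((div_le_one (by positivity)).2 (by linarith))
  obtain ⟨M, hM, hτ⟩ := exists_clip_sq_le (hE 0) hE2 he
  obtain ⟨g, V, hV, hV2, hVe, hVind⟩ := happrox e he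
  have hE2' (j : ℕ) : MemLp (E j) 2 P := (hident j).memLp_iff.2 hE2
  set B : ℝ := R * (2 + 2 * M ^ 2) with hB
  have hB0 : 0 ≤ B := by positivity
  obtain ⟨N₀, hN₀⟩ := exists_nat_ge (2 * (2 * g * (2 * B) ^ 2 / (η / 2)) / η + 1)
  -- All parameters are chosen before `Ψ` and depend on it only through `R`, whence the uniformity.
  refine ⟨N₀, fun N hN Ψ hΨ => ?_⟩
  have hNr : 2 * (2 * g * (2 * B) ^ 2 / (η / 2)) / η + 1 ≤ (N : ℝ) :=
    hN₀.trans (by exact_mod_cast hN)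
  have hNpos : (0 : ℝ) < N := lt_of_lt_of_le (by positivity) hNr
  set ζ : ℕ → Ω → ℝ := fun j ω => Ψ (lam j ω) (E j ω) with hζ
  set ζ' : ℕ → Ω → ℝ := fun j ω => Ψ (lam j ω) (clip M (V j ω)) with hζ'
  have hcV (j : ℕ) : MemLp (fun ω => clip M (V j ω)) 2 P :=
    MemLp.of_bound ((measurable_clip M).comp (hV j)).aestronglyMeasurable M
      (Eventually.of_forall fun ω => abs_clip_le hM _)
  have hζm (j : ℕ) : Measurable (ζ j) := hΨ.measurable.comp ((hlam j).prodMk (hE j))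
  have hζ'm (j : ℕ) : Measurable (ζ' j) :=
    hΨ.measurable.comp ((hlam j).prodMk ((measurable_clip M).comp (hV j)))
  have hζi (j : ℕ) : Integrable (ζ j) P := hΨ.integrable (hlam j) (hE j) (hE2' j)
  have hζ'i (j : ℕ) : Integrable (ζ' j) P :=
    hΨ.integrable (hlam j) ((measurable_clip M).comp (hV j)) (hcV j)
  have hζ'b (j : ℕ) (ω : Ω) : |ζ' j ω| ≤ B := by
    refine (hΨ.abs_le _ _).trans ?_
    have : clip M (V j ω) ^ 2 ≤ M ^ 2 := sq_le_sq' (abs_le.1 (abs_clip_le hM _)).1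
      (abs_le.1 (abs_clip_le hM _)).2
    rw [hB]; gcongr
  have hdiff (j : ℕ) : ∫ ω, |ζ j ω - ζ' j ω| ∂P ≤ η / 8 := by
    have h1 : ∫ ω, E j ω ^ 2 ∂P ≤ s2 :=
      ((hident j).comp (u := fun x => x ^ 2) (by fun_prop)).integral_eq.le
    have h2 : ∫ ω, (E j ω - clip M (E j ω)) ^ 2 ∂P ≤ e :=
      (((hident j).comp (u := fun x => (x - clip M x) ^ 2)
        ((measurable_id.sub (measurable_clip M)).pow_const 2)).integral_eq.le).trans hτ
    refine (hΨ.integral_abs_sub_clip_le hR (hlam j) (hE j) (hV j) (hE2' j) (hV2 j) hM hθ he1 h1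
      (hVe j) h2).trans ?_
    rw [mul_add]; linarith
  set c : ℕ → ℝ := fun j => ∫ ω, ζ' j ω ∂P with hc
  have hcB (j : ℕ) : |c j| ≤ B := by
    refine abs_integral_le_integral_abs.trans ?_
    refine (integral_mono (hζ'i j).abs (integrable_const B) (hζ'b j)).trans ?_
    simp
  have hmean (j : ℕ) : |c j - ∫ ω, ζ j ω ∂P| ≤ η / 8 := by
    rw [hc, ← integral_sub (hζ'i j) (hζi j)]
    refine abs_integral_le_integral_abs.trans ?_
    simp_rw [abs_sub_comm (ζ' j _)]
    exact hdiff j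
  have hfluct : ∫ ω, (∑ j ∈ Finset.range N, (ζ' j ω - c j)) ^ 2 ∂P
      ≤ N * (2 * g) * (2 * B) ^ 2 := by
    refine integral_sq_sum_le_of_uncorrelated (fun j => (hζ'm j).sub_const _) (fun j ω => ?_)
      (fun i j hij => ?_) N
    · refine (abs_sub _ _).trans ?_
      linarith [hζ'b j ω, hcB j]
    · have hm : Measurable (fun p : Λ × ℝ => Ψ p.1 (clip M p.2)) :=
        hΨ.measurable.comp (measurable_fst.prodMk ((measurable_clip M).comp measurable_snd))
      have hi : IndepFun (fun ω => ζ' i ω - c i) (fun ω => ζ' j ω - c j) P :=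
        (hVind i j hij).comp (hm.sub_const (c i)) (hm.sub_const (c j))
      rw [hi.integral_fun_mul_eq_mul_integral
        ((hζ'm i).sub_const _).aestronglyMeasurable ((hζ'm j).sub_const _).aestronglyMeasurable,
        integral_sub (hζ'i i) (integrable_const _)]
      simp [hc]
  have hmS : Measurable (fun ω => ∑ j ∈ Finset.range N, (ζ' j ω - c j)) :=
    Finset.measurable_fun_sum _ fun j _ => (hζ'm j).sub_const _
  have hSi : Integrable (fun ω => (∑ j ∈ Finset.range N, (ζ' j ω - c j)) ^ 2) P := by
    refine integrable_of_bdd (hmS.pow_const 2) ((∑ j ∈ Finset.range N, (2 * B)) ^ 2) fun ω => ?_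
    rw [abs_pow]
    refine pow_le_pow_left₀ (abs_nonneg _) ((Finset.abs_sum_le_sum_abs _ _).trans
      (Finset.sum_le_sum fun j _ => (abs_sub _ _).trans ?_)) 2
    linarith [hζ'b j ω, hcB j]
  -- Truncation errors plus the centred sum of truncated terms. The three parts integrate to at most
  -- `η/4 + η/8 + η/2`.
  have hpt (ω : Ω) : |(∑ j ∈ Finset.range N, (ζ j ω - ∫ ω', ζ j ω' ∂P)) / N|
      ≤ (∑ j ∈ Finset.range N, (|ζ j ω - ζ' j ω| + η / 8)) / N
        + ((η / 2) / 4 + ((∑ j ∈ Finset.range N, (ζ' j ω - c j)) ^ 2 / (N : ℝ) ^ 2) / (η / 2)) := by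
    have h1 : (∑ j ∈ Finset.range N, (ζ j ω - ∫ ω', ζ j ω' ∂P)) / N
        = (∑ j ∈ Finset.range N, ((ζ j ω - ζ' j ω) + (c j - ∫ ω', ζ j ω' ∂P))) / N
          + (∑ j ∈ Finset.range N, (ζ' j ω - c j)) / N := by
      rw [← add_div, ← Finset.sum_add_distrib]
      congr 1
      exact Finset.sum_congr rfl fun j _ => by ring
    rw [h1]
    refine (abs_add_le _ _).trans (add_le_add ?_ ?_)
    · rw [abs_div, abs_of_pos hNpos]
      gcongr
      refine (Finset.abs_sum_le_sum_abs _ _).trans (Finset.sum_le_sum fun j _ => ?_)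
      exact (abs_add_le _ _).trans (by linarith [hmean j])
    · have := abs_le_of_sq ((∑ j ∈ Finset.range N, (ζ' j ω - c j)) / N) (half_pos hη)
      rwa [div_pow] at this
  have hI1 : Integrable (fun ω => (∑ j ∈ Finset.range N, (|ζ j ω - ζ' j ω| + η / 8)) / N) P :=
    (integrable_finsetSum _ fun j _ => (((hζi j).sub (hζ'i j)).abs.add
      (integrable_const _))).div_const _
  have hI2 : Integrable (fun ω => (η / 2) / 4
      + ((∑ j ∈ Finset.range N, (ζ' j ω - c j)) ^ 2 / (N : ℝ) ^ 2) / (η / 2)) P :=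
    (integrable_const _).add ((hSi.div_const _).div_const _)
  have hI0 : Integrable (fun ω => |(∑ j ∈ Finset.range N, (ζ j ω - ∫ ω', ζ j ω' ∂P)) / N|) P :=
    ((integrable_finsetSum _ fun j _ => (hζi j).sub (integrable_const _)).div_const _).abs
  refine (integral_mono hI0 (hI1.add hI2) hpt).trans ?_
  change ∫ ω, ((∑ j ∈ Finset.range N, (|ζ j ω - ζ' j ω| + η / 8)) / N
        + ((η / 2) / 4 + ((∑ j ∈ Finset.range N, (ζ' j ω - c j)) ^ 2 / (N : ℝ) ^ 2) / (η / 2))) ∂P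
      ≤ η
  have hsum : ∫ ω, ∑ j ∈ Finset.range N, (|ζ j ω - ζ' j ω| + η / 8) ∂P
      = ∑ j ∈ Finset.range N, ∫ ω, (|ζ j ω - ζ' j ω| + η / 8) ∂P :=
    integral_finsetSum _ fun j _ => ((hζi j).sub (hζ'i j)).abs.add (integrable_const _)
  have hsq : ∫ ω, (∑ j ∈ Finset.range N, (ζ' j ω - c j)) ^ 2 / (N : ℝ) ^ 2 / (η / 2) ∂P
      = (∫ ω, (∑ j ∈ Finset.range N, (ζ' j ω - c j)) ^ 2 ∂P) / (N : ℝ) ^ 2 / (η / 2) := by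
    rw [integral_div, integral_div]
  rw [integral_add hI1 hI2, integral_div, integral_add (integrable_const _)
    ((hSi.div_const _).div_const _), hsq, hsum]
  have b1 : (∑ j ∈ Finset.range N, ∫ ω, (|ζ j ω - ζ' j ω| + η / 8) ∂P) / N ≤ η / 4 := by
    rw [div_le_iff₀ hNpos]
    calc ∑ j ∈ Finset.range N, ∫ ω, (|ζ j ω - ζ' j ω| + η / 8) ∂P
        ≤ ∑ j ∈ Finset.range N, η / 4 := by
          refine Finset.sum_le_sum fun j _ => ?_
          have hI : Integrable (fun ω => |ζ j ω - ζ' j ω|) P := ((hζi j).sub (hζ'i j)).abs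
          rw [integral_add hI (integrable_const _)]
          simp only [integral_const, probReal_univ, smul_eq_mul, one_mul]
          linarith [hdiff j]
      _ = η / 4 * N := by simp [mul_comm]
  have b2 : (∫ ω, (∑ j ∈ Finset.range N, (ζ' j ω - c j)) ^ 2 ∂P) / (N : ℝ) ^ 2 / (η / 2)
      ≤ η / 2 := by
    have : (∫ ω, (∑ j ∈ Finset.range N, (ζ' j ω - c j)) ^ 2 ∂P) / (N : ℝ) ^ 2 / (η / 2)
        ≤ (N * (2 * g) * (2 * B) ^ 2) / (N : ℝ) ^ 2 / (η / 2) := by gcongr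
    refine this.trans ?_
    have e2 : (N * (2 * g) * (2 * B) ^ 2) / (N : ℝ) ^ 2 / (η / 2)
        = (2 * g * (2 * B) ^ 2 / (η / 2)) / N := by field_simp
    rw [e2, div_le_iff₀ hNpos]
    have e3 : 2 * (2 * g * (2 * B) ^ 2 / (η / 2)) / η ≤ N := by linarith
    rw [div_le_iff₀ hη] at e3
    linarith
  simp only [integral_const, probReal_univ, smul_eq_mul, one_mul]
  linarith

end LLN


/-! ## The error process -/

section AR

variable {Ω : Type*} [MeasurableSpace Ω] {P : Measure Ω} [IsProbabilityMeasure P] {ρ σu : ℝ}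
  {ε u : ℤ → Ω → ℝ}

/-- Unrolling the recursion exhibits the error as a moving average of `K` innovations plus a
geometrically small remainder. -/
lemma IsStationaryAR1.iterate (h : IsStationaryAR1 P ρ σu ε u) (K : ℕ) :
    ∀ t : ℤ, ∀ᵐ ω ∂P, ε t ω = ∑ i ∈ Finset.range K, ρ ^ i * u (t - i) ω + ρ ^ K * ε (t - K) ω := by
  induction K with
  | zero => intro t; simp
  | succ K ih =>
    intro t
    filter_upwards [ih t, h.recursion (t - K)] with ω h1 h2
    rw [h1, h2, Finset.sum_range_succ, show t - (K : ℤ) - 1 = t - ((K + 1 : ℕ) : ℤ) by push_cast; ring]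
    ring

lemma IsStationaryAR1.identDistrib_error (h : IsStationaryAR1 P ρ σu ε u) (t : ℤ) :
    IdentDistrib (ε t) (ε 0) P P := by
  have := (h.stationary t).comp (u := fun e : ℤ → ℝ => e 0) (by fun_prop)
  simpa [Function.comp_def] using this

lemma IsStationaryAR1.measurable_path (h : IsStationaryAR1 P ρ σu ε u) :
    Measurable (fun ω t => ε t ω) := measurable_pi_iff.2 h.measurable_error

/-- The errors have a finite second moment. -/
lemma IsStationaryAR1.memLp_error (h : IsStationaryAR1 P ρ σu ε u) (hρ : |ρ| < 1) (t : ℤ) :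
    MemLp (ε t) 2 P := by
  refine (h.identDistrib_error t).memLp_iff.2 ⟨(h.measurable_error 0).aestronglyMeasurable, ?_⟩
  -- Integrability of the errors is not assumed. The partial innovation sums are bounded in `L²` by
  -- Minkowski and the geometric series, and they are shown to converge to `ε 0` in probability.
  set S : ℕ → Ω → ℝ := fun K ω => ∑ i ∈ Finset.range K, ρ ^ i * u (0 - i) ω with hS
  have hSm (K : ℕ) : Measurable (S K) :=
    Finset.measurable_fun_sum _ fun i _ => (h.measurable_innovation _).const_mul _
  set C : ℝ := (eLpNorm (u 0) 2 P).toReal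
  have hC : eLpNorm (u 0) 2 P = ENNReal.ofReal C := (ENNReal.ofReal_toReal h.memLp.2.ne).symm
  have hbound (K : ℕ) : eLpNorm (S K) 2 P ≤ ENNReal.ofReal ((1 - |ρ|)⁻¹ * C) := by
    have hSK : S K = ∑ i ∈ Finset.range K, (fun ω => ρ ^ i * u (0 - i) ω) := by
      ext ω; simp [hS]
    rw [hSK]
    refine (eLpNorm_sum_le (fun i _ =>
      ((h.measurable_innovation _).const_mul _).aestronglyMeasurable) (by norm_num)).trans ?_
    have hterm (i : ℕ) : eLpNorm (fun ω => ρ ^ i * u (0 - i) ω) 2 P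
        = ENNReal.ofReal (|ρ| ^ i * C) := by
      have h1 := eLpNorm_const_smul (ρ ^ i) (u (0 - i)) 2 P
      have h2 : (ρ ^ i) • u (0 - i) = fun ω => ρ ^ i * u (0 - i) ω := rfl
      rw [h2] at h1
      rw [h1, (h.identDistrib (0 - i)).eLpNorm_eq, hC, Real.enorm_eq_ofReal_abs,
        ← ENNReal.ofReal_mul (abs_nonneg _), abs_pow]
    simp_rw [hterm]
    rw [← ENNReal.ofReal_sum_of_nonneg fun i _ => by positivity, ← Finset.sum_mul]
    refine ENNReal.ofReal_le_ofReal (mul_le_mul_of_nonneg_right ?_ ENNReal.toReal_nonneg)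
    rw [← tsum_geometric_of_lt_one (abs_nonneg ρ) hρ]
    exact (summable_geometric_of_lt_one (abs_nonneg ρ) hρ).sum_le_tsum _ fun _ _ => by positivity
  have hrem : TendstoInMeasure P (fun (K : ℕ) ω => ρ ^ K * ε 0 ω) atTop (fun _ => 0) := by
    refine tendstoInMeasure_of_tendsto_ae
      (fun K => ((h.measurable_error 0).const_mul _).aestronglyMeasurable)
      (Eventually.of_forall fun ω => ?_)
    simpa using (tendsto_pow_atTop_nhds_zero_of_abs_lt_one hρ).mul_const (ε 0 ω)
  -- The remainder `ρ^K ε_{-K}` has the law of `ρ^K ε_0` by stationarity, and the latter tends to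
  -- zero pointwise.
  have hconv : TendstoInMeasure P S atTop (ε 0) := by
    intro δ hδ
    refine (hrem δ hδ).congr fun K => ?_
    have h1 : P {ω | δ ≤ edist (S K ω) (ε 0 ω)} = P {ω | δ ≤ edist (ρ ^ K * ε (0 - K) ω) 0} := by
      refine measure_congr ?_
      filter_upwards [h.iterate K 0] with ω hω
      have : edist (S K ω) (ε 0 ω) = edist (ρ ^ K * ε (0 - K) ω) 0 := by
        rw [edist_comm, edist_eq_enorm_sub, edist_eq_enorm_sub, hω]
        simp [hS]
      change (δ ≤ _) = (δ ≤ _)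
      rw [this]
    rw [h1]
    have h2 := ((h.identDistrib_error (0 - K)).comp (u := fun x => ρ ^ K * x)
      (by fun_prop)).measure_mem_eq (s := {x | δ ≤ edist x 0})
      (measurableSet_le measurable_const (by fun_prop))
    exact h2.symm
  -- Fatou's lemma along an almost surely convergent subsequence transfers the `L²` bound to the
  -- limit.
  obtain ⟨ns, -, hae⟩ := hconv.exists_seq_tendsto_ae
  refine lt_of_le_of_lt (Lp.eLpNorm_lim_le_liminf_eLpNorm
    (fun n => (hSm (ns n)).aestronglyMeasurable) (ε 0) hae) ?_
  refine lt_of_le_of_lt (Filter.liminf_le_of_frequently_le' (Frequently.of_forall fun n => hbound _))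
    ENNReal.ofReal_lt_top

/-- Taking means in the recursion gives `(1 - ρ) E ε = 0`. -/
lemma IsStationaryAR1.integral_error (h : IsStationaryAR1 P ρ σu ε u) (hρ : |ρ| < 1) (t : ℤ) :
    ∫ ω, ε t ω ∂P = 0 := by
  rw [(h.identDistrib_error t).integral_eq]
  have i1 (t : ℤ) : Integrable (ε t) P := (h.memLp_error hρ t).integrable (by norm_num)
  have i2 : Integrable (u 0) P := h.memLp.integrable (by norm_num)
  have e1 : ∫ ω, ε 0 ω ∂P = ρ * ∫ ω, ε (0 - 1) ω ∂P + ∫ ω, u 0 ω ∂P := by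
    rw [integral_congr_ae (h.recursion 0), integral_add ((i1 _).const_mul _) i2,
      integral_const_mul]
  rw [h.mean_zero, (h.identDistrib_error (0 - 1)).integral_eq] at e1
  have : (1 - ρ) * ∫ ω, ε 0 ω ∂P = 0 := by linarith
  rcases mul_eq_zero.1 this with h0 | h0
  · linarith [(abs_lt.1 hρ).2]
  · exact h0

/-- The focal mean of an error path in the second of two consecutive sections, the first of which
starts after time `k`. -/
noncomputable def errorMean (L r m : ℕ) (k : ℤ) (e : ℤ → ℝ) : ℝ :=
  (∑ t ∈ Finset.Icc (r * L + 1 + m) (2 * (r * L)), e ((t : ℤ) + k)) / ((r * L - m : ℕ) : ℝ)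

lemma measurable_errorMean (L r m : ℕ) (k : ℤ) : Measurable (errorMean L r m k) := by
  unfold errorMean
  fun_prop

variable {L r m : ℕ}

lemma errorMean_sub_mul (k l : ℤ) (c : ℝ) (e : ℤ → ℝ) :
    errorMean L r m k e - c * errorMean L r m (k - l) e
      = errorMean L r m k (fun t => e t - c * e (t - l)) := by
  simp only [errorMean]
  rw [← mul_div_assoc, ← sub_div, Finset.mul_sum, ← Finset.sum_sub_distrib]
  simp only [add_sub_assoc]

lemma IsStationaryAR1.identDistrib_errorMean (h : IsStationaryAR1 P ρ σu ε u) (k l : ℤ) :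
    IdentDistrib (fun ω => errorMean L r m k (fun t => ε t ω))
      (fun ω => errorMean L r m l (fun t => ε t ω)) P P := by
  have h1 := (h.stationary k).comp (measurable_errorMean L r m 0)
  have h2 := (h.stationary l).comp (measurable_errorMean L r m 0)
  have := h1.trans h2.symm
  simpa [Function.comp_def, errorMean] using this

lemma IsStationaryAR1.memLp_errorMean (h : IsStationaryAR1 P ρ σu ε u) (hρ : |ρ| < 1) (k : ℤ) :
    MemLp (fun ω => errorMean L r m k (fun t => ε t ω)) 2 P := by
  unfold errorMean
  simp_rw [div_eq_inv_mul]
  exact (memLp_finsetSum _ fun t _ => h.memLp_error hρ _).const_mul _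

lemma IsStationaryAR1.measurable_errorMean_path (h : IsStationaryAR1 P ρ σu ε u) (k : ℤ) :
    Measurable (fun ω => errorMean L r m k (fun t => ε t ω)) :=
  (measurable_errorMean L r m k).comp h.measurable_path

lemma IsStationaryAR1.integral_errorMean (h : IsStationaryAR1 P ρ σu ε u) (hρ : |ρ| < 1) (k : ℤ) :
    ∫ ω, errorMean L r m k (fun t => ε t ω) ∂P = 0 := by
  unfold errorMean
  rw [integral_div, integral_finsetSum _ fun t _ => (h.memLp_error hρ _).integrable (by norm_num)]
  simp [h.integral_error hρ]

/-- Focal error means of sections which are far apart are independent up to a geometrically small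
error. -/
lemma IsStationaryAR1.indepFun_errorMean_sub (h : IsStationaryAR1 P ρ σu ε u) (K : ℕ) {k l : ℤ}
    (hkl : k + 2 * (r * L : ℕ) + K ≤ l) :
    IndepFun
      (fun ω => errorMean L r m k (fun t => ε t ω) - ρ ^ K * errorMean L r m (k - K) (fun t => ε t ω))
      (fun ω => errorMean L r m l (fun t => ε t ω) - ρ ^ K * errorMean L r m (l - K) (fun t => ε t ω))
      P := by
  classical
  have hae (k : ℤ) : (fun ω => errorMean L r m k
        (fun t => ∑ i ∈ Finset.range K, ρ ^ i * u (t - i) ω)) =ᵐ[P]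
      (fun ω => errorMean L r m k (fun t => ε t ω)
        - ρ ^ K * errorMean L r m (k - K) (fun t => ε t ω)) := by
    filter_upwards [ae_all_iff.2 (h.iterate K)] with ω hω
    rw [errorMean_sub_mul]
    congr 1
    ext t
    rw [hω t]; ring
  refine IndepFun.congr ?_ (hae k) (hae l)
  -- The truncated moving averages over a pair starting after `k` use only innovations in this
  -- window, and the gap hypothesis makes the windows at `k` and `l` disjoint.
  set S : ℤ → Finset ℤ := fun k => Finset.Ioc (k - K) (k + 2 * (r * L : ℕ)) with hS
  have hdisj : Disjoint (S k) (S l) := by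
    rw [Finset.disjoint_left]
    intro a ha hb
    simp only [hS, Finset.mem_Ioc] at ha hb
    linarith [ha.2, hb.1]
  have hind := h.indep.indepFun_finset (S k) (S l) hdisj h.measurable_innovation
  let φ : (k : ℤ) → (S k → ℝ) → ℝ := fun k x => errorMean L r m k
    (fun t => ∑ i ∈ Finset.range K, ρ ^ i * (if ht : t - (i : ℤ) ∈ S k then x ⟨t - i, ht⟩ else 0))
  have hφm (k : ℤ) : Measurable (φ k) := by
    refine (measurable_errorMean L r m k).comp (measurable_pi_iff.2 fun t => ?_)
    refine Finset.measurable_fun_sum _ fun i _ => Measurable.const_mul ?_ _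
    split_ifs
    · exact measurable_pi_apply _
    · exact measurable_const
  have hφ (k : ℤ) : (fun ω => errorMean L r m k
        (fun t => ∑ i ∈ Finset.range K, ρ ^ i * u (t - i) ω))
      = φ k ∘ (fun ω (i : S k) => u i ω) := by
    ext ω
    simp only [φ, errorMean, Function.comp_apply]
    congr 1
    refine Finset.sum_congr rfl fun t ht => Finset.sum_congr rfl fun i hi => ?_
    rw [Finset.mem_Icc] at ht
    rw [Finset.mem_range] at hi
    rw [dif_pos]
    simp only [hS, Finset.mem_Ioc]
    have h1 : ((r * L + 1 + m : ℕ) : ℤ) ≤ t := by exact_mod_cast ht.1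
    have h2 : (t : ℤ) ≤ ((2 * (r * L) : ℕ) : ℤ) := by exact_mod_cast ht.2
    have h3 : (0 : ℤ) ≤ ((r * L + 1 + m : ℕ) : ℤ) := Int.natCast_nonneg _
    push_cast at *
    constructor <;> omega
  rw [hφ, hφ]
  exact hind.comp (hφm k) (hφm l)

end AR

/-! ## Sections -/

section Sections

variable {Ω : Type*} [MeasurableSpace Ω] {P : Measure Ω} [IsProbabilityMeasure P]
  {q : unitInterval} {W : Ω → ℕ → Bool}

lemma iIndepFun_labels (hW : Measurable W) (hWlaw : P.map W = design q) :
    iIndepFun (fun k ω => W ω k) P := by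
  have hm (k : ℕ) : Measurable (fun ω => W ω k) := (measurable_pi_apply k).comp hW
  rw [iIndepFun_iff_map_fun_eq_infinitePi_map hm]
  have hk (k : ℕ) : P.map (fun ω => W ω k) = bernoulliMeasure true false q := by
    have := Measure.infinitePi_map_eval (fun _ : ℕ => bernoulliMeasure true false q) k
    rw [← this]
    change _ = Measure.map (fun x => x k) (design q)
    rw [← hWlaw, Measure.map_map (measurable_pi_apply k) hW]
    rfl
  simp_rw [hk]
  exact hWlaw

/-- The labels of the blocks of the pair of sections `2j + 1`, `2j + 2`. -/
def pairLabels (r j : ℕ) (w : ℕ → Bool) (i : Fin (2 * r)) : Bool := w (2 * j * r + 1 + i)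

lemma measurable_pairLabels (r j : ℕ) : Measurable (pairLabels r j) :=
  measurable_pi_iff.2 fun _ => measurable_pi_apply _

lemma indepFun_pairLabels (hW : Measurable W) (hWlaw : P.map W = design q) {r i j : ℕ}
    (hij : i < j) : IndepFun (fun ω => pairLabels r i (W ω)) (fun ω => pairLabels r j (W ω)) P := by
  classical
  set S : ℕ → Finset ℕ := fun j => Finset.Ico (2 * j * r + 1) (2 * (j + 1) * r + 1) with hS
  have hle : 2 * (i + 1) * r ≤ 2 * j * r := Nat.mul_le_mul_right r (by omega)
  have hdisj : Disjoint (S i) (S j) := by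
    rw [Finset.disjoint_left]
    intro a ha hb
    simp only [hS, Finset.mem_Ico] at ha hb
    omega
  have hind := (iIndepFun_labels hW hWlaw).indepFun_finset (S i) (S j) hdisj
    (fun k => (measurable_pi_apply k).comp hW)
  have hmem (j : ℕ) (a : Fin (2 * r)) : 2 * j * r + 1 + (a : ℕ) ∈ S j := by
    simp only [hS, Finset.mem_Ico]
    have : 2 * (j + 1) * r = 2 * j * r + 2 * r := by ring
    have := a.2
    omega
  exact hind.comp (φ := fun x a => x ⟨_, hmem i a⟩) (ψ := fun x a => x ⟨_, hmem j a⟩)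
    (by fun_prop) (by fun_prop)

variable {ρ σu : ℝ} {ε u : ℤ → Ω → ℝ} {L r m : ℕ}

/-- The law of large numbers for functions of the labels and of the focal error mean of pairs of
sections. -/
theorem exists_forall_integral_abs_pairAverage_le (hrL : 0 < r * L) (hW : Measurable W)
    (hWlaw : P.map W = design q) (hρ : |ρ| < 1) (hε : IsStationaryAR1 P ρ σu ε u)
    (hind : IndepFun W (fun ω t => ε t ω) P) {R η : ℝ} (hR : 0 ≤ R) (hη : 0 < η) :
    ∃ N₀ : ℕ, ∀ N ≥ N₀, ∀ Ψ : (Fin (2 * r) → Bool) → ℝ → ℝ, QuadBound R Ψ →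
      ∫ ω, |(∑ j ∈ Finset.range N,
        (Ψ (pairLabels r j (W ω)) (errorMean L r m (2 * j * (r * L) : ℕ) (fun t => ε t ω))
        - ∫ ω', Ψ (pairLabels r j (W ω'))
            (errorMean L r m (2 * j * (r * L) : ℕ) (fun t => ε t ω')) ∂P)) / N| ∂P ≤ η := by
  refine exists_forall_integral_abs_average_sub_le (lam := fun j ω => pairLabels r j (W ω))
    (E := fun j ω => errorMean L r m (2 * j * (r * L) : ℕ) (fun t => ε t ω))
    (fun j => (measurable_pairLabels r j).comp hW) (fun j => hε.measurable_errorMean_path _)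
    (fun j => hε.identDistrib_errorMean _ _) (hε.memLp_errorMean hρ _) (fun e he => ?_) hR hη
  set s2 := ∫ ω, errorMean L r m 0 (fun t => ε t ω) ^ 2 ∂P with hs2
  have hpow : Tendsto (fun K : ℕ => (ρ ^ K) ^ 2 * s2) atTop (𝓝 0) := by
    simpa using ((tendsto_pow_atTop_nhds_zero_of_abs_lt_one hρ).pow 2).mul_const s2
  obtain ⟨K, hK⟩ := (hpow.eventually (gt_mem_nhds he)).exists
  have hV (k : ℤ) : Measurable (fun ω => errorMean L r m k (fun t => ε t ω)
      - ρ ^ K * errorMean L r m (k - K) (fun t => ε t ω)) :=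
    (hε.measurable_errorMean_path _).sub ((hε.measurable_errorMean_path _).const_mul _)
  -- Pairs at distance `K + 1` or more start at least `2rL + K` periods apart, because `rL ≥ 1`.
  refine ⟨K + 1, fun j ω => errorMean L r m (2 * j * (r * L) : ℕ) (fun t => ε t ω)
      - ρ ^ K * errorMean L r m ((2 * j * (r * L) : ℕ) - K) (fun t => ε t ω),
    fun j => hV _, fun j => (hε.memLp_errorMean hρ _).sub ((hε.memLp_errorMean hρ _).const_mul _),
    fun j => ?_, fun i j hij => ?_⟩
  · simp_rw [sub_sub_cancel, mul_pow]
    rw [integral_const_mul]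
    have h2 := ((hε.identDistrib_errorMean (L := L) (r := r) (m := m)
      ((2 * j * (r * L) : ℕ) - K) 0).comp (u := fun x => x ^ 2) (by fun_prop)).integral_eq
    simp only [Function.comp_apply] at h2
    rw [h2]
    exact hK.le
  · have hm : Measurable (fun (w : ℕ → Bool) => (pairLabels r i w, pairLabels r j w)) :=
      (measurable_pairLabels r i).prodMk (measurable_pairLabels r j)
    have hme (k : ℤ) : Measurable (fun e : ℤ → ℝ =>
        errorMean L r m k e - ρ ^ K * errorMean L r m (k - K) e) :=
      (measurable_errorMean L r m k).sub ((measurable_errorMean L r m (k - K)).const_mul _)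
    refine indepFun_prodMk_prodMk ((measurable_pairLabels r i).comp hW)
      ((measurable_pairLabels r j).comp hW) (hV _) (hV _)
      (hind.comp hm ((hme (2 * i * (r * L) : ℕ)).prodMk (hme (2 * j * (r * L) : ℕ))))
      (indepFun_pairLabels hW hWlaw (by omega)) (hε.indepFun_errorMean_sub K ?_)
    obtain ⟨d, rfl⟩ := Nat.exists_eq_add_of_le hij
    have : K ≤ 2 * (K + d) * (r * L) := by nlinarith
    have e : 2 * (i + (K + 1) + d) * (r * L) = 2 * i * (r * L) + 2 * (r * L) + 2 * (K + d) * (r * L) := by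
      ring
    rw [e]
    push_cast
    have : (K : ℤ) ≤ 2 * (K + d) * (r * L) := by exact_mod_cast this
    linarith

end Sections


/-! ## Focal means as linear forms in the labels of a pair of sections -/

section Structure

/-- The weight of the `i`-th block of a pair of sections in the focal mean of the pair. -/
noncomputable def lagWeight (L r m m₀ : ℕ) (β : ℕ → ℝ) (i : ℕ) : ℝ :=
  (∑ t ∈ Finset.Icc (r * L + 1 + m) (2 * (r * L)), ∑ ℓ ∈ Finset.range (m₀ + 1),
    if (t - ℓ - 1) / L = i then β ℓ else 0) / ((r * L - m : ℕ) : ℝ)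

/-- The label part of the focal mean. -/
noncomputable def labelMean (L r m m₀ : ℕ) (μ : ℝ) (β : ℕ → ℝ) (l : Fin (2 * r) → Bool) : ℝ :=
  μ + ∑ i : Fin (2 * r), lagWeight L r m m₀ β i * label (l i)

variable {L r m m₀ : ℕ} {μ : ℝ} {β : ℕ → ℝ}

lemma focalMean_shift (y : ℕ → ℝ) (j : ℕ) :
    focalMean L r m y (j + 1) = (∑ t ∈ Finset.Icc (r * L + 1 + m) (2 * (r * L)),
      y (2 * j * (r * L) + t)) / ((r * L - m : ℕ) : ℝ) := by
  rw [focalMean]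
  congr 1
  have e1 : (2 * (j + 1) - 1) * (r * L) + 1 + m = (r * L + 1 + m) + 2 * j * (r * L) := by
    rw [show 2 * (j + 1) - 1 = 2 * j + 1 by omega]; ring
  have e2 : 2 * (j + 1) * (r * L) = 2 * (r * L) + 2 * j * (r * L) := by ring
  rw [e1, e2, ← Finset.map_add_right_Icc, Finset.sum_map]
  simp only [addRightEmbedding_apply, add_comm]

/-- A focal time exceeds `rL + m` within its pair and the lag is at most `m₀ ≤ rL`, so the lagged
time stays inside the pair. In particular the truncated subtraction and the untreated period 0 play
no role. -/
lemma treatment_shift (hm₀ : m₀ ≤ r * L) (hL : 0 < L) (w : ℕ → Bool) (j : ℕ) {t ℓ : ℕ}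
    (ht : t ∈ Finset.Icc (r * L + 1 + m) (2 * (r * L))) (hℓ : ℓ ∈ Finset.range (m₀ + 1)) :
    treatment L w (2 * j * (r * L) + t - ℓ)
      = ∑ i : Fin (2 * r), if (t - ℓ - 1) / L = i then label (pairLabels r j w i) else 0 := by
  rw [Finset.mem_Icc] at ht
  rw [Finset.mem_range] at hℓ
  have hlt : (t - ℓ - 1) / L < 2 * r := by
    rw [Nat.div_lt_iff_lt_mul hL, mul_assoc]; omega
  have e1 : (2 * j * (r * L) + t - ℓ - 1) / L = 2 * j * r + (t - ℓ - 1) / L := by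
    rw [show 2 * j * (r * L) + t - ℓ - 1 = (t - ℓ - 1) + L * (2 * j * r) by
      rw [show L * (2 * j * r) = 2 * j * (r * L) by ring]; omega, Nat.add_mul_div_left _ _ hL, add_comm]
  rw [treatment, if_neg (by omega), e1, Finset.sum_eq_single ⟨(t - ℓ - 1) / L, hlt⟩]
  · rw [if_pos rfl, pairLabels]
    congr 2
    simp only
    omega
  · intro b _ hb
    rw [if_neg]
    intro h
    exact hb (Fin.ext h.symm)
  · intro h; exact absurd (Finset.mem_univ _) h

/-- The reduction on which everything rests: a focal mean is an affine form in the labels of its own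
pair plus an error mean. Pairs are numbered from 0 here, so pair `j` consists of sections `2j + 1`
and `2j + 2`. -/
lemma focalMean_outcome (hm : m < m₀) (hm₀ : m₀ ≤ r * L) (e : ℤ → ℝ) (w : ℕ → Bool) (j : ℕ) :
    focalMean L r m (outcome L m₀ μ β e w) (j + 1)
      = labelMean L r m m₀ μ β (pairLabels r j w) + errorMean L r m (2 * j * (r * L) : ℕ) e := by
  have hL : 0 < L := Nat.pos_of_ne_zero (by rintro rfl; omega)
  have hn : (((r * L - m : ℕ) : ℝ)) ≠ 0 := by
    have : 0 < r * L - m := by omega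
    exact_mod_cast this.ne'
  rw [focalMean_shift, labelMean, errorMean]
  simp only [outcome, Finset.sum_add_distrib]
  rw [add_div, add_div]
  congr 1
  · congr 1
    · rw [Finset.sum_const, Nat.card_Icc, nsmul_eq_mul,
        show 2 * (r * L) + 1 - (r * L + 1 + m) = r * L - m by omega, mul_div_cancel_left₀ _ hn]
    · simp only [lagWeight, div_mul_eq_mul_div, ← Finset.sum_div]
      congr 1
      have h1 : ∀ t ∈ Finset.Icc (r * L + 1 + m) (2 * (r * L)),
          ∑ ℓ ∈ Finset.range (m₀ + 1), β ℓ * treatment L w (2 * j * (r * L) + t - ℓ)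
          = ∑ ℓ ∈ Finset.range (m₀ + 1), ∑ i : Fin (2 * r),
            (if (t - ℓ - 1) / L = i then β ℓ else 0) * label (pairLabels r j w i) := by
        intro t ht
        refine Finset.sum_congr rfl fun ℓ hℓ => ?_
        rw [treatment_shift hm₀ hL w j ht hℓ, Finset.mul_sum]
        refine Finset.sum_congr rfl fun i _ => ?_
        split_ifs <;> ring
      rw [Finset.sum_congr rfl h1]
      simp_rw [Finset.sum_mul]
      rw [Finset.sum_comm (s := Finset.univ)]
      refine Finset.sum_congr rfl fun t _ => ?_
      rw [Finset.sum_comm]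
  · congr 1
    refine Finset.sum_congr rfl fun t _ => ?_
    congr 1
    push_cast
    ring

/-- The weight of the last block of the odd section is the tail signal. -/
lemma lagWeight_last (hm₀ : m₀ ≤ r * L) (hL : 0 < L) (hr : 0 < r) :
    lagWeight L r m m₀ β (r - 1) = tailSignal L r m m₀ β := by
  rw [lagWeight, tailSignal]
  congr 1
  rw [Finset.sum_comm]
  have hsub : Finset.Icc (m + 1) m₀ ⊆ Finset.range (m₀ + 1) := fun ℓ hℓ => by
    rw [Finset.mem_Icc] at hℓ; rw [Finset.mem_range]; omega
  rw [Finset.sum_subset hsub]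
  · refine Finset.sum_congr rfl fun ℓ hℓ => ?_
    rw [Finset.mem_range] at hℓ
    rw [← Finset.sum_filter, Finset.sum_const, nsmul_eq_mul]
    congr 2
    obtain ⟨s, rfl⟩ : ∃ s, r = s + 1 := ⟨r - 1, by omega⟩
    -- The focal times whose `ℓ`-th lag falls in the last odd block form an interval with `min L (ℓ
    -- - m)` elements; the upper end of the section does not cut it, since `ℓ ≤ m₀ ≤ rL`.
    have hset : (Finset.Icc ((s + 1) * L + 1 + m) (2 * ((s + 1) * L))).filter
        (fun t => (t - ℓ - 1) / L = s + 1 - 1)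
        = Finset.Icc (max (s * L + ℓ + 1) ((s + 1) * L + 1 + m)) ((s + 1) * L + ℓ) := by
      ext t
      rw [Finset.mem_filter, Finset.mem_Icc, Finset.mem_Icc, Nat.div_eq_iff hL, max_le_iff]
      rw [Nat.add_sub_cancel]
      have : (s + 1) * L = s * L + L := by ring
      omega
    rw [hset, Nat.card_Icc]
    have : (s + 1) * L = s * L + L := by ring
    omega
  · intro ℓ _ hℓ
    rw [Finset.mem_Icc] at hℓ
    rw [Finset.mem_range] at *
    rw [show ℓ - m = 0 by omega]
    simp

/-- The position, in a pair of sections, of the last block of the first section. -/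
def lastIdx {r : ℕ} (hr : 0 < r) : Fin (2 * r) := ⟨r - 1, by omega⟩

lemma lastOddBlock_succ {r : ℕ} (hr : 0 < r) (j : ℕ) :
    lastOddBlock r (j + 1) = 2 * j * r + 1 + (lastIdx hr : ℕ) := by
  rw [lastOddBlock, lastIdx, show 2 * (j + 1) - 1 = 2 * j + 1 by omega, add_mul]
  simp only
  omega

lemma pairLabels_lastIdx {r : ℕ} (hr : 0 < r) (j : ℕ) (w : ℕ → Bool) :
    pairLabels r j w (lastIdx hr) = w (lastOddBlock r (j + 1)) := by
  rw [lastOddBlock_succ hr]; rfl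

lemma pairLabels_update (r j : ℕ) (i : Fin (2 * r)) (w : ℕ → Bool) (z : Bool) :
    pairLabels r j (Function.update w (2 * j * r + 1 + i) z)
      = Function.update (pairLabels r j w) i z := by
  ext a
  by_cases h : a = i
  · subst h; simp [pairLabels]
  · have : 2 * j * r + 1 + (a : ℕ) ≠ 2 * j * r + 1 + i := by
      intro h'; exact h (Fin.ext (by omega))
    rw [Function.update_of_ne h, pairLabels, Function.update_of_ne this]; rfl

/-- Resampling the labels of the last blocks of odd sections changes the labels of a pair of sections
in one position only. -/
lemma update_pairLabels_mix {r : ℕ} (hr : 0 < r) (j : ℕ) (w w' : ℕ → Bool) (z : Bool) :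
    Function.update (pairLabels r j (mix (Set.range fun i => lastOddBlock r (i + 1)) w w'))
      (lastIdx hr) z = Function.update (pairLabels r j w) (lastIdx hr) z := by
  ext a
  by_cases h : a = lastIdx hr
  · subst h; simp
  · rw [Function.update_of_ne h, Function.update_of_ne h, pairLabels, mix_of_notMem]
    · rfl
    · rintro ⟨i, hi⟩
      simp only [lastOddBlock_succ hr] at hi
      apply h
      have ha := a.2
      have hb : (lastIdx hr : ℕ) < r := by simp [lastIdx]; omega
      have hij : i = j := by
        rcases lt_trichotomy i j with hlt | heq | hgt
        · have : 2 * (i + 1) * r ≤ 2 * j * r := Nat.mul_le_mul_right r (by omega)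
          have : 2 * (i + 1) * r = 2 * i * r + 2 * r := by ring
          omega
        · exact heq
        · have : 2 * (j + 1) * r ≤ 2 * i * r := Nat.mul_le_mul_right r (by omega)
          have : 2 * (j + 1) * r = 2 * j * r + 2 * r := by ring
          omega
      subst hij
      exact Fin.ext (by omega)

lemma potentialMean_eq (hm : m < m₀) (hm₀ : m₀ ≤ r * L) (hr : 0 < r) (e : ℤ → ℝ) (w : ℕ → Bool)
    (j : ℕ) (z : Bool) :
    potentialMean L r m m₀ μ β (j + 1) z e w
      = labelMean L r m m₀ μ β (Function.update (pairLabels r j w) (lastIdx hr) z)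
        + errorMean L r m (2 * j * (r * L) : ℕ) e := by
  rw [potentialMean, focalMean_outcome hm hm₀, lastOddBlock_succ hr, pairLabels_update]

lemma labelMean_update (l : Fin (2 * r) → Bool) (i : Fin (2 * r)) :
    labelMean L r m m₀ μ β (Function.update l i true)
      = labelMean L r m m₀ μ β (Function.update l i false) + lagWeight L r m m₀ β i := by
  have h (z : Bool) : labelMean L r m m₀ μ β (Function.update l i z)
      = μ + (lagWeight L r m m₀ β i * label z
        + ∑ k ∈ Finset.univ.erase i, lagWeight L r m m₀ β k * label (l k)) := by
    rw [labelMean, ← Finset.add_sum_erase _ _ (Finset.mem_univ i), Function.update_self]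
    congr 2
    refine Finset.sum_congr rfl fun k hk => ?_
    rw [Function.update_of_ne (Finset.ne_of_mem_erase hk)]
  rw [h, h]
  simp [label]
  ring

lemma abs_labelMean_le (l : Fin (2 * r) → Bool) :
    |labelMean L r m m₀ μ β l| ≤ |μ| + ∑ i : Fin (2 * r), |lagWeight L r m m₀ β i| := by
  refine (abs_add_le _ _).trans (add_le_add_right ((Finset.abs_sum_le_sum_abs _ _).trans
    (Finset.sum_le_sum fun i _ => ?_)) _)
  rw [abs_mul]
  refine mul_le_of_le_one_right (abs_nonneg _) ?_
  cases l i <;> simp [label]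

/-- Used to recover a bound on the intercept from bounds on the label mean and on the weights. -/
lemma abs_le_of_labelMean (l : Fin (2 * r) → Bool) :
    |μ| ≤ |labelMean L r m m₀ μ β l| + ∑ i : Fin (2 * r), |lagWeight L r m m₀ β i| := by
  have h : μ = labelMean L r m m₀ μ β l + -∑ i : Fin (2 * r), lagWeight L r m m₀ β i * label (l i) := by
    rw [labelMean]; ring
  nth_rewrite 1 [h]
  refine (abs_add_le _ _).trans ?_
  rw [abs_neg]
  refine add_le_add_right ((Finset.abs_sum_le_sum_abs _ _).trans
    (Finset.sum_le_sum fun i _ => ?_)) _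
  rw [abs_mul]
  refine mul_le_of_le_one_right (abs_nonneg _) ?_
  cases l i <;> simp [label]

lemma measurable_labelMean : Measurable (labelMean L r m m₀ μ β) := by
  unfold labelMean
  refine measurable_const.add (Finset.measurable_fun_sum _ fun i _ => Measurable.const_mul ?_ _)
  exact measurable_label.comp (measurable_pi_apply i)

end Structure


/-! ## Moments of the focal means -/

section Moments

variable {Ω : Type*} [MeasurableSpace Ω] {P : Measure Ω} [IsProbabilityMeasure P]
  {L r m m₀ : ℕ} {q : unitInterval} {ρ σu : ℝ} {W : Ω → ℕ → Bool} {ε u : ℤ → Ω → ℝ}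
  {μ : ℝ} {β : ℕ → ℝ}

/-- The standing assumptions on the experiment. -/
structure IsExperiment (P : Measure Ω) (L r m m₀ : ℕ) (q : unitInterval) (ρ σu : ℝ)
    (W : Ω → ℕ → Bool) (ε u : ℤ → Ω → ℝ) : Prop where
  q_pos : 0 < (q : ℝ)
  q_lt_one : (q : ℝ) < 1
  lag_lt : m < m₀
  lag_le : m₀ ≤ r * L
  measurable_labels : Measurable W
  law_labels : P.map W = design q
  abs_lt_one : |ρ| < 1
  error : IsStationaryAR1 P ρ σu ε u
  indep : IndepFun W (fun ω t => ε t ω) P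

/-- The focal error mean of the `j`-th pair of sections. -/
noncomputable def pairError (L r m : ℕ) (ε : ℤ → Ω → ℝ) (j : ℕ) (ω : Ω) : ℝ :=
  errorMean L r m (2 * j * (r * L) : ℕ) (fun t => ε t ω)

namespace IsExperiment

variable (h : IsExperiment P L r m m₀ q ρ σu W ε u)
include h

lemma rL_pos : 0 < r * L := by have := h.lag_lt; have := h.lag_le; omega

lemma r_pos : 0 < r := Nat.pos_of_mul_pos_right h.rL_pos

lemma L_pos : 0 < L := Nat.pos_of_mul_pos_left h.rL_pos

lemma one_sub_q_pos : 0 < 1 - (q : ℝ) := by linarith [h.q_lt_one]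

lemma qq_pos : 0 < (q : ℝ) * (1 - q) := mul_pos h.q_pos h.one_sub_q_pos

lemma measurable_pairError (j : ℕ) : Measurable (pairError L r m ε j) :=
  h.error.measurable_errorMean_path _

lemma memLp_pairError (j : ℕ) : MemLp (pairError L r m ε j) 2 P :=
  h.error.memLp_errorMean h.abs_lt_one _

lemma identDistrib_pairError (j : ℕ) :
    IdentDistrib (pairError L r m ε j) (pairError L r m ε 0) P P :=
  h.error.identDistrib_errorMean _ _

lemma measurable_pairLabels (j : ℕ) : Measurable (fun ω => pairLabels r j (W ω)) :=
  (Switchback.measurable_pairLabels r j).comp h.measurable_labels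

lemma indepFun_pair (j : ℕ) : IndepFun (fun ω => pairLabels r j (W ω)) (pairError L r m ε j) P :=
  h.indep.comp (Switchback.measurable_pairLabels r j) (measurable_errorMean L r m _)

lemma identDistrib_pairLabels (j : ℕ) :
    IdentDistrib (fun ω => pairLabels r j (W ω)) (fun ω => pairLabels r 0 (W ω)) P P := by
  have hk (j : ℕ) : P.map (fun ω => pairLabels r j (W ω))
      = Measure.infinitePi (fun _ : Fin (2 * r) => bernoulliMeasure true false q) := by
    have hinj : Function.Injective (fun i : Fin (2 * r) => 2 * j * r + 1 + (i : ℕ)) := by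
      intro a b hab
      exact Fin.ext (by simpa using hab)
    have := Measure.map_infinitePi_infinitePi_of_inj
      (P := fun _ : ℕ => bernoulliMeasure true false q) hinj
    rw [← this]
    change _ = Measure.map (pairLabels r j) (design q)
    rw [← h.law_labels, Measure.map_map (Switchback.measurable_pairLabels r j) h.measurable_labels]
    rfl
  exact ⟨(h.measurable_pairLabels j).aemeasurable, (h.measurable_pairLabels 0).aemeasurable,
    (hk j).trans (hk 0).symm⟩

/-- Labels and errors are independent, so equality of the two marginal laws gives equality of the
joint law. This justifies computing all moments on the first pair. -/
lemma identDistrib_pair (j : ℕ) :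
    IdentDistrib (fun ω => (pairLabels r j (W ω), pairError L r m ε j ω))
      (fun ω => (pairLabels r 0 (W ω), pairError L r m ε 0 ω)) P P := by
  refine ⟨((h.measurable_pairLabels j).prodMk (h.measurable_pairError j)).aemeasurable,
    ((h.measurable_pairLabels 0).prodMk (h.measurable_pairError 0)).aemeasurable, ?_⟩
  rw [(indepFun_iff_map_prod_eq_prod_map_map (h.measurable_pairLabels j).aemeasurable
      (h.measurable_pairError j).aemeasurable).1 (h.indepFun_pair j),
    (indepFun_iff_map_prod_eq_prod_map_map (h.measurable_pairLabels 0).aemeasurable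
      (h.measurable_pairError 0).aemeasurable).1 (h.indepFun_pair 0),
    (h.identDistrib_pairLabels j).map_eq, (h.identDistrib_pairError j).map_eq]

lemma integral_pairError : ∫ ω, pairError L r m ε 0 ω ∂P = 0 :=
  h.error.integral_errorMean h.abs_lt_one _

lemma YBar_eq (z : Bool) (ω : Ω) :
    YBar W ε L r m m₀ μ β z ω
      = labelMean L r m m₀ μ β (Function.update (pairLabels r 0 (W ω)) (lastIdx h.r_pos) z)
        + pairError L r m ε 0 ω :=
  potentialMean_eq h.lag_lt h.lag_le h.r_pos _ _ 0 z

lemma measurable_labelMean_update (z : Bool) : Measurable (fun ω =>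
    labelMean L r m m₀ μ β (Function.update (pairLabels r 0 (W ω)) (lastIdx h.r_pos) z)) := by
  have : Measurable (fun l : Fin (2 * r) → Bool => Function.update l (lastIdx h.r_pos) z) :=
    measurable_update'.comp (measurable_id.prodMk measurable_const)
  exact measurable_labelMean.comp (this.comp (h.measurable_pairLabels 0))

lemma memLp_labelMean_update (z : Bool) : MemLp (fun ω =>
    labelMean L r m m₀ μ β (Function.update (pairLabels r 0 (W ω)) (lastIdx h.r_pos) z)) 2 P :=
  MemLp.of_bound (h.measurable_labelMean_update z).aestronglyMeasurable _
    (Eventually.of_forall fun _ => abs_labelMean_le _)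

lemma memLp_YBar (z : Bool) : MemLp (YBar W ε L r m m₀ μ β z) 2 P := by
  have : YBar W ε L r m m₀ μ β z = fun ω => _ := funext fun ω => h.YBar_eq z ω
  rw [this]
  exact (h.memLp_labelMean_update z).add (h.memLp_pairError 0)

/-- By additivity of the lag effects, `Ȳ(1) - Ȳ(0)` is deterministic; hence the exact identity
between `v_up` and `σ_δ²`. -/
lemma YBar_true (ω : Ω) : YBar W ε L r m m₀ μ β true ω
    = YBar W ε L r m m₀ μ β false ω + tailSignal L r m m₀ β := by
  rw [h.YBar_eq, h.YBar_eq, labelMean_update, ← lagWeight_last h.lag_le h.L_pos h.r_pos]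
  simp only [lastIdx]
  ring

/-- `v_up = σ_δ² + δ²`. -/
lemma vUp_eq : vUp P W ε L r m m₀ q μ β
    = sigmaDeltaSq P W ε L r m m₀ q μ β + tailSignal L r m m₀ β ^ 2 := by
  have i1 := (h.memLp_YBar (μ := μ) (β := β) true).integrable_sq
  have i0 := (h.memLp_YBar (μ := μ) (β := β) false).integrable_sq
  have i2 : Integrable (fun ω => (1 / (q : ℝ) - 1) * YBar W ε L r m m₀ μ β true ω ^ 2
    + (1 / (1 - (q : ℝ)) - 1) * YBar W ε L r m m₀ μ β false ω ^ 2
    + 2 * (YBar W ε L r m m₀ μ β true ω * YBar W ε L r m m₀ μ β false ω)) P :=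
    ((i1.const_mul _).add (i0.const_mul _)).add
      (((h.memLp_YBar true).integrable_mul (h.memLp_YBar false)).const_mul 2)
  rw [vUp, sigmaDeltaSq, ← integral_div, ← integral_div, ← integral_add (i1.div_const _)
    (i0.div_const _)]
  have e : tailSignal L r m m₀ β ^ 2 = ∫ _, tailSignal L r m m₀ β ^ 2 ∂P := by simp
  rw [e, ← integral_add i2 (integrable_const _)]
  -- Pointwise, the two integrands differ by `(Ȳ(1) - Ȳ(0))²`.
  refine integral_congr_ae (Eventually.of_forall fun ω => ?_)
  simp only [h.YBar_true]
  ring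

lemma integral_YBar_false_sq_le (hpos : 0 ≤ vUp P W ε L r m m₀ q μ β) :
    ∫ ω, YBar W ε L r m m₀ μ β false ω ^ 2 ∂P ≤ vUp P W ε L r m m₀ q μ β := by
  have h1 : 0 ≤ (∫ ω, YBar W ε L r m m₀ μ β true ω ^ 2 ∂P) / q :=
    div_nonneg (integral_nonneg fun _ => sq_nonneg _) h.q_pos.le
  have h2 : (∫ ω, YBar W ε L r m m₀ μ β false ω ^ 2 ∂P) / (1 - q)
      ≤ vUp P W ε L r m m₀ q μ β := by rw [vUp]; linarith
  rw [div_le_iff₀ h.one_sub_q_pos] at h2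
  nlinarith [h.q_pos]

/-- The cross term vanishes: the error mean is centred and independent of the labels. -/
lemma integral_YBar_sq_eq (z : Bool) :
    ∫ ω, YBar W ε L r m m₀ μ β z ω ^ 2 ∂P
      = ∫ ω, labelMean L r m m₀ μ β
          (Function.update (pairLabels r 0 (W ω)) (lastIdx h.r_pos) z) ^ 2 ∂P
        + ∫ ω, pairError L r m ε 0 ω ^ 2 ∂P := by
  have hG := h.memLp_labelMean_update (μ := μ) (β := β) z
  have hE := h.memLp_pairError 0
  have hupd : Measurable (fun l : Fin (2 * r) → Bool => Function.update l (lastIdx h.r_pos) z) :=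
    measurable_update'.comp (measurable_id.prodMk measurable_const)
  have hind : IndepFun (fun ω => labelMean L r m m₀ μ β
      (Function.update (pairLabels r 0 (W ω)) (lastIdx h.r_pos) z)) (pairError L r m ε 0) P :=
    (h.indepFun_pair 0).comp (measurable_labelMean.comp hupd) measurable_id
  have hcross := hind.integral_fun_mul_eq_mul_integral
    (h.measurable_labelMean_update z).aestronglyMeasurable
    (h.measurable_pairError 0).aestronglyMeasurable
  rw [h.integral_pairError, mul_zero] at hcross
  have hcr : ∫ ω, 2 * (labelMean L r m m₀ μ β
      (Function.update (pairLabels r 0 (W ω)) (lastIdx h.r_pos) z) * pairError L r m ε 0 ω) ∂P = 0 := by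
    rw [integral_const_mul, hcross, mul_zero]
  have hsum : Integrable (fun ω => labelMean L r m m₀ μ β
      (Function.update (pairLabels r 0 (W ω)) (lastIdx h.r_pos) z) ^ 2
        + pairError L r m ε 0 ω ^ 2) P := hG.integrable_sq.add hE.integrable_sq
  have hci : Integrable (fun ω => 2 * (labelMean L r m m₀ μ β
      (Function.update (pairLabels r 0 (W ω)) (lastIdx h.r_pos) z) * pairError L r m ε 0 ω)) P :=
    (hG.integrable_mul hE).const_mul 2
  have hexp (ω : Ω) : YBar W ε L r m m₀ μ β z ω ^ 2
      = labelMean L r m m₀ μ β (Function.update (pairLabels r 0 (W ω)) (lastIdx h.r_pos) z) ^ 2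
        + pairError L r m ε 0 ω ^ 2 + 2 * (labelMean L r m m₀ μ β
      (Function.update (pairLabels r 0 (W ω)) (lastIdx h.r_pos) z) * pairError L r m ε 0 ω) := by
    rw [h.YBar_eq]; ring
  simp_rw [hexp]
  rw [integral_add hsum hci, hcr, add_zero, integral_add hG.integrable_sq hE.integrable_sq]

variable (hpos : 0 < sigmaDeltaSq P W ε L r m m₀ q μ β)
include hpos

lemma vUp_pos : 0 < vUp P W ε L r m m₀ q μ β := by
  rw [h.vUp_eq]; positivity

lemma integral_pairError_sq_le :
    ∫ ω, pairError L r m ε 0 ω ^ 2 ∂P ≤ vUp P W ε L r m m₀ q μ β := by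
  have h1 := h.integral_YBar_false_sq_le (h.vUp_pos hpos).le
  rw [h.integral_YBar_sq_eq] at h1
  have h2 : 0 ≤ ∫ ω, labelMean L r m m₀ μ β
    (Function.update (pairLabels r 0 (W ω)) (lastIdx h.r_pos) false) ^ 2 ∂P :=
    integral_nonneg fun _ => sq_nonneg _
  linarith

/-- The weight of the last odd block is `δ`, with `δ² ≤ v_up`. Any other block keeps a random label
in `Ȳ(0)`, whose conditional variance `q(1-q)a²` bounds `E[Ȳ(0)²] ≤ v_up` from below. -/
lemma lagWeight_sq_le (i : Fin (2 * r)) :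
    (q : ℝ) * (1 - q) * lagWeight L r m m₀ β i ^ 2 ≤ vUp P W ε L r m m₀ q μ β := by
  have hq := h.q_pos
  have hq' := h.one_sub_q_pos
  by_cases hi : i = lastIdx h.r_pos
  · have h1 : lagWeight L r m m₀ β i = tailSignal L r m m₀ β := by
      rw [hi, ← lagWeight_last h.lag_le h.L_pos h.r_pos]; rfl
    have h2 : tailSignal L r m m₀ β ^ 2 ≤ vUp P W ε L r m m₀ q μ β := by
      rw [h.vUp_eq]; linarith
    rw [h1]
    refine le_trans (mul_le_of_le_one_left (sq_nonneg _) ?_) h2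
    nlinarith
  · refine le_trans ?_ (h.integral_YBar_false_sq_le (h.vUp_pos hpos).le)
    set F : (ℕ → Bool) → (ℤ → ℝ) → ℝ := fun w e =>
      (labelMean L r m m₀ μ β (Function.update (pairLabels r 0 w) (lastIdx h.r_pos) false)
        + errorMean L r m (2 * 0 * (r * L) : ℕ) e) ^ 2 with hF
    have hupd : Measurable (fun l : Fin (2 * r) → Bool =>
        Function.update l (lastIdx h.r_pos) false) :=
      measurable_update'.comp (measurable_id.prodMk measurable_const)
    have hFm : Measurable (Function.uncurry F) :=
      (((measurable_labelMean.comp (hupd.comp (Switchback.measurable_pairLabels r 0))).comp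
        measurable_fst).add ((measurable_errorMean L r m _).comp measurable_snd)).pow_const 2
    have hYF (ω : Ω) : YBar W ε L r m m₀ μ β false ω ^ 2 = F (W ω) (fun t => ε t ω) := by
      rw [h.YBar_eq]; rfl
    have hint : Integrable (fun ω => F (W ω) (fun t => ε t ω)) P := by
      simp_rw [← hYF]
      exact (h.memLp_YBar false).integrable_sq
    simp_rw [hYF]
    rw [integral_eq_integral_update h.measurable_labels h.law_labels h.error.measurable_path h.indep
      (2 * 0 * r + 1 + i) hFm hint]
    have hpt (w : ℕ → Bool) (e : ℤ → ℝ) : (q : ℝ) * (1 - q) * lagWeight L r m m₀ β i ^ 2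
        ≤ q * F (Function.update w (2 * 0 * r + 1 + i) true) e
          + (1 - q) * F (Function.update w (2 * 0 * r + 1 + i) false) e := by
      simp only [hF, pairLabels_update]
      rw [Function.update_comm hi, Function.update_comm hi, labelMean_update]
      set y := labelMean L r m m₀ μ β (Function.update (Function.update (pairLabels r 0 w)
        (lastIdx h.r_pos) false) i false) + errorMean L r m (2 * 0 * (r * L) : ℕ) e
      have e1 : labelMean L r m m₀ μ β (Function.update (Function.update (pairLabels r 0 w)
        (lastIdx h.r_pos) false) i false) + lagWeight L r m m₀ β i
        + errorMean L r m (2 * 0 * (r * L) : ℕ) e = y + lagWeight L r m m₀ β i := by ring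
      rw [e1]
      -- A second moment is the variance `q(1-q)a²` plus the square of the mean.
      nlinarith [sq_nonneg (q * (y + lagWeight L r m m₀ β i) + (1 - q) * y)]
    by_cases hI : Integrable (fun ω => (q : ℝ) * F (Function.update (W ω) (2 * 0 * r + 1 + i) true)
        (fun t => ε t ω) + (1 - q) * F (Function.update (W ω) (2 * 0 * r + 1 + i) false)
        (fun t => ε t ω)) P
    · calc _ = ∫ _, (q : ℝ) * (1 - q) * lagWeight L r m m₀ β i ^ 2 ∂P := by simp
        _ ≤ _ := integral_mono (integrable_const _) hI fun ω => hpt _ _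
    · exfalso
      apply hI
      have hFb (b : Bool) : Integrable (fun ω =>
          F (Function.update (W ω) (2 * 0 * r + 1 + i) b) (fun t => ε t ω)) P := by
        simp only [hF, pairLabels_update]
        refine MemLp.integrable_sq (MemLp.add ?_ (h.memLp_pairError 0))
        have hupd2 : Measurable (fun l : Fin (2 * r) → Bool => Function.update l i b) :=
          measurable_update'.comp (measurable_id.prodMk measurable_const)
        exact MemLp.of_bound ((measurable_labelMean.comp (hupd.comp hupd2)).comp
          (h.measurable_pairLabels 0)).aestronglyMeasurable _
          (Eventually.of_forall fun _ => abs_labelMean_le _)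
      exact ((hFb true).const_mul _).add ((hFb false).const_mul _)

omit hpos in
/-- The label part of the focal means is bounded by a multiple of `√v_up`, uniformly in the
coefficients. -/
lemma exists_abs_labelMean_le : ∃ A, 0 ≤ A ∧ ∀ (μ : ℝ) (β : ℕ → ℝ),
    0 < sigmaDeltaSq P W ε L r m m₀ q μ β → ∀ l : Fin (2 * r) → Bool,
      |labelMean L r m m₀ μ β l| ≤ A * √(vUp P W ε L r m m₀ q μ β) := by
  set K : ℝ := (√((q : ℝ) * (1 - q)))⁻¹ with hK
  have hqq := h.qq_pos
  have hs : 0 < √((q : ℝ) * (1 - q)) := Real.sqrt_pos.2 hqq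
  refine ⟨1 + 2 * (2 * r * K), by positivity, fun μ β hpos l => ?_⟩
  set v := vUp P W ε L r m m₀ q μ β with hv
  have hv0 : 0 < v := h.vUp_pos hpos
  have hb (i : Fin (2 * r)) : |lagWeight L r m m₀ β i| ≤ K * √v := by
    have h1 := h.lagWeight_sq_le hpos i
    rw [← hv] at h1
    have h2 : |lagWeight L r m m₀ β i| * √((q : ℝ) * (1 - q)) ≤ √v := by
      refine Real.le_sqrt_of_sq_le ?_
      rw [mul_pow, sq_abs, Real.sq_sqrt hqq.le]; linarith
    rw [hK, inv_mul_eq_div, le_div_iff₀ hs]; exact h2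
  have hS : ∑ i : Fin (2 * r), |lagWeight L r m m₀ β i| ≤ 2 * r * K * √v := by
    refine (Finset.sum_le_sum fun i _ => hb i).trans (le_of_eq ?_)
    simp [mul_assoc]
  -- A larger intercept would push the label part of `Ȳ(0)` above `√v` for every label pattern,
  -- against `E[Ȳ(0)²] ≤ v`.
  have hμ : |μ| ≤ √v + 2 * r * K * √v := by
    by_contra! hcon
    have hpt (ω : Ω) : √v < |labelMean L r m m₀ μ β
        (Function.update (pairLabels r 0 (W ω)) (lastIdx h.r_pos) false)| := by
      have := abs_le_of_labelMean (L := L) (r := r) (m := m) (m₀ := m₀) (μ := μ) (β := β)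
        (Function.update (pairLabels r 0 (W ω)) (lastIdx h.r_pos) false)
      linarith
    have h1 := h.integral_YBar_false_sq_le (h.vUp_pos hpos).le
    rw [h.integral_YBar_sq_eq] at h1
    have h2 : 0 ≤ ∫ ω, pairError L r m ε 0 ω ^ 2 ∂P := integral_nonneg fun _ => sq_nonneg _
    set d := |μ| - 2 * r * K * √v with hd
    have hdv : √v < d := by rw [hd]; linarith
    have hpt' (ω : Ω) : d ^ 2 ≤ labelMean L r m m₀ μ β
        (Function.update (pairLabels r 0 (W ω)) (lastIdx h.r_pos) false) ^ 2 := by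
      have := abs_le_of_labelMean (L := L) (r := r) (m := m) (m₀ := m₀) (μ := μ) (β := β)
        (Function.update (pairLabels r 0 (W ω)) (lastIdx h.r_pos) false)
      rw [← sq_abs (labelMean _ _ _ _ _ _ _)]
      exact pow_le_pow_left₀ ((Real.sqrt_nonneg _).trans hdv.le) (by rw [hd]; linarith) 2
    have h3 : d ^ 2 ≤ ∫ ω, labelMean L r m m₀ μ β
        (Function.update (pairLabels r 0 (W ω)) (lastIdx h.r_pos) false) ^ 2 ∂P := by
      calc d ^ 2 = ∫ _, d ^ 2 ∂P := by simp
        _ ≤ _ := integral_mono (integrable_const _)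
          (h.memLp_labelMean_update false).integrable_sq hpt'
    have h4 : v < d ^ 2 := by
      calc v = √v ^ 2 := (Real.sq_sqrt hv0.le).symm
        _ < d ^ 2 := pow_lt_pow_left₀ hdv (Real.sqrt_nonneg _) two_ne_zero
    linarith
  refine (abs_labelMean_le l).trans ?_
  linarith

end IsExperiment

end Moments


/-! ## Averages over pairs of sections -/

/-- The constant depends only on the bounds `A`, `S`, `G`, so a whole family of coefficients shares
one quadratic bound. -/
lemma quadBound_sq {Λ : Type*} [MeasurableSpace Λ] {c g : Λ → ℝ} (hc : Measurable c)
    (hg : Measurable g) {A S G s : ℝ} (hcA : ∀ l, |c l| ≤ A) (hs : |s| ≤ S) (hgG : ∀ l, |g l| ≤ G)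
    (hA : 0 ≤ A) (hG : 0 ≤ G) : QuadBound (G * (A + S) ^ 2) (fun l x => (c l + s * x) ^ 2 * g l) where
  measurable := by
    have h1 : Measurable (fun p : Λ × ℝ => c p.1) := hc.comp measurable_fst
    have h2 : Measurable (fun p : Λ × ℝ => g p.1) := hg.comp measurable_fst
    exact ((h1.add (measurable_snd.const_mul s)).pow_const 2).mul h2
  zero_le l := by
    have hS : 0 ≤ S := (abs_nonneg _).trans hs
    rw [mul_zero, add_zero, abs_mul, abs_pow, mul_comm]
    have : |c l| ^ 2 ≤ (A + S) ^ 2 := pow_le_pow_left₀ (abs_nonneg _) ((hcA l).trans (by linarith)) 2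
    exact mul_le_mul (hgG l) this (by positivity) hG
  lipschitz l x y := by
    have hS : 0 ≤ S := (abs_nonneg _).trans hs
    have e : (c l + s * x) ^ 2 * g l - (c l + s * y) ^ 2 * g l
        = g l * (s * (2 * c l + s * (x + y))) * (x - y) := by ring
    rw [e, abs_mul, abs_mul, abs_mul]
    refine mul_le_mul_of_nonneg_right ?_ (abs_nonneg _)
    rw [mul_assoc G]
    refine mul_le_mul (hgG l) ?_ (by positivity) hG
    have h1 : |2 * c l + s * (x + y)| ≤ 2 * A + S * (|x| + |y|) := by
      refine (abs_add_le _ _).trans (add_le_add ?_ ?_)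
      · rw [abs_mul, abs_two]; linarith [hcA l]
      · rw [abs_mul]
        exact mul_le_mul hs (abs_add_le _ _) (abs_nonneg _) hS
    have x0 := abs_nonneg x
    have y0 := abs_nonneg y
    calc |s| * |2 * c l + s * (x + y)| ≤ S * (2 * A + S * (|x| + |y|)) :=
          mul_le_mul hs h1 (abs_nonneg _) hS
      _ ≤ (A + S) ^ 2 * (1 + |x| + |y|) := by
          have : 0 ≤ |x| + |y| := by positivity
          nlinarith [mul_nonneg (mul_nonneg hA hS) this, mul_nonneg (sq_nonneg A) this,
            sq_nonneg A, sq_nonneg S]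

section Tail

variable {Ω : Type*} [MeasurableSpace Ω] {P : Measure Ω} [IsProbabilityMeasure P]

/-- Tails of square integrable variables. -/
lemma tendsto_mul_real_sq_gt {X : Ω → ℝ} (hX : Measurable X) (hX2 : MemLp X 2 P) {a : ℝ}
    (ha : 0 < a) :
    Tendsto (fun N : ℕ => (N : ℝ) * P.real {ω | a * N < X ω ^ 2}) atTop (𝓝 0) := by
  have hms (N : ℕ) : MeasurableSet {ω | a * N < X ω ^ 2} :=
    measurableSet_lt measurable_const (hX.pow_const 2)
  have hlim : Tendsto (fun N : ℕ => ∫ ω, {ω | a * N < X ω ^ 2}.indicator (fun ω => X ω ^ 2) ω ∂P)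
      atTop (𝓝 (∫ _, 0 ∂P)) := by
    refine tendsto_integral_of_dominated_convergence (fun ω => X ω ^ 2)
      (fun N => ((hX.pow_const 2).indicator (hms N)).aestronglyMeasurable) hX2.integrable_sq
      (fun N => Eventually.of_forall fun ω => ?_) (Eventually.of_forall fun ω => ?_)
    · refine (norm_indicator_le_norm_self _ _).trans (le_of_eq ?_)
      rw [Real.norm_eq_abs, abs_of_nonneg (sq_nonneg _)]
    · refine tendsto_const_nhds.congr' ?_
      obtain ⟨n, hn⟩ := exists_nat_ge (X ω ^ 2 / a)
      filter_upwards [eventually_ge_atTop n] with N hN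
      rw [Set.indicator_of_notMem]
      simp only [Set.mem_ofPred_eq, not_lt]
      rw [div_le_iff₀ ha] at hn
      have : (n : ℝ) ≤ N := by exact_mod_cast hN
      nlinarith
  rw [integral_zero] at hlim
  refine tendsto_zero_of_le_real (fun N => by positivity) (Eventually.of_forall fun N => ?_)
    (by simpa using hlim.const_mul a⁻¹)
  have h1 : a * N * P.real {ω | a * N < X ω ^ 2}
      ≤ ∫ ω, {ω | a * N < X ω ^ 2}.indicator (fun ω => X ω ^ 2) ω ∂P := by
    have e : a * N * P.real {ω | a * N < X ω ^ 2}
        = ∫ ω, {ω | a * N < X ω ^ 2}.indicator (fun _ => a * N) ω ∂P := by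
      rw [integral_indicator_const _ (hms N), smul_eq_mul, mul_comm]
    rw [e]
    refine integral_mono ((integrable_const _).indicator (hms N))
      (hX2.integrable_sq.indicator (hms N)) fun ω => ?_
    by_cases hω : ω ∈ {ω | a * N < X ω ^ 2}
    · rw [Set.indicator_of_mem hω, Set.indicator_of_mem hω]
      exact le_of_lt hω
    · rw [Set.indicator_of_notMem hω, Set.indicator_of_notMem hω]
  rw [inv_mul_eq_div, le_div_iff₀ ha]
  linarith

end Tail

lemma tendsto_half_atTop : Tendsto (fun J : ℕ => J / 2) atTop atTop :=
  Nat.tendsto_div_const_atTop two_ne_zero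

section Pairs

variable {Ω : Type*} [MeasurableSpace Ω] {P : Measure Ω} [IsProbabilityMeasure P]
  {L r m m₀ : ℕ} {q : unitInterval} {ρ σu : ℝ} {W : Ω → ℕ → Bool} {ε u : ℤ → Ω → ℝ}

/-- An affine function of the focal error mean of the `j`-th pair, with intercept depending on its
labels. -/
noncomputable def pairForm (L r m : ℕ) (W : Ω → ℕ → Bool) (ε : ℤ → Ω → ℝ)
    (c : (Fin (2 * r) → Bool) → ℝ) (b : ℝ) (j : ℕ) (ω : Ω) : ℝ :=
  c (pairLabels r j (W ω)) + b * pairError L r m ε j ω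

namespace IsExperiment

variable (h : IsExperiment P L r m m₀ q ρ σu W ε u)
include h

lemma measurable_pairForm {c : (Fin (2 * r) → Bool) → ℝ} (hc : Measurable c) (b : ℝ) (j : ℕ) :
    Measurable (pairForm L r m W ε c b j) :=
  (hc.comp (h.measurable_pairLabels j)).add ((h.measurable_pairError j).const_mul b)

lemma pairError_eq_zero (h0 : ∫ ω, pairError L r m ε 0 ω ^ 2 ∂P = 0) :
    ∀ᵐ ω ∂P, ∀ j, pairError L r m ε j ω = 0 := by
  refine ae_all_iff.2 fun j => ?_
  have h1 : ∫ ω, pairError L r m ε j ω ^ 2 ∂P = 0 := by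
    rw [← h0]
    exact ((h.identDistrib_pairError j).comp (u := fun x => x ^ 2) (by fun_prop)).integral_eq
  have h2 := (integral_eq_zero_iff_of_nonneg (fun _ => sq_nonneg _)
    (h.memLp_pairError j).integrable_sq).1 h1
  filter_upwards [h2] with ω hω
  simpa using hω

variable {c : ℕ → (Fin (2 * r) → Bool) → ℝ} (hc : ∀ J, Measurable (c J)) {A : ℝ} (hA : 0 ≤ A)
  {v : ℕ → ℝ} (hv : ∀ J, 0 < v J) (hcA : ∀ J l, |c J l| ≤ A * √(v J))
  (hvE : ∀ J, ∫ ω, pairError L r m ε 0 ω ^ 2 ∂P ≤ v J) (b : ℝ)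
include hc hA hv hcA hvE

/-- Law of large numbers for weighted squares. -/
lemma tendstoProb_average {g : (Fin (2 * r) → Bool) → ℝ} (hg : Measurable g) {G : ℝ}
    (hgG : ∀ l, |g l| ≤ G) :
    TendstoProb P atTop (fun J ω =>
      (∑ j ∈ Finset.range (J / 2),
        pairForm L r m W ε (c J) b j ω ^ 2 * g (pairLabels r j (W ω))) / (((J / 2 : ℕ) : ℝ) * v J)
      - (∫ ω', pairForm L r m W ε (c J) b 0 ω' ^ 2 * g (pairLabels r 0 (W ω')) ∂P) / v J) 0 := by
  have hG : 0 ≤ G := (abs_nonneg _).trans (hgG fun _ => true)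
  have hint (J j : ℕ) : Integrable
      (fun ω => pairForm L r m W ε (c J) b j ω ^ 2 * g (pairLabels r j (W ω))) P :=
    (quadBound_sq (hc J) hg (hcA J) (le_refl |b|) hgG (by positivity) hG).integrable
      (h.measurable_pairLabels j) (h.measurable_pairError j) (h.memLp_pairError j)
  refine TendstoProb.of_integral (Eventually.of_forall fun J =>
    ((integrable_finsetSum _ fun j _ => hint J j).div_const _).sub (integrable_const _)) ?_
  set s2 := ∫ ω, pairError L r m ε 0 ω ^ 2 ∂P with hs2
  have hs20 : 0 ≤ s2 := integral_nonneg fun _ => sq_nonneg _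
  -- The slope after normalization. When the errors vanish almost surely, `v J` has no positive
  -- lower bound from `hvE`, so `b / √(v J)` may be unbounded; the slope multiplies zero then and is
  -- replaced by 0.
  set s : ℕ → ℝ := fun J => if s2 = 0 then 0 else b / √(v J) with hs
  have hsb (J : ℕ) : |s J| ≤ |b| / √s2 := by
    simp only [hs]
    split_ifs with h0
    · simp [h0]
    · rw [abs_div, abs_of_nonneg (Real.sqrt_nonneg _)]
      have : 0 < s2 := lt_of_le_of_ne hs20 (Ne.symm h0)
      exact div_le_div_of_nonneg_left (abs_nonneg _) (Real.sqrt_pos.2 this)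
        (Real.sqrt_le_sqrt (hvE J))
  have hsE (J : ℕ) : ∀ᵐ ω ∂P, ∀ j, s J * pairError L r m ε j ω
      = b * pairError L r m ε j ω / √(v J) := by
    by_cases h0 : s2 = 0
    · filter_upwards [h.pairError_eq_zero h0] with ω hω j
      simp [hω j]
    · refine Eventually.of_forall fun ω j => ?_
      simp only [hs, if_neg h0]; ring
  set Ψ : ℕ → (Fin (2 * r) → Bool) → ℝ → ℝ := fun J l x => (c J l / √(v J) + s J * x) ^ 2 * g l
    with hΨ
  have hΨb (J : ℕ) : QuadBound (G * (A + |b| / √s2) ^ 2) (Ψ J) := by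
    refine quadBound_sq ((hc J).div_const _) hg (fun l => ?_) (hsb J) hgG hA hG
    have : 0 < √(v J) := Real.sqrt_pos.2 (hv J)
    rw [abs_div, abs_of_pos this, div_le_iff₀ this]
    exact hcA J l
  have hform (J : ℕ) : ∀ᵐ ω ∂P, ∀ j, pairForm L r m W ε (c J) b j ω ^ 2 * g (pairLabels r j (W ω))
      = v J * Ψ J (pairLabels r j (W ω)) (pairError L r m ε j ω) := by
    filter_upwards [hsE J] with ω hω j
    have hq : 0 < √(v J) := Real.sqrt_pos.2 (hv J)
    simp only [hΨ]
    rw [hω j, ← add_div, div_pow, Real.sq_sqrt (hv J).le, pairForm]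
    have := (hv J).ne'
    field_simp
  have hmean (J : ℕ) : (∫ ω', pairForm L r m W ε (c J) b 0 ω' ^ 2 * g (pairLabels r 0 (W ω')) ∂P)
      / v J = ∫ ω', Ψ J (pairLabels r 0 (W ω')) (pairError L r m ε 0 ω') ∂P := by
    rw [integral_congr_ae ((hform J).mono fun ω hω => hω 0), integral_const_mul,
      mul_div_cancel_left₀ _ (hv J).ne']
  have hident (J j : ℕ) : ∫ ω', Ψ J (pairLabels r j (W ω')) (pairError L r m ε j ω') ∂P
      = ∫ ω', Ψ J (pairLabels r 0 (W ω')) (pairError L r m ε 0 ω') ∂P :=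
    ((h.identDistrib_pair j).comp (u := Function.uncurry (Ψ J)) (hΨb J).measurable).integral_eq
  rw [Metric.tendsto_nhds]
  intro e he
  obtain ⟨N₀, hN₀⟩ := exists_forall_integral_abs_pairAverage_le (m := m) h.rL_pos
    h.measurable_labels h.law_labels h.abs_lt_one h.error h.indep
    (R := G * (A + |b| / √s2) ^ 2) (by positivity) (half_pos he)
  filter_upwards [tendsto_half_atTop.eventually_ge_atTop (max N₀ 1)] with J hJ
  have hJ0 : (0 : ℝ) < ((J / 2 : ℕ) : ℝ) := by
    have : 0 < J / 2 := lt_of_lt_of_le one_pos ((le_max_right _ _).trans hJ)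
    exact_mod_cast this
  have hb := hN₀ (J / 2) ((le_max_left _ _).trans hJ) (Ψ J) (hΨb J)
  rw [Real.dist_eq, sub_zero, abs_of_nonneg (integral_nonneg fun _ => abs_nonneg _)]
  refine lt_of_le_of_lt (le_of_eq ?_) (lt_of_le_of_lt hb (half_lt_self he))
  refine integral_congr_ae ?_
  filter_upwards [hform J] with ω hω
  rw [sub_zero, hmean]
  congr 1
  rw [Finset.sum_congr rfl fun j _ => hω j]
  change _ = (∑ j ∈ Finset.range (J / 2), (Ψ J (pairLabels r j (W ω)) (pairError L r m ε j ω)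
    - ∫ ω', Ψ J (pairLabels r j (W ω')) (pairError L r m ε j ω') ∂P)) / _
  simp_rw [hident]
  rw [Finset.sum_sub_distrib, ← Finset.mul_sum, Finset.sum_const, Finset.card_range, nsmul_eq_mul,
    sub_div, mul_div_cancel_left₀ _ hJ0.ne', mul_comm (((J / 2 : ℕ) : ℝ)),
    mul_div_mul_left _ _ (hv J).ne']

/-- No single pair of sections dominates. -/
lemma tendsto_real_exists_sq_gt {κ : ℝ} (hκ : 0 < κ) :
    Tendsto (fun J : ℕ => P.real {ω | ∃ j ∈ Finset.range (J / 2),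
      κ * (((J / 2 : ℕ) : ℝ) * v J) < pairForm L r m W ε (c J) b j ω ^ 2}) atTop (𝓝 0) := by
  set s2 := ∫ ω, pairError L r m ε 0 ω ^ 2 ∂P with hs2
  have hs20 : 0 ≤ s2 := integral_nonneg fun _ => sq_nonneg _
  -- From `(c + bE)² ≤ 2c² + 2b²E²`: once `4A² ≤ κN`, the label part accounts for at most half of
  -- `κNv`, so the error part must exceed the other half.
  set a : ℝ := κ / (4 * (b ^ 2 + 1)) with ha
  have ha0 : 0 < a := by positivity
  have hNκ : ∀ᶠ J : ℕ in atTop, 4 * A ^ 2 / κ ≤ ((J / 2 : ℕ) : ℝ) :=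
    (tendsto_natCast_atTop_atTop.comp tendsto_half_atTop).eventually_ge_atTop _
  have hpt {J : ℕ} (hJ : 4 * A ^ 2 / κ ≤ ((J / 2 : ℕ) : ℝ)) {ω : Ω} {j : ℕ}
      (hω : κ * (((J / 2 : ℕ) : ℝ) * v J) < pairForm L r m W ε (c J) b j ω ^ 2) :
      a * (((J / 2 : ℕ) : ℝ) * v J) < pairError L r m ε j ω ^ 2 := by
    set E := pairError L r m ε j ω
    set cc := c J (pairLabels r j (W ω))
    set N : ℝ := ((J / 2 : ℕ) : ℝ)
    have hvJ := hv J
    have h1 : cc ^ 2 ≤ A ^ 2 * v J := by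
      rw [← sq_abs]
      calc |cc| ^ 2 ≤ (A * √(v J)) ^ 2 := pow_le_pow_left₀ (abs_nonneg _) (hcA J _) 2
        _ = A ^ 2 * v J := by rw [mul_pow, Real.sq_sqrt hvJ.le]
    have h2 : pairForm L r m W ε (c J) b j ω ^ 2 ≤ 2 * cc ^ 2 + 2 * (b ^ 2 * E ^ 2) := by
      rw [pairForm]; nlinarith [sq_nonneg (cc - b * E)]
    have h3 : 4 * A ^ 2 ≤ N * κ := (div_le_iff₀ hκ).1 hJ
    have h4 : κ * (N * v J) < 4 * ((b ^ 2 + 1) * E ^ 2) := by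
      nlinarith [mul_le_mul_of_nonneg_right h3 hvJ.le, sq_nonneg E]
    rw [ha, div_mul_eq_mul_div, div_lt_iff₀ (by positivity)]
    linarith
  by_cases h0 : s2 = 0
  · have hz := h.pairError_eq_zero h0
    refine tendsto_const_nhds.congr' ?_
    filter_upwards [hNκ] with J hJ
    symm
    rw [measureReal_def, ENNReal.toReal_eq_zero_iff]
    left
    refine measure_mono_null (fun ω hω => ?_) (ae_iff.1 hz)
    obtain ⟨j, hj, hω⟩ := hω
    intro hall
    have h1 := hpt hJ hω
    rw [hall j] at h1
    have : 0 ≤ a * (((J / 2 : ℕ) : ℝ) * v J) :=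
      mul_nonneg ha0.le (mul_nonneg (Nat.cast_nonneg _) (hv J).le)
    norm_num at h1
    linarith
  · have hs2pos : 0 < s2 := lt_of_le_of_ne hs20 (Ne.symm h0)
    -- Since `v J ≥ s2`, a union bound over the `N` identically distributed error means leaves `N
    -- P(E² > a s2 N)`.
    have htail := (tendsto_mul_real_sq_gt (h.measurable_pairError 0) (h.memLp_pairError 0)
      (mul_pos ha0 hs2pos)).comp tendsto_half_atTop
    refine tendsto_zero_of_le_real (fun _ => measureReal_nonneg) ?_ htail
    filter_upwards [hNκ] with J hJ
    simp only [Function.comp_apply]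
    have hset : {ω | ∃ j ∈ Finset.range (J / 2),
        κ * (((J / 2 : ℕ) : ℝ) * v J) < pairForm L r m W ε (c J) b j ω ^ 2}
        ⊆ ⋃ j ∈ Finset.range (J / 2), {ω | a * s2 * ((J / 2 : ℕ) : ℝ) < pairError L r m ε j ω ^ 2} := by
      rintro ω ⟨j, hj, hω⟩
      refine Set.mem_biUnion hj ?_
      refine lt_of_le_of_lt ?_ (hpt hJ hω)
      have := mul_le_mul_of_nonneg_left (hvE J) (Nat.cast_nonneg (α := ℝ) (J / 2))
      calc a * s2 * ((J / 2 : ℕ) : ℝ) = a * (((J / 2 : ℕ) : ℝ) * s2) := by ring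
        _ ≤ _ := mul_le_mul_of_nonneg_left this ha0.le
    refine (measureReal_mono hset (measure_ne_top _ _)).trans ((measureReal_biUnion_finset_le _ _).trans
      (le_of_eq ?_))
    have heq (j : ℕ) : P.real {ω | a * s2 * ((J / 2 : ℕ) : ℝ) < pairError L r m ε j ω ^ 2}
        = P.real {ω | a * s2 * ((J / 2 : ℕ) : ℝ) < pairError L r m ε 0 ω ^ 2} := by
      rw [measureReal_def, measureReal_def]
      congr 1
      exact (h.identDistrib_pairError j).measure_mem_eq
        (s := {x | a * s2 * ((J / 2 : ℕ) : ℝ) < x ^ 2})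
        (measurableSet_lt measurable_const (by fun_prop))
    simp_rw [heq]
    simp

/-- With probability tending to one, the squares are negligible with respect to their sum, as soon as
their normalized mean stays away from zero. -/
lemma tendsto_real_dominated {l : Filter ℕ} (hl : l ≤ atTop) {a : ℝ} (ha : 0 < a)
    (hmean : ∀ᶠ J in l, a ≤ (∫ ω, pairForm L r m W ε (c J) b 0 ω ^ 2 ∂P) / v J)
    {κ : ℝ} (hκ : 0 < κ) :
    Tendsto (fun J : ℕ => P.real {ω | ¬ ((∀ j ∈ Finset.range (J / 2),
        pairForm L r m W ε (c J) b j ω ^ 2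
          ≤ κ * ∑ i ∈ Finset.range (J / 2), pairForm L r m W ε (c J) b i ω ^ 2) ∧
        0 < ∑ i ∈ Finset.range (J / 2), pairForm L r m W ε (c J) b i ω ^ 2)}) l (𝓝 0) := by
  have havg := h.tendstoProb_average hc hA hv hcA hvE b (g := fun _ => 1) measurable_const (G := 1)
    (by simp)
  simp only [mul_one] at havg
  -- The factor `a/2` appears because the sum of squares exceeds `(a/2) N v` with probability
  -- tending to one.
  have hmax := h.tendsto_real_exists_sq_gt hc hA hv hcA hvE b (κ := κ * (a / 2)) (by positivity)
  refine real_subset_tendsto_zero ?_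
    ((real_union_tendsto_zero (havg (a / 2) (by positivity)) hmax).mono_left hl)
  filter_upwards [hmean, hl (tendsto_half_atTop.eventually_ge_atTop 1)] with J hJ hJ1 ω hω
  by_contra hcon
  simp only [Set.mem_union, Set.mem_ofPred_eq, not_or, not_le, not_exists, not_and, not_lt,
    sub_zero] at hcon
  obtain ⟨h1, h2⟩ := hcon
  have hJ0 : (0 : ℝ) < ((J / 2 : ℕ) : ℝ) := by exact_mod_cast hJ1
  have hNv : 0 < ((J / 2 : ℕ) : ℝ) * v J := mul_pos hJ0 (hv J)
  set S := ∑ i ∈ Finset.range (J / 2), pairForm L r m W ε (c J) b i ω ^ 2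
  have h3 : a / 2 < S / (((J / 2 : ℕ) : ℝ) * v J) := by linarith [(abs_lt.1 h1).1]
  rw [lt_div_iff₀ hNv] at h3
  refine hω ⟨fun j hj => (h2 j hj).trans ?_, lt_trans (by positivity) h3⟩
  calc κ * (a / 2) * (((J / 2 : ℕ) : ℝ) * v J) = κ * (a / 2 * (((J / 2 : ℕ) : ℝ) * v J)) := by ring
    _ ≤ κ * S := mul_le_mul_of_nonneg_left h3.le hκ.le

end IsExperiment

end Pairs


/-! ## Moments of the pair averages, and conditional limits given everything but the pair labels -/

/-- The inverse probability weight of a label. -/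
noncomputable def invProb (q : ℝ) (b : Bool) : ℝ := label b / q ^ 2 + (1 - label b) / (1 - q) ^ 2

/-- The coefficient of the centred pair label in the contrast of a pair. -/
noncomputable def contrastCoeff {r : ℕ} (hr : 0 < r) (q : ℝ) (c : (Fin (2 * r) → Bool) → ℝ)
    (l : Fin (2 * r) → Bool) : ℝ :=
  c (Function.update l (lastIdx hr) true) / q + c (Function.update l (lastIdx hr) false) / (1 - q)

/-- Independence of the pair's own randomized label: resampling these labels leaves the weights of
the noise unchanged. -/
lemma contrastCoeff_update {r : ℕ} (hr : 0 < r) (q : ℝ) (c : (Fin (2 * r) → Bool) → ℝ)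
    (l : Fin (2 * r) → Bool) (z : Bool) :
    contrastCoeff hr q c (Function.update l (lastIdx hr) z) = contrastCoeff hr q c l := by
  simp [contrastCoeff]

lemma measurable_contrastCoeff {r : ℕ} (hr : 0 < r) (q : ℝ) {c : (Fin (2 * r) → Bool) → ℝ}
    (hc : Measurable c) : Measurable (contrastCoeff hr q c) := by
  have hupd (z : Bool) :
      Measurable (fun l : Fin (2 * r) → Bool => Function.update l (lastIdx hr) z) :=
    measurable_update'.comp (measurable_id.prodMk measurable_const)
  exact ((hc.comp (hupd true)).div_const _).add ((hc.comp (hupd false)).div_const _)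

lemma abs_contrastCoeff_le {r : ℕ} (hr : 0 < r) {q : ℝ} (hq0 : 0 < q) (hq1 : 0 < 1 - q)
    {c : (Fin (2 * r) → Bool) → ℝ} {A : ℝ} (hcA : ∀ l, |c l| ≤ A) (l : Fin (2 * r) → Bool) :
    |contrastCoeff hr q c l| ≤ A / q + A / (1 - q) := by
  refine (abs_add_le _ _).trans (add_le_add ?_ ?_)
  · rw [abs_div, abs_of_pos hq0]; gcongr; exact hcA _
  · rw [abs_div, abs_of_pos hq1]; gcongr; exact hcA _

section Pairs

variable {Ω : Type*} [MeasurableSpace Ω] {P : Measure Ω} [IsProbabilityMeasure P]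
  {L r m m₀ : ℕ} {q : unitInterval} {ρ σu : ℝ} {W : Ω → ℕ → Bool} {ε u : ℤ → Ω → ℝ}

namespace IsExperiment

variable (h : IsExperiment P L r m m₀ q ρ σu W ε u)
include h

section Moments

variable {μ : ℝ} {β : ℕ → ℝ}

lemma invProb_nonneg (b : Bool) : 0 ≤ invProb q b := by
  cases b <;> simp [invProb, label] <;> positivity

lemma exists_invProb_le : ∃ G, 0 < G ∧ ∀ b, |invProb q b| ≤ G := by
  obtain ⟨G, hG⟩ := exists_bound_bool (invProb q)
  exact ⟨|G| + 1, by positivity, fun b => (hG b).trans ((le_abs_self G).trans (by linarith))⟩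

/-- The mean of the weighted squared focal mean is `v_up`. -/
lemma integral_sq_mul_invProb :
    ∫ ω, pairForm L r m W ε (labelMean L r m m₀ μ β) 1 0 ω ^ 2
        * invProb q (pairLabels r 0 (W ω) (lastIdx h.r_pos)) ∂P
      = vUp P W ε L r m m₀ q μ β := by
  have hq := h.q_pos
  have hq' := h.one_sub_q_pos
  obtain ⟨G, hG0, hG⟩ := h.exists_invProb_le
  set F : (ℕ → Bool) → (ℤ → ℝ) → ℝ := fun w e =>
    (labelMean L r m m₀ μ β (pairLabels r 0 w) + 1 * errorMean L r m (2 * 0 * (r * L) : ℕ) e) ^ 2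
      * invProb q (pairLabels r 0 w (lastIdx h.r_pos)) with hF
  have hgm : Measurable (fun w : ℕ → Bool => invProb q (pairLabels r 0 w (lastIdx h.r_pos))) :=
    (measurable_from_top (f := invProb q)).comp
      (measurable_pi_apply (2 * 0 * r + 1 + (lastIdx h.r_pos : ℕ)))
  have hFm : Measurable (Function.uncurry F) :=
    ((((measurable_labelMean.comp (Switchback.measurable_pairLabels r 0)).comp
      measurable_fst).add (((measurable_errorMean L r m _).comp measurable_snd).const_mul 1)).pow_const
      2).mul (hgm.comp measurable_fst)
  have hXm : Measurable (pairForm L r m W ε (labelMean L r m m₀ μ β) 1 0) :=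
    (measurable_labelMean.comp (h.measurable_pairLabels 0)).add
      ((h.measurable_pairError 0).const_mul 1)
  have hX : MemLp (pairForm L r m W ε (labelMean L r m m₀ μ β) 1 0) 2 P := by
    refine MemLp.add (MemLp.of_bound (measurable_labelMean.comp
      (h.measurable_pairLabels 0)).aestronglyMeasurable _
      (Eventually.of_forall fun _ => abs_labelMean_le _)) ((h.memLp_pairError 0).const_mul 1)
  have hint : Integrable (fun ω => F (W ω) (fun t => ε t ω)) P := by
    refine (hX.integrable_sq.mul_const G).mono'
      (hFm.comp (h.measurable_labels.prodMk h.error.measurable_path)).aestronglyMeasurable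
      (Eventually.of_forall fun ω => ?_)
    rw [Real.norm_eq_abs, hF, abs_mul, abs_of_nonneg (sq_nonneg _)]
    exact mul_le_mul_of_nonneg_left (hG _) (sq_nonneg _)
  -- Averaging over the randomized label turns the weights `1/q²` and `1/(1-q)²` into `1/q` and
  -- `1/(1-q)`.
  have h1 := integral_eq_integral_update h.measurable_labels h.law_labels h.error.measurable_path
    h.indep (2 * 0 * r + 1 + (lastIdx h.r_pos : ℕ)) hFm hint
  refine h1.trans ?_
  rw [vUp, ← integral_div, ← integral_div,
    ← integral_add ((h.memLp_YBar true).integrable_sq.div_const _)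
      ((h.memLp_YBar false).integrable_sq.div_const _)]
  refine integral_congr_ae (Eventually.of_forall fun ω => ?_)
  simp only [hF, pairLabels_update, Function.update_self, h.YBar_eq]
  change _ = (_ + errorMean L r m (2 * 0 * (r * L) : ℕ) fun t => ε t ω) ^ 2 / _
    + (_ + errorMean L r m (2 * 0 * (r * L) : ℕ) fun t => ε t ω) ^ 2 / _
  simp only [invProb, label, one_mul]
  simp
  field_simp

/-- Pointwise, `q(1-q)(Ȳ(1)/q + Ȳ(0)/(1-q))²` expands to the integrand of `σ_δ²`; so `σ_δ²` is the
mean conditional variance of the contrast. -/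
lemma integral_contrast_sq :
    ∫ ω, pairForm L r m W ε (contrastCoeff h.r_pos q (labelMean L r m m₀ μ β))
        (1 / q + 1 / (1 - q)) 0 ω ^ 2 ∂P
      = sigmaDeltaSq P W ε L r m m₀ q μ β / (q * (1 - q)) := by
  have hq := h.q_pos
  have hq' := h.one_sub_q_pos
  rw [sigmaDeltaSq, ← integral_div]
  refine integral_congr_ae (Eventually.of_forall fun ω => ?_)
  simp only [h.YBar_eq, pairForm, contrastCoeff]
  field_simp
  ring

end Moments

section Conditional

variable {c : ℕ → (Fin (2 * r) → Bool) → ℝ} (hc : ∀ J, Measurable (c J))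
  (hci : ∀ J l z, c J (Function.update l (lastIdx h.r_pos) z) = c J l) (b : ℝ)
include hc hci

omit hc in
lemma coeff_pairLabels_mix (J j : ℕ) (w w' : ℕ → Bool) :
    c J (pairLabels r j (mix (Set.range fun i => lastOddBlock r (i + 1)) w w'))
      = c J (pairLabels r j w) := by
  rw [← hci J _ true, update_pairLabels_mix, hci]

omit hci in
lemma measurable_coeff_add_errorMean (J j : ℕ) : Measurable (fun p : (ℕ → Bool) × (ℤ → ℝ) =>
    c J (pairLabels r j p.1) + b * errorMean L r m (2 * j * (r * L) : ℕ) p.2) :=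
  (((hc J).comp (Switchback.measurable_pairLabels r j)).comp measurable_fst).add
    (((measurable_errorMean L r m _).comp measurable_snd).const_mul b)

omit h hc hci in
lemma measurable_stdLabel_eval (k : ℕ) : Measurable (fun p : (ℕ → Bool) × (ℤ → ℝ) =>
    stdLabel q (p.1 k)) :=
  (measurable_stdLabel _).comp ((measurable_pi_apply _).comp measurable_fst)

/-- Conditionally on the errors and the other labels the weights are constants, and the uniform
central limit theorem applies off the event that one of them dominates. The filter is general so
that subsequences are covered. -/
lemma tendsto_real_standardized_le {l : Filter ℕ}
    (hdom : ∀ κ > 0, Tendsto (fun J : ℕ => P.real {ω | ¬ ((∀ j ∈ Finset.range (J / 2),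
        pairForm L r m W ε (c J) b j ω ^ 2
          ≤ κ * ∑ i ∈ Finset.range (J / 2), pairForm L r m W ε (c J) b i ω ^ 2) ∧
        0 < ∑ i ∈ Finset.range (J / 2), pairForm L r m W ε (c J) b i ω ^ 2)}) l (𝓝 0)) (t : ℝ) :
    Tendsto (fun J : ℕ => P.real {ω | (∑ j ∈ Finset.range (J / 2),
        pairForm L r m W ε (c J) b j ω * stdLabel q (W ω (lastOddBlock r (j + 1))))
          / √(∑ i ∈ Finset.range (J / 2), pairForm L r m W ε (c J) b i ω ^ 2) ≤ t}) l
      (𝓝 (Phi t)) := by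
  have hinj : Function.Injective fun i => lastOddBlock r (i + 1) :=
    (lastOddBlock_injective h.r_pos).comp (add_left_injective 1)
  rw [Metric.tendsto_nhds]
  intro e he
  obtain ⟨κ, hκ, hbd⟩ := exists_weight_bound_linear h.q_pos h.q_lt_one hinj t (half_pos he)
  filter_upwards [Metric.tendsto_nhds.1 (hdom κ hκ) (e / 2) (half_pos he)] with J hJ
  rw [Real.dist_eq, sub_zero, abs_of_nonneg measureReal_nonneg] at hJ
  rw [Real.dist_eq]
  set f : ℕ → (ℕ → Bool) × (ℤ → ℝ) → ℝ := fun j p =>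
    c J (pairLabels r j p.1) + b * errorMean L r m (2 * j * (r * L) : ℕ) p.2 with hf
  have hfm (j : ℕ) : Measurable (f j) := h.measurable_coeff_add_errorMean hc b J j
  have hS : Measurable fun p => ∑ i ∈ Finset.range (J / 2), f i p ^ 2 :=
    Finset.measurable_fun_sum _ fun i _ => (hfm i).pow_const 2
  have hA : MeasurableSet {p : (ℕ → Bool) × (ℤ → ℝ) | (∑ j ∈ Finset.range (J / 2),
      f j p * stdLabel q (p.1 (lastOddBlock r (j + 1))))
        / √(∑ i ∈ Finset.range (J / 2), f i p ^ 2) ≤ t} :=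
    measurableSet_le ((Finset.measurable_fun_sum _ fun i _ =>
      (hfm i).mul (measurable_stdLabel_eval _)).div (Real.continuous_sqrt.measurable.comp hS))
      measurable_const
  have hB : MeasurableSet {p : (ℕ → Bool) × (ℤ → ℝ) | ¬ ((∀ j ∈ Finset.range (J / 2),
      f j p ^ 2 ≤ κ * ∑ i ∈ Finset.range (J / 2), f i p ^ 2) ∧
        0 < ∑ i ∈ Finset.range (J / 2), f i p ^ 2)} := by
    have hB' : {p : (ℕ → Bool) × (ℤ → ℝ) | ∀ j ∈ Finset.range (J / 2),
        f j p ^ 2 ≤ κ * ∑ i ∈ Finset.range (J / 2), f i p ^ 2}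
        = ⋂ j ∈ Finset.range (J / 2), {p | f j p ^ 2 ≤ κ * ∑ i ∈ Finset.range (J / 2), f i p ^ 2} := by
      ext p; simp
    have hB'' : MeasurableSet {p : (ℕ → Bool) × (ℤ → ℝ) | ∀ j ∈ Finset.range (J / 2),
        f j p ^ 2 ≤ κ * ∑ i ∈ Finset.range (J / 2), f i p ^ 2} := by
      rw [hB']
      exact Finset.measurableSet_biInter _ fun j _ =>
        measurableSet_le ((hfm j).pow_const 2) (hS.const_mul κ)
    exact MeasurableSet.compl (hB''.inter (measurableSet_lt measurable_const hS))
  have := abs_real_sub_le_of_resample h.measurable_labels h.law_labels h.error.measurable_path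
    h.indep (Set.range fun i => lastOddBlock r (i + 1)) hA hB (Phi_nonneg t) (Phi_le_one t)
    (half_pos he).le ?_
  · refine lt_of_le_of_lt this ?_
    have : P.real {ω | (W ω, fun t => ε t ω) ∈ {p : (ℕ → Bool) × (ℤ → ℝ) |
      ¬ ((∀ j ∈ Finset.range (J / 2), f j p ^ 2 ≤ κ * ∑ i ∈ Finset.range (J / 2), f i p ^ 2) ∧
        0 < ∑ i ∈ Finset.range (J / 2), f i p ^ 2)}} < e / 2 := hJ
    linarith
  · intro p hp
    simp only [Set.mem_ofPred_eq, not_not] at hp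
    have hb := hbd (Finset.range (J / 2)) (fun j => f j p) hp.1 hp.2
    have e1 (w' : ℕ → Bool) (j : ℕ) :
        f j (mix (Set.range fun i => lastOddBlock r (i + 1)) p.1 w', p.2) = f j p := by
      simp only [hf, h.coeff_pairLabels_mix hci]
    have e2 (w' : ℕ → Bool) (j : ℕ) : mix (Set.range fun i => lastOddBlock r (i + 1)) p.1 w'
        (lastOddBlock r (j + 1)) = w' (lastOddBlock r (j + 1)) := mix_of_mem (Set.mem_range_self j) _ _
    simpa only [Set.mem_ofPred_eq, e1, e2] using hb

/-- Conditional Chebyshev inequality. Unlike the central limit theorem it requires no lower bound on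
the weights, so it serves when `μ_m(J)` diverges. -/
lemma real_abs_weightedSum_ge_le {J : ℕ} {V K a : ℝ} (hV : 0 < V) (ha : 0 < a) (hK : 0 ≤ K) :
    P.real {ω | a * √V ≤ |∑ j ∈ Finset.range (J / 2),
        pairForm L r m W ε (c J) b j ω * stdLabel q (W ω (lastOddBlock r (j + 1)))|}
      ≤ K / a ^ 2
        + P.real {ω | K * V < ∑ i ∈ Finset.range (J / 2), pairForm L r m W ε (c J) b i ω ^ 2} := by
  have hinj : Function.Injective fun i => lastOddBlock r (i + 1) :=
    (lastOddBlock_injective h.r_pos).comp (add_left_injective 1)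
  have hsV : 0 < √V := Real.sqrt_pos.2 hV
  set f : ℕ → (ℕ → Bool) × (ℤ → ℝ) → ℝ := fun j p =>
    c J (pairLabels r j p.1) + b * errorMean L r m (2 * j * (r * L) : ℕ) p.2 with hf
  have hfm (j : ℕ) : Measurable (f j) := h.measurable_coeff_add_errorMean hc b J j
  have hA : MeasurableSet {p : (ℕ → Bool) × (ℤ → ℝ) | a * √V ≤ |∑ j ∈ Finset.range (J / 2),
      f j p * stdLabel q (p.1 (lastOddBlock r (j + 1)))|} :=
    measurableSet_le measurable_const (Finset.measurable_fun_sum _ fun i _ =>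
      (hfm i).mul (measurable_stdLabel_eval _)).abs
  have hB : MeasurableSet {p : (ℕ → Bool) × (ℤ → ℝ) |
      K * V < ∑ i ∈ Finset.range (J / 2), f i p ^ 2} :=
    measurableSet_lt measurable_const (Finset.measurable_fun_sum _ fun i _ => (hfm i).pow_const 2)
  have := abs_real_sub_le_of_resample h.measurable_labels h.law_labels h.error.measurable_path
    h.indep (Set.range fun i => lastOddBlock r (i + 1)) hA hB le_rfl zero_le_one
    (η := K / a ^ 2) (by positivity) ?_
  · rw [sub_zero] at this
    exact (le_abs_self _).trans this
  · intro p hp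
    simp only [Set.mem_ofPred_eq, not_lt] at hp
    have hb := design_abs_weightedSum_ge h.q_pos h.q_lt_one hinj (Finset.range (J / 2))
      (fun j => f j p) (mul_pos ha hsV)
    have e1 (w' : ℕ → Bool) (j : ℕ) :
        f j (mix (Set.range fun i => lastOddBlock r (i + 1)) p.1 w', p.2) = f j p := by
      simp only [hf, h.coeff_pairLabels_mix hci]
    have e2 (w' : ℕ → Bool) (j : ℕ) : mix (Set.range fun i => lastOddBlock r (i + 1)) p.1 w'
        (lastOddBlock r (j + 1)) = w' (lastOddBlock r (j + 1)) := mix_of_mem (Set.mem_range_self j) _ _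
    rw [sub_zero, abs_of_nonneg measureReal_nonneg]
    simp only [Set.mem_ofPred_eq, e1, e2]
    refine hb.trans ?_
    rw [mul_pow, Real.sq_sqrt hV.le, div_le_div_iff₀ (by positivity) (by positivity)]
    nlinarith [mul_le_mul_of_nonneg_right hp (sq_nonneg a)]

end Conditional

end IsExperiment

end Pairs


/-! ## The observed statistic -/

lemma sum_Icc_one_eq_sum_range {M : Type*} [AddCommMonoid M] (f : ℕ → M) (n : ℕ) :
    ∑ j ∈ Finset.Icc 1 n, f j = ∑ j ∈ Finset.range n, f (j + 1) := by
  rw [Finset.range_eq_Ico, Finset.sum_Ico_add' f 0 n 1]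
  rfl

section Statistic

section Definitions

variable {Ω : Type*} [MeasurableSpace Ω] (P : Measure Ω) (W : Ω → ℕ → Bool) (ε : ℤ → Ω → ℝ)
  (L r m m₀ : ℕ) (q μ : ℝ) (β : ℕ → ℕ → ℝ)

/-- The focal mean of the `j`-th pair. -/
noncomputable def pairMean (J j : ℕ) (ω : Ω) : ℝ :=
  pairForm L r m W ε (labelMean L r m m₀ μ (β J)) 1 j ω

/-- `Ȳ(1)/q + Ȳ(0)/(1-q)` for the `j`-th pair. -/
noncomputable def pairContrast (hr : 0 < r) (J j : ℕ) (ω : Ω) : ℝ :=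
  pairForm L r m W ε (contrastCoeff hr q (labelMean L r m m₀ μ (β J))) (1 / q + 1 / (1 - q)) j ω

/-- `J_e v_up`. -/
noncomputable def totalVar (J : ℕ) : ℝ := ((J / 2 : ℕ) : ℝ) * vUp P W ε L r m m₀ q μ (β J)

/-- The observed statistic of the experiment with `J` sections. -/
noncomputable def obsStat (J : ℕ) (ω : Ω) : ℝ :=
  tStat L r m q J (outcome L m₀ μ (β J) (fun t => ε t ω) (W ω)) (W ω)

/-- The standardized noise of the contrast. -/
noncomputable def noise (hr : 0 < r) (J : ℕ) (ω : Ω) : ℝ :=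
  √(q * (1 - q)) * (∑ j ∈ Finset.range (J / 2), pairContrast W ε L r m m₀ q μ β hr J j ω
    * stdLabel q (W ω (lastOddBlock r (j + 1)))) / √(totalVar P W ε L r m m₀ q μ β J)

/-- The ratio of the variance estimator and `v_up`. -/
noncomputable def varRatio (J : ℕ) (ω : Ω) : ℝ :=
  (∑ j ∈ Finset.range (J / 2), pairMean W ε L r m m₀ μ β J j ω ^ 2
    * invProb q (W ω (lastOddBlock r (j + 1)))) / totalVar P W ε L r m m₀ q μ β J

end Definitions

variable {Ω : Type*} [MeasurableSpace Ω] {P : Measure Ω} [IsProbabilityMeasure P]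
  {L r m m₀ : ℕ} {q : unitInterval} {ρ σu : ℝ} {W : Ω → ℕ → Bool} {ε u : ℤ → Ω → ℝ}
  {μ : ℝ} {β : ℕ → ℕ → ℝ}

namespace IsExperiment

variable (h : IsExperiment P L r m m₀ q ρ σu W ε u)
include h

lemma focalMean_outcome_eq (J j : ℕ) (ω : Ω) :
    focalMean L r m (outcome L m₀ μ (β J) (fun t => ε t ω) (W ω)) (j + 1)
      = pairMean W ε L r m m₀ μ β J j ω := by
  rw [focalMean_outcome h.lag_lt h.lag_le, pairMean, pairForm, pairError, one_mul]

lemma measurable_pairMean (J j : ℕ) : Measurable (pairMean W ε L r m m₀ μ β J j) :=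
  h.measurable_pairForm measurable_labelMean 1 j

lemma obsStat_eq (J : ℕ) (ω : Ω) : obsStat W ε L r m m₀ q μ β J ω
    = (∑ j ∈ Finset.range (J / 2),
        (label (W ω (lastOddBlock r (j + 1))) * pairMean W ε L r m m₀ μ β J j ω / q
          - (1 - label (W ω (lastOddBlock r (j + 1)))) * pairMean W ε L r m m₀ μ β J j ω / (1 - q)))
      / √(∑ j ∈ Finset.range (J / 2), pairMean W ε L r m m₀ μ β J j ω ^ 2
        * invProb q (W ω (lastOddBlock r (j + 1)))) := by
  rw [obsStat, tStat_eq_studentized, studentized, sum_Icc_one_eq_sum_range,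
    sum_Icc_one_eq_sum_range]
  simp only [h.focalMean_outcome_eq]
  rfl

lemma measurable_obsStat (J : ℕ) : Measurable (obsStat W ε L r m m₀ q μ β J) := by
  have hl (k : ℕ) (f : Bool → ℝ) : Measurable (fun ω => f (W ω k)) :=
    (measurable_from_top (f := f)).comp ((measurable_pi_apply k).comp h.measurable_labels)
  have hX (j : ℕ) := h.measurable_pairMean (μ := μ) (β := β) J j
  rw [funext (h.obsStat_eq (μ := μ) (β := β) J)]
  refine Measurable.div (Finset.measurable_fun_sum _ fun j _ => ?_)
    (Real.continuous_sqrt.measurable.comp (Finset.measurable_fun_sum _ fun j _ => ?_))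
  · exact (((hl _ label).mul (hX j)).div_const _).sub
      (((measurable_const.sub (hl _ label)).mul (hX j)).div_const _)
  · exact ((hX j).pow_const 2).mul (hl _ (invProb q))

/-- Decomposition of the contrast of a pair into signal and noise. -/
lemma pair_decomposition (J j : ℕ) (ω : Ω) :
    label (W ω (lastOddBlock r (j + 1))) * pairMean W ε L r m m₀ μ β J j ω / q
        - (1 - label (W ω (lastOddBlock r (j + 1)))) * pairMean W ε L r m m₀ μ β J j ω / (1 - q)
      = tailSignal L r m m₀ (β J) + √(q * (1 - q)) * (pairContrast W ε L r m m₀ q μ β h.r_pos J j ω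
        * stdLabel q (W ω (lastOddBlock r (j + 1)))) := by
  have hq := h.q_pos.ne'
  have hq' := h.one_sub_q_pos.ne'
  have e1 := label_sub_eq h.q_pos h.q_lt_one (W ω (lastOddBlock r (j + 1)))
  have e2 : √((q : ℝ) * (1 - q)) * (pairContrast W ε L r m m₀ q μ β h.r_pos J j ω
        * stdLabel q (W ω (lastOddBlock r (j + 1))))
      = pairContrast W ε L r m m₀ q μ β h.r_pos J j ω
        * (label (W ω (lastOddBlock r (j + 1))) - q) := by rw [e1]; ring
  have e3 := labelMean_update (L := L) (m := m) (m₀ := m₀) (μ := μ) (β := β J)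
    (pairLabels r j (W ω)) (lastIdx h.r_pos)
  have e4 : lagWeight L r m m₀ (β J) (lastIdx h.r_pos : ℕ) = tailSignal L r m m₀ (β J) :=
    lagWeight_last h.lag_le h.L_pos h.r_pos
  rw [e4] at e3
  have e5 : labelMean L r m m₀ μ (β J) (pairLabels r j (W ω)) = labelMean L r m m₀ μ (β J)
      (Function.update (pairLabels r j (W ω)) (lastIdx h.r_pos) (W ω (lastOddBlock r (j + 1)))) := by
    rw [← pairLabels_lastIdx h.r_pos j (W ω), Function.update_eq_self]
  rw [e2]
  simp only [pairMean, pairContrast, pairForm, contrastCoeff]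
  rw [e5, e3]
  cases W ω (lastOddBlock r (j + 1))
  · simp only [label]
    simp
    field_simp
    ring
  · simp only [label]
    simp
    rw [e3]
    field_simp
    ring

variable (hpos : ∀ J, 0 < sigmaDeltaSq P W ε L r m m₀ q μ (β J))
include hpos

lemma totalVar_pos {J : ℕ} (hJ : 0 < J / 2) : 0 < totalVar P W ε L r m m₀ q μ β J :=
  mul_pos (by exact_mod_cast hJ) (h.vUp_pos (hpos J))

lemma muM_mul_sqrt_totalVar (J : ℕ) :
    muM P W ε L r m m₀ q μ (β J) J * √(totalVar P W ε L r m m₀ q μ β J)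
      = ((J / 2 : ℕ) : ℝ) * tailSignal L r m m₀ (β J) := by
  have hv := Real.sqrt_pos.2 (h.vUp_pos (hpos J))
  rw [muM, totalVar, Real.sqrt_mul (Nat.cast_nonneg _)]
  have : √((J / 2 : ℕ) : ℝ) * √((J / 2 : ℕ) : ℝ) = ((J / 2 : ℕ) : ℝ) :=
    Real.mul_self_sqrt (Nat.cast_nonneg _)
  field_simp
  linear_combination (tailSignal L r m m₀ (β J)) * this

/-- Signal plus noise over the studentization factor, everything measured in units of `√(J_e v_up)`.
-/
lemma obsStat_eq_div {J : ℕ} (hJ : 0 < J / 2) (ω : Ω) :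
    obsStat W ε L r m m₀ q μ β J ω
      = (muM P W ε L r m m₀ q μ (β J) J + noise P W ε L r m m₀ q μ β h.r_pos J ω)
        / √(varRatio P W ε L r m m₀ q μ β J ω) := by
  have hV := h.totalVar_pos hpos hJ
  have hsV := Real.sqrt_pos.2 hV
  rw [h.obsStat_eq, varRatio, noise, Real.sqrt_div' _ hV.le]
  simp only [h.pair_decomposition]
  rw [Finset.sum_add_distrib, Finset.sum_const, Finset.card_range, nsmul_eq_mul,
    ← h.muM_mul_sqrt_totalVar hpos, ← Finset.mul_sum]
  field_simp

/-- Uniform bound on the label parts. -/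
lemma exists_label_bound : ∃ A, 0 ≤ A ∧
    (∀ J l, |labelMean L r m m₀ μ (β J) l| ≤ A * √(vUp P W ε L r m m₀ q μ (β J))) ∧
    (∀ J l, |contrastCoeff h.r_pos q (labelMean L r m m₀ μ (β J)) l|
      ≤ A * √(vUp P W ε L r m m₀ q μ (β J))) := by
  obtain ⟨A, hA, hb⟩ := h.exists_abs_labelMean_le
  have hq := h.q_pos
  have hq' := h.one_sub_q_pos
  refine ⟨A + (A / q + A / (1 - q)), by positivity, fun J l => ?_, fun J l => ?_⟩
  · refine (hb μ (β J) (hpos J) l).trans (mul_le_mul_of_nonneg_right ?_ (Real.sqrt_nonneg _))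
    have : 0 ≤ A / q + A / (1 - q) := by positivity
    linarith
  · refine (abs_contrastCoeff_le h.r_pos hq hq' (hb μ (β J) (hpos J)) l).trans ?_
    have := mul_nonneg hA (Real.sqrt_nonneg (vUp P W ε L r m m₀ q μ (β J)))
    rw [add_mul, add_mul, div_mul_eq_mul_div, div_mul_eq_mul_div]
    linarith

lemma tendstoProb_varRatio : TendstoProb P atTop (varRatio P W ε L r m m₀ q μ β) 1 := by
  obtain ⟨A, hA, hb, -⟩ := h.exists_label_bound hpos
  obtain ⟨G, -, hG⟩ := h.exists_invProb_le
  have hg : Measurable fun l : Fin (2 * r) → Bool => invProb q (l (lastIdx h.r_pos)) :=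
    (measurable_from_top (f := invProb q)).comp (measurable_pi_apply _)
  have := h.tendstoProb_average (c := fun J => labelMean L r m m₀ μ (β J))
    (fun J => measurable_labelMean) hA (fun J => h.vUp_pos (hpos J)) hb
    (fun J => h.integral_pairError_sq_le (hpos J)) 1 hg (fun l => hG _)
  refine TendstoProb.congr_limit (c := fun _ => 1) tendsto_const_nhds ?_
  convert this using 3 with J ω
  · rw [h.integral_sq_mul_invProb, div_self (h.vUp_pos (hpos J)).ne', varRatio, totalVar]
    simp only [pairLabels_lastIdx]
    rfl

/-- The conditional variance of the noise follows `σ_m²`, which itself need not converge. -/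
lemma tendstoProb_contrast : TendstoProb P atTop (fun J ω =>
    q * (1 - q) * (∑ j ∈ Finset.range (J / 2), pairContrast W ε L r m m₀ q μ β h.r_pos J j ω ^ 2)
        / totalVar P W ε L r m m₀ q μ β J
      - sigmaDeltaSq P W ε L r m m₀ q μ (β J) / vUp P W ε L r m m₀ q μ (β J)) 0 := by
  obtain ⟨A, hA, -, hb⟩ := h.exists_label_bound hpos
  have := h.tendstoProb_average
    (c := fun J => contrastCoeff h.r_pos q (labelMean L r m m₀ μ (β J)))
    (fun J => measurable_contrastCoeff _ _ measurable_labelMean) hA (fun J => h.vUp_pos (hpos J)) hb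
    (fun J => h.integral_pairError_sq_le (hpos J)) (1 / q + 1 / (1 - q))
    (g := fun _ => 1) measurable_const (G := 1) (by simp)
  have h2 := this.map (f := fun x => q * (1 - q) * x) (by fun_prop)
  rw [mul_zero] at h2
  convert h2 using 3 with J ω
  have hqq := h.qq_pos.ne'
  simp only [mul_one]
  rw [h.integral_contrast_sq, totalVar, mul_sub ((q : ℝ) * (1 - q)), ← mul_div_assoc, ← mul_div_assoc,
    mul_div_cancel₀ _ hqq]
  rfl

/-- The inverse probability weights are at most `G`, so `E[Ȳ²] ≥ v_up / G` and the normalized mean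
square stays away from zero, whatever the coefficients. -/
lemma tendsto_real_pairMean_dominated {κ : ℝ} (hκ : 0 < κ) :
    Tendsto (fun J : ℕ => P.real {ω | ¬ ((∀ j ∈ Finset.range (J / 2),
        pairMean W ε L r m m₀ μ β J j ω ^ 2
          ≤ κ * ∑ i ∈ Finset.range (J / 2), pairMean W ε L r m m₀ μ β J i ω ^ 2) ∧
        0 < ∑ i ∈ Finset.range (J / 2), pairMean W ε L r m m₀ μ β J i ω ^ 2)}) atTop (𝓝 0) := by
  obtain ⟨A, hA, hb, -⟩ := h.exists_label_bound hpos
  obtain ⟨G, hG0, hG⟩ := h.exists_invProb_le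
  refine h.tendsto_real_dominated (c := fun J => labelMean L r m m₀ μ (β J))
    (fun J => measurable_labelMean) hA (fun J => h.vUp_pos (hpos J)) hb
    (fun J => h.integral_pairError_sq_le (hpos J)) 1 le_rfl (a := 1 / G) (by positivity)
    (Eventually.of_forall fun J => ?_) hκ
  have hv := h.vUp_pos (hpos J)
  rw [div_le_div_iff₀ hG0 hv, one_mul]
  conv_lhs => rw [← h.integral_sq_mul_invProb]
  have hX : MemLp (pairForm L r m W ε (labelMean L r m m₀ μ (β J)) 1 0) 2 P := by
    refine MemLp.add (MemLp.of_bound (measurable_labelMean.comp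
      (h.measurable_pairLabels 0)).aestronglyMeasurable _
      (Eventually.of_forall fun _ => abs_labelMean_le _)) ((h.memLp_pairError 0).const_mul 1)
  rw [← integral_mul_const]
  refine integral_mono_of_nonneg (Eventually.of_forall fun ω => ?_)
    (hX.integrable_sq.mul_const G) (Eventually.of_forall fun ω => ?_)
  · exact mul_nonneg (sq_nonneg _) (h.invProb_nonneg _)
  · exact mul_le_mul_of_nonneg_left ((le_abs_self _).trans (hG _)) (sq_nonneg _)

/-- Combines `v_up = σ_δ² + δ²` with `μ_m(J)² = J_e δ² / v_up`. A bounded `μ_m(J)` thus forces `σ_m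
→ 1`. -/
lemma sigma_div_eq {J : ℕ} (hJ : 0 < J / 2) :
    sigmaDeltaSq P W ε L r m m₀ q μ (β J) / vUp P W ε L r m m₀ q μ (β J)
      = 1 - muM P W ε L r m m₀ q μ (β J) J ^ 2 * (((J / 2 : ℕ) : ℝ))⁻¹ := by
  have hv := h.vUp_pos (hpos J)
  have hN : (0 : ℝ) < ((J / 2 : ℕ) : ℝ) := by exact_mod_cast hJ
  rw [muM, div_pow, mul_pow, Real.sq_sqrt hv.le, Real.sq_sqrt hN.le,
    div_eq_iff hv.ne', sub_mul, one_mul, h.vUp_eq]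
  rw [h.vUp_eq] at hv
  field_simp
  ring

lemma sigma_div_le_one (J : ℕ) :
    sigmaDeltaSq P W ε L r m m₀ q μ (β J) / vUp P W ε L r m m₀ q μ (β J) ≤ 1 := by
  rw [div_le_one (h.vUp_pos (hpos J)), h.vUp_eq]
  linarith [sq_nonneg (tailSignal L r m m₀ (β J))]

lemma tendsto_sigma_div {l : Filter ℕ} (hl : l ≤ atTop) {b : ℝ}
    (hb : Tendsto (fun J => muM P W ε L r m m₀ q μ (β J) J) l (𝓝 b)) :
    Tendsto (fun J => sigmaDeltaSq P W ε L r m m₀ q μ (β J) / vUp P W ε L r m m₀ q μ (β J)) l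
      (𝓝 1) := by
  have h1 : Tendsto (fun J : ℕ => (((J / 2 : ℕ) : ℝ))⁻¹) l (𝓝 0) :=
    (tendsto_inv_atTop_zero.comp (tendsto_natCast_atTop_atTop.comp tendsto_half_atTop)).mono_left hl
  have h2 : Tendsto (fun J => 1 - muM P W ε L r m m₀ q μ (β J) J ^ 2 * (((J / 2 : ℕ) : ℝ))⁻¹) l
      (𝓝 1) := by
    simpa using ((hb.pow 2).mul h1).const_sub 1
  refine h2.congr' ?_
  filter_upwards [hl (tendsto_half_atTop.eventually_ge_atTop 1)] with J hJ
  exact (h.sigma_div_eq hpos hJ).symm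

/-- Limit law of the observed statistic when `μ_m(J)` converges. -/
lemma tendsto_real_le_obsStat {l : Filter ℕ} (hl : l ≤ atTop) {b : ℝ}
    (hb : Tendsto (fun J => muM P W ε L r m m₀ q μ (β J) J) l (𝓝 b)) (x : ℝ) :
    Tendsto (fun J => P.real {ω | x ≤ obsStat W ε L r m m₀ q μ β J ω}) l (𝓝 (1 - Phi (x - b))) := by
  suffices hs : Tendsto (fun J => P.real {ω | obsStat W ε L r m m₀ q μ β J ω < x}) l
      (𝓝 (Phi (x - b))) by
    refine (hs.const_sub 1).congr fun J => ?_
    rw [← probReal_compl_eq_one_sub (measurableSet_lt (h.measurable_obsStat J) measurable_const)]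
    congr 1
    ext ω
    simp
  obtain ⟨A, hA, -, hbd⟩ := h.exists_label_bound hpos
  have hqq := h.qq_pos
  have hσ := h.tendsto_sigma_div hpos hl hb
  -- The normalized mean square of the weights is `σ_m² / (q(1-q))`. It is eventually at least
  -- `1/2`, since `σ_m² → 1` and `q(1-q) ≤ 1`.
  have hdom {κ : ℝ} (hκ : 0 < κ) := h.tendsto_real_dominated
    (c := fun J => contrastCoeff h.r_pos q (labelMean L r m m₀ μ (β J)))
    (fun J => measurable_contrastCoeff _ _ measurable_labelMean) hA (fun J => h.vUp_pos (hpos J)) hbd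
    (fun J => h.integral_pairError_sq_le (hpos J)) (1 / q + 1 / (1 - q)) hl
    (a := 1 / 2) (by norm_num) (by
      filter_upwards [hσ.eventually_const_lt (show (1 / 2 : ℝ) < 1 by norm_num)] with J hJ
      rw [h.integral_contrast_sq, div_right_comm]
      rw [le_div_iff₀ hqq]
      nlinarith [sq_nonneg ((q : ℝ) - 1 / 2)]) hκ
  have hclt := h.tendsto_real_standardized_le
    (c := fun J => contrastCoeff h.r_pos q (labelMean L r m m₀ μ (β J)))
    (fun J => measurable_contrastCoeff _ _ measurable_labelMean)
    (fun J => contrastCoeff_update _ _ _) (1 / q + 1 / (1 - q)) (fun κ hκ => hdom hκ)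
  have hκ2 : TendstoProb P l (fun J ω => q * (1 - q)
      * (∑ j ∈ Finset.range (J / 2), pairContrast W ε L r m m₀ q μ β h.r_pos J j ω ^ 2)
        / totalVar P W ε L r m m₀ q μ β J) 1 :=
    TendstoProb.congr_limit hσ ((h.tendstoProb_contrast hpos).comp (g := id) hl)
  have hR : TendstoProb P l (varRatio P W ε L r m m₀ q μ β) 1 :=
    (h.tendstoProb_varRatio hpos).comp (g := id) hl
  have hsR : TendstoProb P l (fun J ω => x * √(varRatio P W ε L r m m₀ q μ β J ω)
      - muM P W ε L r m m₀ q μ (β J) J) (x - b) := by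
    have := TendstoProb.map₂ hR (tendstoProb_const (P := P) hb) (f := fun R c => x * √R - c)
      (by fun_prop)
    simpa using this
  -- The event `T < x` says that the standardized noise lies below `(x√R - μ_m)/√k`, where `R` and
  -- `k` tend to 1; this random threshold tends to `x - b`.
  have hB := TendstoProb.map₂ hsR hκ2 (f := fun y k => y / √k) (by
    refine ContinuousAt.div continuousAt_fst
      (Real.continuous_sqrt.continuousAt.comp continuousAt_snd) ?_
    simp)
  rw [Real.sqrt_one, div_one] at hB
  have hev : Tendsto (fun J : ℕ => P.real {_ω : Ω | J / 2 = 0}) l (𝓝 0) := by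
    refine tendsto_const_nhds.congr' ?_
    filter_upwards [hl (tendsto_half_atTop.eventually_ge_atTop 1)] with J hJ
    have : ¬ J / 2 = 0 := by omega
    simp [this]
  refine tendsto_real_of_le_of_tendstoProb hclt continuous_Phi hB
    (real_union_tendsto_zero hev (real_union_tendsto_zero (hdom one_pos)
      (hR (1 / 2) (by norm_num)))) ?_ ?_
  all_goals
    intro J ω hω
    simp only [Set.mem_union, Set.mem_ofPred_eq, not_or, not_not, not_le] at hω
    obtain ⟨hJ, ⟨-, hC⟩, hRω⟩ := hω
    have hJ : 0 < J / 2 := Nat.pos_of_ne_zero hJ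
    have hV := h.totalVar_pos hpos hJ
    have hR0 : 0 < √(varRatio P W ε L r m m₀ q μ β J ω) := by
      refine Real.sqrt_pos.2 ?_
      linarith [(abs_lt.1 hRω).1]
    have hCs := Real.sqrt_pos.2 hC
    have hk : 0 < √((q : ℝ) * (1 - q) * (∑ j ∈ Finset.range (J / 2),
        pairContrast W ε L r m m₀ q μ β h.r_pos J j ω ^ 2) / totalVar P W ε L r m m₀ q μ β J) :=
      Real.sqrt_pos.2 (div_pos (mul_pos hqq hC) hV)
    have hn : noise P W ε L r m m₀ q μ β h.r_pos J ω
        = (∑ j ∈ Finset.range (J / 2), pairContrast W ε L r m m₀ q μ β h.r_pos J j ω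
            * stdLabel q (W ω (lastOddBlock r (j + 1))))
            / √(∑ i ∈ Finset.range (J / 2), pairContrast W ε L r m m₀ q μ β h.r_pos J i ω ^ 2)
          * √((q : ℝ) * (1 - q) * (∑ j ∈ Finset.range (J / 2),
            pairContrast W ε L r m m₀ q μ β h.r_pos J j ω ^ 2)
            / totalVar P W ε L r m m₀ q μ β J) := by
      have hCs' : √(∑ i ∈ Finset.range (J / 2),
        pairContrast W ε L r m m₀ q μ β h.r_pos J i ω ^ 2) ≠ 0 := hCs.ne'
      rw [noise, Real.sqrt_div' _ hV.le, Real.sqrt_mul hqq.le]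
      field_simp
    have hT := h.obsStat_eq_div hpos hJ ω
    rw [hn] at hT
    change _ → _
    intro hE
  · rw [Set.mem_ofPred_eq, hT, div_lt_iff₀ hR0] at hE
    rw [le_div_iff₀ hk]
    have : _ * _ < _ := lt_sub_iff_add_lt'.2 hE
    exact this.le
  · rw [lt_div_iff₀ hk] at hE
    rw [Set.mem_ofPred_eq, hT, div_lt_iff₀ hR0]
    exact lt_sub_iff_add_lt'.1 hE

/-- The noise is tight. -/
lemma tendsto_real_abs_noise_ge {l : Filter ℕ} (hl : l ≤ atTop) {a : ℕ → ℝ}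
    (ha : Tendsto a l atTop) :
    Tendsto (fun J => P.real {ω | a J ≤ |noise P W ε L r m m₀ q μ β h.r_pos J ω|}) l (𝓝 0) := by
  have hqq := h.qq_pos
  have hs := Real.sqrt_pos.2 hqq
  have h1 := ((h.tendstoProb_contrast hpos) 1 one_pos).mono_left hl
  have h2 : Tendsto (fun J => 2 / (q * (1 - q)) / (a J / √((q : ℝ) * (1 - q))) ^ 2) l (𝓝 0) :=
    ((tendsto_pow_atTop two_ne_zero).comp (ha.atTop_div_const hs)).const_div_atTop _
  refine tendsto_zero_of_le_real (fun _ => measureReal_nonneg) ?_ (by simpa using h2.add h1)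
  filter_upwards [hl (tendsto_half_atTop.eventually_ge_atTop 1), ha.eventually_gt_atTop 0]
    with J hJ haJ
  have hV := h.totalVar_pos hpos hJ
  have hsV := Real.sqrt_pos.2 hV
  -- With `K = 2/(q(1-q))`, a sum of squares above `K V` makes the conditional variance ratio exceed
  -- 2. Its centring `σ_m²` is at most 1, so this is a deviation of at least 1.
  have h3 := h.real_abs_weightedSum_ge_le
    (c := fun J => contrastCoeff h.r_pos q (labelMean L r m m₀ μ (β J)))
    (fun J => measurable_contrastCoeff _ _ measurable_labelMean)
    (fun J => contrastCoeff_update _ _ _) (1 / q + 1 / (1 - q)) (J := J) hV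
    (div_pos haJ hs) (K := 2 / (q * (1 - q))) (by positivity)
  refine (measureReal_mono ?_ (measure_ne_top _ _)).trans
    (h3.trans (add_le_add_right (measureReal_mono ?_ (measure_ne_top _ _)) _))
  · intro ω hω
    rw [Set.mem_ofPred_eq, noise, abs_div, abs_mul, abs_of_pos hs, abs_of_pos hsV,
      le_div_iff₀ hsV] at hω
    rw [Set.mem_ofPred_eq, div_mul_eq_mul_div, div_le_iff₀ hs, mul_comm |_|]
    exact hω
  · intro ω hω
    have hω' : 2 / (q * (1 - q)) * totalVar P W ε L r m m₀ q μ β J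
      < ∑ i ∈ Finset.range (J / 2), pairContrast W ε L r m m₀ q μ β h.r_pos J i ω ^ 2 := hω
    rw [Set.mem_ofPred_eq]
    refine le_trans ?_ (le_abs_self _)
    have h4 := h.sigma_div_le_one hpos J
    rw [div_mul_eq_mul_div, div_lt_iff₀ hqq] at hω'
    have : 2 ≤ q * (1 - q) * (∑ j ∈ Finset.range (J / 2),
        pairContrast W ε L r m m₀ q μ β h.r_pos J j ω ^ 2) / totalVar P W ε L r m m₀ q μ β J := by
      rw [le_div_iff₀ hV]; linarith
    linarith

/-- When `√R ≤ 2`, the event `T < x` forces the noise below `2|x| - μ_m`, which tightness excludes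
in the limit. -/
lemma tendsto_real_le_obsStat_of_atTop {l : Filter ℕ} (hl : l ≤ atTop)
    (hb : Tendsto (fun J => muM P W ε L r m m₀ q μ (β J) J) l atTop) (x : ℝ) :
    Tendsto (fun J => P.real {ω | x ≤ obsStat W ε L r m m₀ q μ β J ω}) l (𝓝 1) := by
  suffices hs : Tendsto (fun J => P.real {ω | obsStat W ε L r m m₀ q μ β J ω < x}) l (𝓝 0) by
    have := hs.const_sub 1
    rw [sub_zero] at this
    refine this.congr fun J => ?_
    rw [← probReal_compl_eq_one_sub (measurableSet_lt (h.measurable_obsStat J) measurable_const)]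
    congr 1
    ext ω
    simp
  have hR := ((h.tendstoProb_varRatio hpos) (1 / 2) (by norm_num)).mono_left hl
  have hN := h.tendsto_real_abs_noise_ge hpos hl (tendsto_atTop_add_const_right l (-(2 * |x|)) hb)
  refine real_subset_tendsto_zero ?_ (real_union_tendsto_zero hR hN)
  filter_upwards [hl (tendsto_half_atTop.eventually_ge_atTop 1)] with J hJ ω hω
  by_contra hcon
  simp only [Set.mem_union, Set.mem_ofPred_eq, not_or, not_le] at hcon hω
  obtain ⟨h1, h2⟩ := hcon
  have h3 := abs_lt.1 h1
  have hR0 : 0 < √(varRatio P W ε L r m m₀ q μ β J ω) := Real.sqrt_pos.2 (by linarith)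
  have hR2 : √(varRatio P W ε L r m m₀ q μ β J ω) ≤ 2 := Real.sqrt_le_iff.2 ⟨by norm_num, by linarith⟩
  rw [h.obsStat_eq_div hpos hJ, div_lt_iff₀ hR0] at hω
  have h4 : x * √(varRatio P W ε L r m m₀ q μ β J ω) ≤ 2 * |x| := by
    calc _ ≤ |x| * √(varRatio P W ε L r m m₀ q μ β J ω) :=
          mul_le_mul_of_nonneg_right (le_abs_self x) hR0.le
      _ ≤ |x| * 2 := mul_le_mul_of_nonneg_left hR2 (abs_nonneg _)
      _ = _ := mul_comm _ _
  linarith [neg_abs_le (noise P W ε L r m m₀ q μ β h.r_pos J ω)]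

lemma tendsto_real_le_obsStat_of_atBot {l : Filter ℕ} (hl : l ≤ atTop)
    (hb : Tendsto (fun J => muM P W ε L r m m₀ q μ (β J) J) l atBot) (x : ℝ) :
    Tendsto (fun J => P.real {ω | x ≤ obsStat W ε L r m m₀ q μ β J ω}) l (𝓝 0) := by
  have hR := ((h.tendstoProb_varRatio hpos) (1 / 2) (by norm_num)).mono_left hl
  have hN := h.tendsto_real_abs_noise_ge hpos hl
    (tendsto_atTop_add_const_right l (-(2 * |x|)) (tendsto_neg_atBot_atTop.comp hb))
  refine real_subset_tendsto_zero ?_ (real_union_tendsto_zero hR hN)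
  filter_upwards [hl (tendsto_half_atTop.eventually_ge_atTop 1)] with J hJ ω hω
  by_contra hcon
  simp only [Set.mem_union, Set.mem_ofPred_eq, not_or, not_le, Function.comp_apply] at hcon hω
  obtain ⟨h1, h2⟩ := hcon
  have h3 := abs_lt.1 h1
  have hR0 : 0 < √(varRatio P W ε L r m m₀ q μ β J ω) := Real.sqrt_pos.2 (by linarith)
  have hR2 : √(varRatio P W ε L r m m₀ q μ β J ω) ≤ 2 := Real.sqrt_le_iff.2 ⟨by norm_num, by linarith⟩
  rw [h.obsStat_eq_div hpos hJ, le_div_iff₀ hR0] at hω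
  have h4 : -(2 * |x|) ≤ x * √(varRatio P W ε L r m m₀ q μ β J ω) := by
    have : |x| * √(varRatio P W ε L r m m₀ q μ β J ω) ≤ |x| * 2 :=
      mul_le_mul_of_nonneg_left hR2 (abs_nonneg _)
    have := mul_le_mul_of_nonneg_right (neg_abs_le x) hR0.le
    linarith
  linarith [le_abs_self (noise P W ε L r m m₀ q μ β h.r_pos J ω)]

end IsExperiment

end Statistic


/-! ## The randomization distribution -/

section Randomization

variable {L r m : ℕ} {q : unitInterval} {J : ℕ} {y : ℕ → ℝ} {w : ℕ → Bool} {α x x' : ℝ}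

lemma tStat_redraw (hr : 0 < r) (w' : ℕ → Bool) : tStat L r m q J y (redraw r w w')
    = studentized q (Finset.Icc 1 (J / 2)) (focalMean L r m y)
      (fun j => label (w' (lastOddBlock r j))) := by
  have e (j : ℕ) (hj : j ∈ Finset.Icc 1 (J / 2)) :
      redraw r w w' (lastOddBlock r j) = w' (lastOddBlock r j) :=
    redraw_lastOddBlock hr (Finset.mem_Icc.1 hj).1 w w'
  rw [tStat_eq_studentized, studentized, studentized]
  congr 1
  · exact Finset.sum_congr rfl fun j hj => by rw [e j hj]
  · exact congrArg _ (Finset.sum_congr rfl fun j hj => by rw [e j hj])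

lemma measurable_tStat_redraw (hr : 0 < r) :
    Measurable fun w' : ℕ → Bool => tStat L r m q J y (redraw r w w') := by
  simp only [tStat_redraw hr]
  exact measurable_studentized_label _ _ _

/-- Ties count towards the p-value, so the observed statistic must lie strictly above `x` for the
tail event to miss `{≤ x}`. -/
lemma pValue_le_of_lt (hr : 0 < r)
    (hx : 1 - α ≤ (design q).real {w' | tStat L r m q J y (redraw r w w') ≤ x})
    (hT : x < tStat L r m q J y w) : pValue L r m q J y w ≤ α := by
  have hms : MeasurableSet {w' | tStat L r m q J y (redraw r w w') ≤ x} :=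
    measurableSet_le (measurable_tStat_redraw hr) measurable_const
  have h1 : pValue L r m q J y w
      ≤ (design q).real {w' | tStat L r m q J y (redraw r w w') ≤ x}ᶜ :=
    measureReal_mono fun w' hw' => not_le.2 (hT.trans_le hw')
  rw [probReal_compl_eq_one_sub hms] at h1
  linarith

lemma le_tStat_of_pValue_le (hr : 0 < r)
    (hx : (design q).real {w' | tStat L r m q J y (redraw r w w') ≤ x} < 1 - α)
    (hp : pValue L r m q J y w ≤ α) : x ≤ tStat L r m q J y w := by
  by_contra! hT
  have hms : MeasurableSet {w' | tStat L r m q J y (redraw r w w') ≤ x} :=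
    measurableSet_le (measurable_tStat_redraw hr) measurable_const
  have h1 : (design q).real {w' | tStat L r m q J y (redraw r w w') ≤ x}ᶜ
      ≤ pValue L r m q J y w :=
    measureReal_mono fun w' hw' => by
      simp only [Set.mem_compl_iff, Set.mem_ofPred_eq, not_le] at hw' ⊢
      exact hT.le.trans hw'.le
  rw [probReal_compl_eq_one_sub hms] at h1
  linarith

/-- A level below `1 - α` at `x` bounds from below the set whose infimum is the critical value.
Without such a bound the real `sInf` would carry no information. -/
lemma lt_of_real_lt
    (hx : (design q).real {w' | tStat L r m q J y (redraw r w w') ≤ x} < 1 - α) {t : ℝ}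
    (ht : 1 - α ≤ (design q).real {w' | tStat L r m q J y (redraw r w w') ≤ t}) : x ≤ t := by
  by_contra! hlt
  have : (design q).real {w' | tStat L r m q J y (redraw r w w') ≤ t}
      ≤ (design q).real {w' | tStat L r m q J y (redraw r w w') ≤ x} :=
    measureReal_mono fun w' (hw' : _ ≤ t) => hw'.trans hlt.le
  linarith

lemma criticalValue_le
    (hx' : (design q).real {w' | tStat L r m q J y (redraw r w w') ≤ x'} < 1 - α)
    (hx : 1 - α ≤ (design q).real {w' | tStat L r m q J y (redraw r w w') ≤ x}) :
    criticalValue L r m q α J y w ≤ x :=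
  csInf_le ⟨x', fun _ ht => lt_of_real_lt hx' ht⟩ hx

lemma le_criticalValue
    (hx' : (design q).real {w' | tStat L r m q J y (redraw r w w') ≤ x'} < 1 - α)
    (hx : 1 - α ≤ (design q).real {w' | tStat L r m q J y (redraw r w w') ≤ x}) :
    x' ≤ criticalValue L r m q α J y w :=
  le_csInf ⟨x, hx⟩ fun _ ht => lt_of_real_lt hx' ht

end Randomization

/-! ## Asymptotic power -/

section Power

variable {Ω : Type*} [MeasurableSpace Ω] {P : Measure Ω} [IsProbabilityMeasure P]
  {L r m m₀ : ℕ} {q : unitInterval} {ρ σu : ℝ} {W : Ω → ℕ → Bool} {ε u : ℤ → Ω → ℝ}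
  {μ α : ℝ} {β : ℕ → ℕ → ℝ}

/-- The rejection events `E` agree asymptotically with `z ≤ A`, up to arbitrarily small shifts of
`z`. -/
def IsAsymptoticTest (P : Measure Ω) (A : ℕ → Ω → ℝ) (z : ℝ) (E : ℕ → Set Ω) : Prop :=
  ∀ η > 0, ∃ N : ℕ → Set Ω, Tendsto (fun J => P.real (N J)) atTop (𝓝 0) ∧
    ∀ J, ∀ ω ∉ N J, (z + η ≤ A J ω → ω ∈ E J) ∧ (ω ∈ E J → z - η ≤ A J ω)

/-- Sandwich between thresholds `z ± d/2` and continuity of the limit. Taking `G` constant covers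
the degenerate limits 0 and 1. -/
lemma IsAsymptoticTest.tendsto_real {A : ℕ → Ω → ℝ} {z : ℝ} {E : ℕ → Set Ω}
    (hE : IsAsymptoticTest P A z E) {l : Filter ℕ} (hl : l ≤ atTop) {G : ℝ → ℝ}
    (hG : Continuous G)
    (hA : ∀ x, Tendsto (fun J => P.real {ω | x ≤ A J ω}) l (𝓝 (G x))) :
    Tendsto (fun J => P.real (E J)) l (𝓝 (G z)) := by
  rw [Metric.tendsto_nhds]
  intro e he
  obtain ⟨d, hd, hdG⟩ := Metric.continuousAt_iff.1 hG.continuousAt (e / 3) (by positivity)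
  have hx (s : ℝ) (hs : |s| < d) : |G (z + s) - G z| < e / 3 := by
    have := hdG (x := z + s) (by rwa [Real.dist_eq, add_sub_cancel_left])
    rwa [Real.dist_eq] at this
  have h1 := abs_lt.1 (hx (d / 2) (by rw [abs_of_pos] <;> linarith))
  have h2 := abs_lt.1 (hx (-(d / 2)) (by rw [abs_neg, abs_of_pos] <;> linarith))
  obtain ⟨N, hN, hNE⟩ := hE (d / 2) (by positivity)
  filter_upwards [Metric.tendsto_nhds.1 (hN.mono_left hl) (e / 3) (by positivity),
    Metric.tendsto_nhds.1 (hA (z + d / 2)) (e / 3) (by positivity),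
    Metric.tendsto_nhds.1 (hA (z + -(d / 2))) (e / 3) (by positivity)] with J h3 h4 h5
  rw [Real.dist_eq] at h3 h4 h5 ⊢
  have h3 := abs_lt.1 h3
  have h4 := abs_lt.1 h4
  have h5 := abs_lt.1 h5
  have hle : P.real (E J) ≤ P.real {ω | z + -(d / 2) ≤ A J ω} + P.real (N J) :=
    real_le_add fun ω hω => by
      by_cases hn : ω ∈ N J
      · exact Or.inr hn
      · exact Or.inl ((hNE J ω hn).2 hω)
  have hge : P.real {ω | z + d / 2 ≤ A J ω} ≤ P.real (E J) + P.real (N J) :=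
    real_le_add fun ω hω => by
      by_cases hn : ω ∈ N J
      · exact Or.inr hn
      · exact Or.inl ((hNE J ω hn).1 hω)
  rw [abs_lt]
  constructor <;> linarith

namespace IsExperiment

variable (h : IsExperiment P L r m m₀ q ρ σu W ε u)
  (hpos : ∀ J, 0 < sigmaDeltaSq P W ε L r m m₀ q μ (β J))
include h hpos

/-- The randomization distribution is asymptotically standard normal. -/
lemma exists_negligible_randomization (hα0 : 0 < α) (hα1 : α < 1) {η : ℝ} (hη : 0 < η) :
    ∃ N : ℕ → Set Ω, Tendsto (fun J => P.real (N J)) atTop (𝓝 0) ∧ ∀ J, ∀ ω ∉ N J,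
      (design q).real {w' | tStat L r m q J (outcome L m₀ μ (β J) (fun t => ε t ω) (W ω))
        (redraw r (W ω) w') ≤ zQuantile (1 - α) - η} < 1 - α ∧
      1 - α ≤ (design q).real {w' | tStat L r m q J (outcome L m₀ μ (β J) (fun t => ε t ω) (W ω))
        (redraw r (W ω) w') ≤ zQuantile (1 - α) + η} := by
  set z := zQuantile (1 - α)
  have hz : Phi z = 1 - α := Phi_zQuantile (by linarith) (by linarith)
  have hlo : Phi (z - η) < 1 - α := hz ▸ strictMono_Phi (by linarith)
  have hhi : 1 - α < Phi (z + η) := hz ▸ strictMono_Phi (by linarith)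
  -- The gaps between `Φ(z ± η)` and `1 - α` serve as tolerances; the lower one is halved because a
  -- strict inequality is wanted there.
  obtain ⟨κ₁, hκ₁, hb₁⟩ := exists_weight_bound_studentized h.q_pos h.q_lt_one
    (lastOddBlock_injective h.r_pos) (z - η) (half_pos (sub_pos.2 hlo))
  obtain ⟨κ₂, hκ₂, hb₂⟩ := exists_weight_bound_studentized h.q_pos h.q_lt_one
    (lastOddBlock_injective h.r_pos) (z + η) (sub_pos.2 hhi)
  refine ⟨_, real_union_tendsto_zero (h.tendsto_real_pairMean_dominated hpos hκ₁)
    (h.tendsto_real_pairMean_dominated hpos hκ₂), fun J ω hω => ?_⟩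
  simp only [Set.mem_union, Set.mem_ofPred_eq, not_or, not_not] at hω
  obtain ⟨⟨h1, h0⟩, h2, -⟩ := hω
  set y := outcome L m₀ μ (β J) (fun t => ε t ω) (W ω) with hy
  have hS : ∑ j ∈ Finset.Icc 1 (J / 2), focalMean L r m y j ^ 2
      = ∑ j ∈ Finset.range (J / 2), pairMean W ε L r m m₀ μ β J j ω ^ 2 := by
    rw [sum_Icc_one_eq_sum_range]
    simp only [hy, h.focalMean_outcome_eq]
  have hall {κ : ℝ} (hκ : ∀ j ∈ Finset.range (J / 2), pairMean W ε L r m m₀ μ β J j ω ^ 2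
      ≤ κ * ∑ i ∈ Finset.range (J / 2), pairMean W ε L r m m₀ μ β J i ω ^ 2) :
      ∀ j ∈ Finset.Icc 1 (J / 2), focalMean L r m y j ^ 2
        ≤ κ * ∑ i ∈ Finset.Icc 1 (J / 2), focalMean L r m y i ^ 2 := by
    intro j hj
    rw [Finset.mem_Icc] at hj
    obtain ⟨i, rfl⟩ : ∃ i, j = i + 1 := ⟨j - 1, by omega⟩
    rw [hS, hy, h.focalMean_outcome_eq]
    exact hκ i (Finset.mem_range.2 (by omega))
  have h0' : 0 < ∑ j ∈ Finset.Icc 1 (J / 2), focalMean L r m y j ^ 2 := hS ▸ h0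
  have hc₁ := abs_le.1 (hb₁ _ _ (hall h1) h0')
  have hc₂ := abs_le.1 (hb₂ _ _ (hall h2) h0')
  simp only [tStat_redraw h.r_pos]
  constructor <;> linarith [hc₁.2, hc₂.1]

lemma isAsymptoticTest_pValue (hα0 : 0 < α) (hα1 : α < 1) :
    IsAsymptoticTest P (obsStat W ε L r m m₀ q μ β) (zQuantile (1 - α)) (fun J =>
      {ω | pValue L r m q J (outcome L m₀ μ (β J) (fun t => ε t ω) (W ω)) (W ω) ≤ α}) := by
  intro η hη
  obtain ⟨N, hN, hNb⟩ := h.exists_negligible_randomization hpos hα0 hα1 (half_pos hη)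
  refine ⟨N, hN, fun J ω hω => ⟨fun hT => ?_, fun hE => ?_⟩⟩
  · exact pValue_le_of_lt h.r_pos (hNb J ω hω).2 (lt_of_lt_of_le (by linarith) hT)
  · exact le_trans (by linarith) (le_tStat_of_pValue_le h.r_pos (hNb J ω hω).1 hE)

lemma isAsymptoticTest_criticalValue (hα0 : 0 < α) (hα1 : α < 1) :
    IsAsymptoticTest P (obsStat W ε L r m m₀ q μ β) (zQuantile (1 - α)) (fun J =>
      {ω | criticalValue L r m q α J (outcome L m₀ μ (β J) (fun t => ε t ω) (W ω)) (W ω)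
        ≤ tStat L r m q J (outcome L m₀ μ (β J) (fun t => ε t ω) (W ω)) (W ω)}) := by
  intro η hη
  obtain ⟨N, hN, hNb⟩ := h.exists_negligible_randomization hpos hα0 hα1 hη
  refine ⟨N, hN, fun J ω hω => ⟨fun hT => ?_, fun hE => ?_⟩⟩
  · exact (criticalValue_le (hNb J ω hω).1 (hNb J ω hω).2).trans hT
  · exact (le_criticalValue (hNb J ω hω).1 (hNb J ω hω).2).trans hE

lemma sigmaM_pos (J : ℕ) : 0 < sigmaM P W ε L r m m₀ q μ (β J) :=
  Real.sqrt_pos.2 (div_pos (hpos J) (h.vUp_pos (hpos J)))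

lemma sigmaM_le_one (J : ℕ) : sigmaM P W ε L r m m₀ q μ (β J) ≤ 1 :=
  Real.sqrt_le_one.2 (h.sigma_div_le_one hpos J)

lemma tendsto_powerApprox {l : Filter ℕ} (hl : l ≤ atTop) {b : ℝ}
    (hb : Tendsto (fun J => muM P W ε L r m m₀ q μ (β J) J) l (𝓝 b)) :
    Tendsto (fun J => powerApprox P W ε L r m m₀ q μ (β J) α J) l
      (𝓝 (1 - Phi (zQuantile (1 - α) - b))) := by
  have h1 : Tendsto (fun J => sigmaM P W ε L r m m₀ q μ (β J)) l (𝓝 1) := by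
    have := (h.tendsto_sigma_div hpos hl hb).sqrt
    rwa [Real.sqrt_one] at this
  have h2 := ((hb.const_sub (zQuantile (1 - α))).div h1 one_ne_zero)
  rw [div_one] at h2
  exact ((continuous_Phi.tendsto _).comp h2).const_sub 1

/-- As `0 < σ_m ≤ 1`, dividing by `σ_m` only moves a negative argument further out, so no lower
bound on `σ_m` is needed. -/
lemma tendsto_powerApprox_of_atTop {l : Filter ℕ}
    (hb : Tendsto (fun J => muM P W ε L r m m₀ q μ (β J) J) l atTop) :
    Tendsto (fun J => powerApprox P W ε L r m m₀ q μ (β J) α J) l (𝓝 1) := by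
  have h1 : Tendsto (fun J => zQuantile (1 - α) - muM P W ε L r m m₀ q μ (β J) J) l atBot :=
    tendsto_atBot_add_const_left l _ (tendsto_neg_atTop_atBot.comp hb)
  have h2 : Tendsto (fun J => (zQuantile (1 - α) - muM P W ε L r m m₀ q μ (β J) J)
      / sigmaM P W ε L r m m₀ q μ (β J)) l atBot := by
    refine tendsto_atBot_mono' l ?_ h1
    filter_upwards [h1.eventually_le_atBot 0] with J hJ
    rw [div_le_iff₀ (h.sigmaM_pos hpos J)]
    nlinarith [h.sigmaM_le_one hpos J]
  simpa [powerApprox] using (tendsto_Phi_atBot.comp h2).const_sub 1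

lemma tendsto_powerApprox_of_atBot {l : Filter ℕ}
    (hb : Tendsto (fun J => muM P W ε L r m m₀ q μ (β J) J) l atBot) :
    Tendsto (fun J => powerApprox P W ε L r m m₀ q μ (β J) α J) l (𝓝 0) := by
  have h1 : Tendsto (fun J => zQuantile (1 - α) - muM P W ε L r m m₀ q μ (β J) J) l atTop :=
    tendsto_atTop_add_const_left l _ (tendsto_neg_atBot_atTop.comp hb)
  have h2 : Tendsto (fun J => (zQuantile (1 - α) - muM P W ε L r m m₀ q μ (β J) J)
      / sigmaM P W ε L r m m₀ q μ (β J)) l atTop := by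
    refine tendsto_atTop_mono' l ?_ h1
    filter_upwards [h1.eventually_ge_atTop 0] with J hJ
    rw [le_div_iff₀ (h.sigmaM_pos hpos J)]
    nlinarith [h.sigmaM_le_one hpos J]
  simpa [powerApprox] using (tendsto_Phi_atTop.comp h2).const_sub 1

/-- Every asymptotic test based on the observed statistic has the approximate power. -/
lemma tendsto_real_sub_powerApprox {E : ℕ → Set Ω}
    (hE : IsAsymptoticTest P (obsStat W ε L r m m₀ q μ β) (zQuantile (1 - α)) E) :
    Tendsto (fun J => P.real (E J) - powerApprox P W ε L r m m₀ q μ (β J) α J) atTop (𝓝 0) := by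
  refine tendsto_of_subseq_tendsto fun ns hns => ?_
  -- The extended reals are compact, so every subsequence has a further one along which `μ_m(J)`
  -- converges, possibly to an infinite limit.
  obtain ⟨a, φ, hφ, ha⟩ := CompactSpace.tendsto_subseq
    (fun n => ((muM P W ε L r m m₀ q μ (β (ns n)) (ns n) : ℝ) : EReal))
  refine ⟨φ, ?_⟩
  have hl : map (fun n => ns (φ n)) atTop ≤ atTop := hns.comp hφ.tendsto_atTop
  change Tendsto ((fun J => P.real (E J) - powerApprox P W ε L r m m₀ q μ (β J) α J)
    ∘ fun n => ns (φ n)) atTop (𝓝 0)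
  rw [← tendsto_map'_iff]
  induction a with
  | bot =>
    have hb : Tendsto (fun J => muM P W ε L r m m₀ q μ (β J) J)
        (map (fun n => ns (φ n)) atTop) atBot :=
      tendsto_map'_iff.2 (EReal.tendsto_coe_nhds_bot_iff.1 ha)
    simpa using (hE.tendsto_real hl continuous_const
      (h.tendsto_real_le_obsStat_of_atBot hpos hl hb)).sub (h.tendsto_powerApprox_of_atBot hpos hb)
  | top =>
    have hb : Tendsto (fun J => muM P W ε L r m m₀ q μ (β J) J)
        (map (fun n => ns (φ n)) atTop) atTop :=
      tendsto_map'_iff.2 (EReal.tendsto_coe_nhds_top_iff.1 ha)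
    simpa using (hE.tendsto_real hl continuous_const
      (h.tendsto_real_le_obsStat_of_atTop hpos hl hb)).sub (h.tendsto_powerApprox_of_atTop hpos hb)
  | coe b =>
    have hb : Tendsto (fun J => muM P W ε L r m m₀ q μ (β J) J)
        (map (fun n => ns (φ n)) atTop) (𝓝 b) :=
      tendsto_map'_iff.2 (EReal.tendsto_coe.1 ha)
    have hc : Continuous fun x => 1 - Phi (x - b) :=
      continuous_const.sub (continuous_Phi.comp (continuous_id.sub continuous_const))
    simpa using (hE.tendsto_real hl hc (h.tendsto_real_le_obsStat hpos hl hb)).sub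
      (h.tendsto_powerApprox (α := α) hpos hl hb)

end IsExperiment

end Power

end Switchback



/-! ### The power approximation for both versions of the test. -/

theorem proposition3 {Ω : Type*} [MeasurableSpace Ω] (P : Measure Ω) [IsProbabilityMeasure P]
    (L r m m₀ : ℕ) (q : unitInterval) (μ ρ σu α : ℝ)
    -- the lag coefficients may vary with the number `J` of sections
    (β : ℕ → ℕ → ℝ)
    (W : Ω → ℕ → Bool) (ε u : ℤ → Ω → ℝ)
    (hq0 : 0 < (q : ℝ)) (hq1 : (q : ℝ) < 1)
    (hα0 : 0 < α) (hα1 : α < 1)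
    (hm : m < m₀) (hm₀ : m₀ ≤ r * L)
    (hW : Measurable W) (hWlaw : P.map W = design q)
    (hρ : |ρ| < 1) (hε : IsStationaryAR1 P ρ σu ε u)
    (hind : IndepFun W (fun ω t => ε t ω) P)
    -- nondegeneracy, so that `σ_m` is positive (automatic when `σu ≠ 0`)
    (hnd : ∀ J, 0 < sigmaDeltaSq P W ε L r m m₀ q μ (β J)) :
    -- the test rejecting when the randomization p-value is at most `α`
    Tendsto (fun J : ℕ =>
        P.real {ω | pValue L r m q J (outcome L m₀ μ (β J) (fun t => ε t ω) (W ω)) (W ω) ≤ α}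
          - powerApprox P W ε L r m m₀ q μ (β J) α J) atTop (𝓝 0) ∧
    -- the test rejecting when the statistic reaches the randomization critical value
    Tendsto (fun J : ℕ =>
        P.real {ω | criticalValue L r m q α J
              (outcome L m₀ μ (β J) (fun t => ε t ω) (W ω)) (W ω)
            ≤ tStat L r m q J (outcome L m₀ μ (β J) (fun t => ε t ω) (W ω)) (W ω)}
          - powerApprox P W ε L r m m₀ q μ (β J) α J) atTop (𝓝 0) := by
  have h : IsExperiment P L r m m₀ q ρ σu W ε u :=
    ⟨hq0, hq1, hm, hm₀, hW, hWlaw, hρ, hε, hind⟩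
  exact ⟨h.tendsto_real_sub_powerApprox hnd (h.isAsymptoticTest_pValue hnd hα0 hα1),
    h.tendsto_real_sub_powerApprox hnd (h.isAsymptoticTest_criticalValue hnd hα0 hα1)⟩
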